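/- A Gauss diagram on $k$ strands consists of $k$ oriented intervals and finitely many signed arrows (oriented chords) with pairwise disjoint endpoints on them; diagrams are taken up to isotopy. The Reidemeister moves are the following local moves and their inverses. RI: remove an arrow of any sign whose two ends are neighbours on a strand. RII: remove two arrows of opposite sign whose tails are neighbours and whose heads are neighbours. RIII: for three distinct arrows $a,b,c$ of the same sign, running between three pieces of strands from the first to the second, from the first to the third and from the second to the third, respectively, whose ends are consecutive in the order $(a,b)$, $(a,c)$, $(b,c)$ on the three pieces, exchange the two ends on each piece. A long virtual knot is a class of Gauss diagrams on one interval up to Reidemeister moves. Let $PV_k$ be the pure virtual braid group with generators $\mu_{ij}$ ($1\le i\ne j\le k$) and relations $\mu_{ij}\mu_{il}\mu_{jl}=\mu_{jl}\mu_{il}\mu_{ij}$ ($i,j,l$ distinct) and $\mu_{ij}\mu_{lm}=\mu_{lm}\mu_{ij}$ ($\{i,j\}\cap\{l,m\}=\emptyset$). A word in the $\mu_{ij}^{\pm1}$ is drawn as a Gauss diagram on $k$ strands oriented from top to bottom, $\mu_{ij}^{\varepsilon}$ being a horizontal arrow of sign $\varepsilon$ from strand $i$ to strand $j$. Let $\Gamma_1(G)=G$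 and $\Gamma_{n}(G)=[\Gamma_{n-1}(G),G]$. A Gauss diagram $T$ on $k$ strands is attached to a Gauss diagram $D$ on the interval by embedding the $k$ strands disjointly in the interval of $D$, away from the endpoints of the arrows of $D$, and adding the arrows of $T$ to $D$. A strand may be embedded against the orientation of the interval, and the sign of an arrow then changes once for each of its ends that lies on such a strand. For $n\ge1$, an $L_n$-move attaches to a Gauss diagram, for some $k\geq 1$, a diagram of an element $h\in\Gamma_n(PV_k)$ with $h\notin\Gamma_{n+1}(PV_k)$. The $L_n$-equivalence is the equivalence relation generated by $L_n$-moves and Reidemeister moves. For $n\ge0$, a Gauss diagram $T$ on $k$ strands is $n$-trivial if there are $n+1$ non-empty, pairwise disjoint sets $A_1,\dots,A_{n+1}$ of arrows of $T$ such that, for every non-empty subfamily, removing from $T$ all arrows that belong to a set of the subfamily gives a diagram that becomes the diagram without arrows by a sequence of RII moves and their inverses. For $n\ge1$, an $n$-variation attaches to a Gauss diagram an $(n-1)$-trivial Gauss diagram on several strands. For $n\ge0$, the $n$-equivalence (Goussarov–Polyak–Viro) is the equivalence relation generated by $(n+1)$-variations and Reidemeister moves. Theorem. For every $n\ge1$,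 two long virtual knots are $L_n$-equivalent if and only if they are $(n-1)$-equivalent. -/

import Mathlib

/-! ## Gauss diagrams on intervals -/

/-- An endpoint of an arrow: the label of the arrow, and `false` for its tail, `true` for its
head. -/
abbrev ArrowEnd := ℕ × Bool

/-- The tail of the arrow labelled `a`. -/
abbrev ArrowEnd.tail (a : ℕ) : ArrowEnd := (a, false)

/-- The head of the arrow labelled `a`. -/
abbrev ArrowEnd.head (a : ℕ) : ArrowEnd := (a, true)

/-- A Gauss diagram on `k` strands (oriented intervals): finitely many signed arrows, and for each
strand the list of arrow endpoints met when running along it. Every arrow has exactly one tail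
and exactly one head. Labels of arrows carry no meaning (see `GaussDiagram.Same`). -/
structure GaussDiagram (k : ℕ) where
  /-- the labels of the arrows -/
  arrows : Finset ℕ
  /-- the signs of the arrows (the value at a label that is not used is irrelevant) -/
  sign : ℕ → ℤˣ
  /-- the endpoints on each strand, in the order of the orientation -/
  strand : Fin k → List ArrowEnd
  /-- each end of each arrow occurs exactly once, and nothing else occurs -/
  count_eq : ∀ x : ArrowEnd, ∑ i, (strand i).count x = if x.1 ∈ arrows then 1 else 0

namespace GaussDiagram

variable {k : ℕ}

/-- The two data describe the same Gauss diagram: they differ by a renaming of the arrows. -/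
def Same (D D' : GaussDiagram k) : Prop :=
  ∃ τ : Equiv.Perm ℕ, (∀ i, D'.strand i = (D.strand i).map (fun x => (τ x.1, x.2))) ∧
    ∀ a ∈ D.arrows, D'.sign (τ a) = D.sign a

/-- The Gauss diagram obtained by removing all arrows whose label belongs to `S`. -/
def remove (D : GaussDiagram k) (S : Finset ℕ) : GaussDiagram k where
  arrows := D.arrows \ S
  sign := D.sign
  strand i := (D.strand i).filter (fun x => x.1 ∉ S)
  count_eq x := by
    by_cases h : x.1 ∈ S
    · rw [if_neg (by simp [h])]
      refine Finset.sum_eq_zero fun i _ => List.count_eq_zero.2 ?_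
      simp [h]
    · have h1 : ∀ i, ((D.strand i).filter (fun x => x.1 ∉ S)).count x = (D.strand i).count x :=
        fun i => List.count_filter (by simpa using h)
      simp only [h1, D.count_eq x, Finset.mem_sdiff, h, not_false_eq_true, and_true]

/-- The endpoint `y` comes immediately after the endpoint `x` on some strand. -/
def Next (D : GaussDiagram k) (x y : ArrowEnd) : Prop := ∃ i, [x, y] <:+: D.strand i

/-- The endpoints `x` and `y` are neighbours on some strand. -/
def Adjacent (D : GaussDiagram k) (x y : ArrowEnd) : Prop := D.Next x y ∨ D.Next y x

/-- First Reidemeister move: an arrow whose two ends are neighbours is removed. -/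
def ReidemeisterI (D D' : GaussDiagram k) : Prop :=
  ∃ a, D.Adjacent (ArrowEnd.tail a) (ArrowEnd.head a) ∧ D' = D.remove {a}

/-- Second Reidemeister move: two arrows of opposite sign whose tails are neighbours and whose
heads are neighbours are removed. -/
def ReidemeisterII (D D' : GaussDiagram k) : Prop :=
  ∃ a b, D.Adjacent (ArrowEnd.tail a) (ArrowEnd.tail b) ∧
    D.Adjacent (ArrowEnd.head a) (ArrowEnd.head b) ∧ D.sign a = - D.sign b ∧ D' = D.remove {a, b}

/-- Third Reidemeister move: three arrows `a`, `b`, `c` of the same sign run between three pieces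
of strands, `a` from the first to the second, `b` from the first to the third and `c` from the
second to the third, and their ends are consecutive on each piece in the order `(a, b)`, `(a, c)`,
`(b, c)`. The order of the two ends is exchanged on each of the three pieces. -/
def ReidemeisterIII (D D' : GaussDiagram k) : Prop :=
  ∃ a b c, a ≠ b ∧ a ≠ c ∧ b ≠ c ∧
    D.Next (ArrowEnd.tail a) (ArrowEnd.tail b) ∧ D.Next (ArrowEnd.head a) (ArrowEnd.tail c) ∧
    D.Next (ArrowEnd.head b) (ArrowEnd.head c) ∧ D.sign a = D.sign b ∧ D.sign b = D.sign c ∧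
    D'.sign = D.sign ∧
    ∀ i, D'.strand i = (D.strand i).map
      (Equiv.swap (ArrowEnd.tail a) (ArrowEnd.tail b) *
        Equiv.swap (ArrowEnd.head a) (ArrowEnd.tail c) *
        Equiv.swap (ArrowEnd.head b) (ArrowEnd.head c))

/-- One of the three Reidemeister moves. -/
def ReidemeisterMove (D D' : GaussDiagram k) : Prop :=
  ReidemeisterI D D' ∨ ReidemeisterII D D' ∨ ReidemeisterIII D D'

/-- Equivalence of Gauss diagrams: a finite sequence of Reidemeister moves and their inverses. -/
def Equivalent : GaussDiagram k → GaussDiagram k → Prop :=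
  Relation.EqvGen fun D D' => Same D D' ∨ ReidemeisterMove D D'

/-- The diagram becomes the diagram without arrows by a sequence of second Reidemeister moves and
their inverses. -/
def TrivialUpToRII (D : GaussDiagram k) : Prop :=
  ∃ E : GaussDiagram k, E.arrows = ∅ ∧
    Relation.EqvGen (fun D D' => Same D D' ∨ ReidemeisterII D D') D E

/-! ## Attaching a Gauss diagram on several strands to a Gauss diagram on the interval -/

/-- The strands `i` with `r i = true` get the opposite orientation. As for crossings of oriented
strands, the sign of an arrow changes once for each of its two ends that lies on such a
strand. -/
def reorient (T : GaussDiagram k) (r : Fin k → Bool) : GaussDiagram k where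
  arrows := T.arrows
  sign a := T.sign a *
    ∏ i, if r i then (-1) ^ ((T.strand i).countP fun x => x.1 = a) else 1
  strand i := if r i then (T.strand i).reverse else T.strand i
  count_eq x := by
    rw [← T.count_eq x]
    refine Finset.sum_congr rfl fun i _ => ?_
    split <;> simp

/-- An embedding of `k` strands in the interval of `D` that avoids all endpoints of arrows, up to
isotopy: the strand `order i` is the `i`-th one that is met along the interval, the endpoints of
`D` between consecutive strands are listed by `block`, and `reversed` tells which strands are
embedded against the orientation of the interval. -/
structure StrandEmbedding (D : GaussDiagram 1) (k : ℕ) where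
  /-- the order of the strands along the interval -/
  order : Equiv.Perm (Fin k)
  /-- the endpoints of arrows of `D` before, between and after the strands -/
  block : Fin (k + 1) → List ArrowEnd
  /-- together the blocks are all of the interval of `D` -/
  flatten_block : (List.ofFn block).flatten = D.strand 0
  /-- the strands that run against the orientation of the interval -/
  reversed : Fin k → Bool

/-- Relabelling of the arrows of the first diagram when two diagrams are put together. -/
def oldEnd (x : ArrowEnd) : ArrowEnd := (2 * x.1, x.2)

/-- Relabelling of the arrows of the second diagram when two diagrams are put together. -/
def newEnd (x : ArrowEnd) : ArrowEnd := (2 * x.1 + 1, x.2)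

theorem oldEnd_injective : Function.Injective oldEnd := by
  rintro ⟨a, s⟩ ⟨b, t⟩ h
  simp only [oldEnd, Prod.mk.injEq] at h ⊢
  exact ⟨by omega, h.2⟩

theorem newEnd_injective : Function.Injective newEnd := by
  rintro ⟨a, s⟩ ⟨b, t⟩ h
  simp only [newEnd, Prod.mk.injEq] at h ⊢
  exact ⟨by omega, h.2⟩

theorem oldEnd_ne_newEnd (x y : ArrowEnd) : oldEnd x ≠ newEnd y := by
  intro h
  have := congrArg Prod.fst h
  simp only [oldEnd, newEnd] at this
  omega

theorem count_map_newEnd_oldEnd (l : List ArrowEnd) (x : ArrowEnd) :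
    (l.map newEnd).count (oldEnd x) = 0 := by
  refine List.count_eq_zero.2 fun h => ?_
  obtain ⟨y, -, hy⟩ := List.mem_map.1 h
  exact oldEnd_ne_newEnd x y hy.symm

theorem count_map_oldEnd_newEnd (l : List ArrowEnd) (x : ArrowEnd) :
    (l.map oldEnd).count (newEnd x) = 0 := by
  refine List.count_eq_zero.2 fun h => ?_
  obtain ⟨y, -, hy⟩ := List.mem_map.1 h
  exact oldEnd_ne_newEnd y x hy

theorem count_flatten_ofFn {m : ℕ} (f : Fin m → List ArrowEnd) (x : ArrowEnd) :
    (List.ofFn f).flatten.count x = ∑ i, (f i).count x := by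
  rw [List.count_flatten, List.map_ofFn, List.sum_ofFn]
  rfl

/-- The Gauss diagram obtained from `D` by attaching the Gauss diagram `T` on `k` strands along
the embedding `e` of its strands. -/
def attach (D : GaussDiagram 1) (T : GaussDiagram k) (e : StrandEmbedding D k) :
    GaussDiagram 1 where
  arrows := D.arrows.image (fun a => 2 * a) ∪ T.arrows.image (fun a => 2 * a + 1)
  sign a := if a % 2 = 0 then D.sign (a / 2) else (T.reorient e.reversed).sign (a / 2)
  strand _ :=
    (List.ofFn fun i : Fin k => (e.block i.castSucc).map oldEnd ++
      ((T.reorient e.reversed).strand (e.order i)).map newEnd).flatten ++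
      (e.block (Fin.last k)).map oldEnd
  count_eq := by
    rintro ⟨a, s⟩
    simp only [Finset.univ_unique, Finset.sum_const, Finset.card_singleton, one_smul,
      List.count_append, count_flatten_ofFn]
    obtain ⟨b, rfl | rfl⟩ := Nat.even_or_odd' a
    · change (∑ i : Fin k, (_ + _)) + ((e.block (Fin.last k)).map oldEnd).count (oldEnd (b, s)) = _
      have h := D.count_eq (b, s)
      rw [Fin.sum_univ_one, ← e.flatten_block, count_flatten_ofFn, Fin.sum_univ_castSucc] at h
      have h1 : ∀ l : List ArrowEnd, (l.map oldEnd).count (2 * b, s) = l.count (b, s) :=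
        fun l => List.count_map_of_injective l oldEnd oldEnd_injective (b, s)
      have h2 : ∀ l : List ArrowEnd, (l.map newEnd).count (2 * b, s) = 0 :=
        fun l => count_map_newEnd_oldEnd l (b, s)
      have h3 : oldEnd (b, s) = (2 * b, s) := rfl
      simp only [h3, h1, h2, add_zero]
      rw [h]
      have h4 : (2 * b ∈ D.arrows.image (fun a => 2 * a) ∪ T.arrows.image (fun a => 2 * a + 1)) ↔
          b ∈ D.arrows := by
        simp only [Finset.mem_union, Finset.mem_image]
        constructor
        · rintro (⟨c, hc, h⟩ | ⟨c, hc, h⟩)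
          · obtain rfl : c = b := by omega
            exact hc
          · omega
        · exact fun h => Or.inl ⟨b, h, rfl⟩
      simp only [h4]
    · have h := (T.reorient e.reversed).count_eq (b, s)
      have h1 : ∀ l : List ArrowEnd, (l.map newEnd).count (2 * b + 1, s) = l.count (b, s) :=
        fun l => List.count_map_of_injective l newEnd newEnd_injective (b, s)
      have h2 : ∀ l : List ArrowEnd, (l.map oldEnd).count (2 * b + 1, s) = 0 :=
        fun l => count_map_oldEnd_newEnd l (b, s)
      simp only [h1, h2, add_zero, zero_add]
      rw [Equiv.sum_comp e.order (fun i => ((T.reorient e.reversed).strand i).count (b, s)), h]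
      have h4 : (2 * b + 1 ∈
          D.arrows.image (fun a => 2 * a) ∪ T.arrows.image (fun a => 2 * a + 1)) ↔
          b ∈ (T.reorient e.reversed).arrows := by
        simp only [Finset.mem_union, Finset.mem_image, reorient]
        constructor
        · rintro (⟨c, hc, h⟩ | ⟨c, hc, h⟩)
          · omega
          · obtain rfl : c = b := by omega
            exact hc
        · exact fun h => Or.inr ⟨b, h, rfl⟩
      simp only [h4]

end GaussDiagram

/-! ## The pure virtual braid group -/

/-- Indices of the generators `μ i j`, `i ≠ j`, of the pure virtual braid group. -/
abbrev PVGen (k : ℕ) := {p : Fin k × Fin k // p.1 ≠ p.2}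

/-- The letter `μ i j` of the free group on the generators. -/
def pvLetter {k : ℕ} (i j : Fin k) (h : i ≠ j) : FreeGroup (PVGen k) := FreeGroup.of ⟨(i, j), h⟩

/-- The relators of the pure virtual braid group:
`μ i j * μ i l * μ j l = μ j l * μ i l * μ i j` for distinct `i`, `j`, `l`, and
`μ i j * μ l m = μ l m * μ i j` if `{i, j}` and `{l, m}` are disjoint. -/
def pvRelators (k : ℕ) : Set (FreeGroup (PVGen k)) :=
  {r | ∃ (i j l : Fin k) (hij : i ≠ j) (hil : i ≠ l) (hjl : j ≠ l),
    r = pvLetter i j hij * pvLetter i l hil * pvLetter j l hjl *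
      (pvLetter j l hjl * pvLetter i l hil * pvLetter i j hij)⁻¹} ∪
  {r | ∃ (i j l m : Fin k) (hij : i ≠ j) (hlm : l ≠ m),
    Disjoint ({i, j} : Set (Fin k)) {l, m} ∧
    r = pvLetter i j hij * pvLetter l m hlm * (pvLetter l m hlm * pvLetter i j hij)⁻¹}

/-- The pure virtual braid group on `k` strands. -/
abbrev PureVirtualBraidGroup (k : ℕ) := PresentedGroup (pvRelators k)

/-- `Γ_n(G)` for `n ≥ 1`, with `Γ_1(G) = G` and `Γ_{n+1}(G) = [Γ_n(G), G]`. -/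
def lowerCentralSubgroup (G : Type*) [Group G] (n : ℕ) : Subgroup G :=
  (⊤ : Subgroup G).lowerCentralSeries (n - 1)

/-- A diagram of a pure virtual braid, read from top to bottom: a word in the letters `μ i j`
(second component `true`) and their inverses (second component `false`). -/
abbrev PVWord (k : ℕ) := List (PVGen k × Bool)

namespace PVWord

variable {k : ℕ}

/-- The element of the pure virtual braid group that a word represents. -/
def toGroup (w : PVWord k) : PureVirtualBraidGroup k :=
  PresentedGroup.mk (pvRelators k) (FreeGroup.mk w)

/-- The endpoints on the strand `i`, from top to bottom. The arrow of a letter is labelled by the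
number of letters after it. -/
def strand (i : Fin k) : PVWord k → List ArrowEnd
  | [] => []
  | x :: w =>
    (if x.1.1.1 = i then [ArrowEnd.tail w.length]
      else if x.1.1.2 = i then [ArrowEnd.head w.length] else []) ++ strand i w

/-- The sign of the arrow labelled `a`: `1` for a letter `μ i j`, `-1` for its inverse. -/
def sign : PVWord k → ℕ → ℤˣ
  | [], _ => 1
  | x :: w, a => if a = w.length then (if x.2 then 1 else -1) else sign w a

theorem sum_count_strand (w : PVWord k) (x : ArrowEnd) :
    ∑ i, (strand i w).count x = if x.1 ∈ Finset.range w.length then 1 else 0 := by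
  induction w with
  | nil => simp [strand]
  | cons y w ih =>
    obtain ⟨⟨⟨p, q⟩, hpq⟩, b⟩ := y
    obtain ⟨a, s⟩ := x
    simp only [ne_eq] at hpq
    simp only [strand, List.count_append, Finset.sum_add_distrib, ih, List.length_cons,
      Finset.mem_range]
    have key : ∀ i : Fin k,
        (if p = i then [ArrowEnd.tail w.length]
          else if q = i then [ArrowEnd.head w.length] else []).count (a, s) =
        (if p = i then (if (w.length, false) = (a, s) then 1 else 0) else 0) +
        (if q = i then (if (w.length, true) = (a, s) then 1 else 0) else 0) := by
      intro i
      by_cases hp : p = i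
      · have hq : q ≠ i := fun h => hpq (hp.trans h.symm)
        simp [hp, hq, List.count_singleton]
      · by_cases hq : q = i <;> simp [hp, hq, List.count_singleton]
    simp only [key, Finset.sum_add_distrib, Finset.sum_ite_eq, Finset.mem_univ, if_true,
      Prod.mk.injEq]
    cases s <;> simp <;> split_ifs <;> omega

/-- The Gauss diagram on `k` strands of a pure virtual braid word: the letter `μ i j` to the power
`ε` is a horizontal arrow of sign `ε` from the strand `i` to the strand `j`. -/
def gaussDiagram (w : PVWord k) : GaussDiagram k where
  arrows := Finset.range w.length
  sign := w.sign
  strand i := w.strand i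
  count_eq := w.sum_count_strand

end PVWord

namespace GaussDiagram

/-! ## `L_n`-equivalence -/

/-- `D'` is obtained from `D` by an `L_n`-move (`n ≥ 1`): a diagram of an element of
`Γ_n(PV_k)` that is not in `Γ_{n+1}(PV_k)` is attached along an embedding of its `k` strands. -/
def LMove (n : ℕ) (D D' : GaussDiagram 1) : Prop :=
  ∃ (k : ℕ) (_ : 0 < k) (w : PVWord k) (e : StrandEmbedding D k),
    w.toGroup ∈ lowerCentralSubgroup (PureVirtualBraidGroup k) n ∧
    w.toGroup ∉ lowerCentralSubgroup (PureVirtualBraidGroup k) (n + 1) ∧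
    Same (D.attach w.gaussDiagram e) D'

/-- `L_n`-equivalence: the equivalence relation generated by `L_n`-moves and Reidemeister
moves. -/
def LEquivalent (n : ℕ) : GaussDiagram 1 → GaussDiagram 1 → Prop :=
  Relation.EqvGen fun D D' => Same D D' ∨ ReidemeisterMove D D' ∨ LMove n D D'

/-! ## `n`-equivalence -/

/-- `n`-triviality of a Gauss diagram on `k` strands. -/
def NTrivial {k : ℕ} (n : ℕ) (T : GaussDiagram k) : Prop :=
  ∃ A : Fin (n + 1) → Finset ℕ,
    (∀ i, (A i).Nonempty ∧ A i ⊆ T.arrows) ∧ (∀ i j, i ≠ j → Disjoint (A i) (A j)) ∧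
    ∀ S : Finset (Fin (n + 1)), S.Nonempty → TrivialUpToRII (T.remove (S.biUnion A))

/-- `D'` is obtained from `D` by an `n`-variation (`n ≥ 1`): an `(n-1)`-trivial Gauss diagram on
several strands is attached. -/
def Variation (n : ℕ) (D D' : GaussDiagram 1) : Prop :=
  ∃ (k : ℕ) (T : GaussDiagram k) (e : StrandEmbedding D k),
    T.NTrivial (n - 1) ∧ Same (D.attach T e) D'

/-- `n`-equivalence (`n ≥ 0`): the equivalence relation generated by `(n+1)`-variations and
Reidemeister moves. -/
def NEquivalent (n : ℕ) : GaussDiagram 1 → GaussDiagram 1 → Prop :=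
  Relation.EqvGen fun D D' => Same D D' ∨ ReidemeisterMove D D' ∨ Variation (n + 1) D D'

theorem Equivalent.lEquivalent {n : ℕ} {D D' : GaussDiagram 1} (h : Equivalent D D') :
    LEquivalent n D D' :=
  Relation.EqvGen.mono (fun _ _ H => Or.imp id Or.inl H) _ _ h

theorem Equivalent.nEquivalent {n : ℕ} {D D' : GaussDiagram 1} (h : Equivalent D D') :
    NEquivalent n D D' :=
  Relation.EqvGen.mono (fun _ _ H => Or.imp id Or.inl H) _ _ h

/-- Gauss diagrams on the interval up to Reidemeister moves. -/
def setoid : Setoid (GaussDiagram 1) := Relation.EqvGen.setoid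
  fun D D' => Same D D' ∨ ReidemeisterMove D D'

end GaussDiagram

/-- Long virtual knots: equivalence classes of Gauss diagrams on the interval. -/
def LongVirtualKnot := Quotient GaussDiagram.setoid

namespace LongVirtualKnot

/-- `L_n`-equivalence of long virtual knots, that is, of Gauss diagrams that represent them. -/
def LEquivalent (n : ℕ) (K K' : LongVirtualKnot) : Prop :=
  Quotient.liftOn₂ K K' (GaussDiagram.LEquivalent n) fun _ _ _ _ h h' => propext
    ⟨fun H => .trans _ _ _ (.symm _ _ (GaussDiagram.Equivalent.lEquivalent h))
        (.trans _ _ _ H (GaussDiagram.Equivalent.lEquivalent h')),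
      fun H => .trans _ _ _ (GaussDiagram.Equivalent.lEquivalent h)
        (.trans _ _ _ H (.symm _ _ (GaussDiagram.Equivalent.lEquivalent h')))⟩

/-- `n`-equivalence of long virtual knots, that is, of Gauss diagrams that represent them. -/
def NEquivalent (n : ℕ) (K K' : LongVirtualKnot) : Prop :=
  Quotient.liftOn₂ K K' (GaussDiagram.NEquivalent n) fun _ _ _ _ h h' => propext
    ⟨fun H => .trans _ _ _ (.symm _ _ (GaussDiagram.Equivalent.nEquivalent h))
        (.trans _ _ _ H (GaussDiagram.Equivalent.nEquivalent h')),
      fun H => .trans _ _ _ (GaussDiagram.Equivalent.nEquivalent h)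
        (.trans _ _ _ H (.symm _ _ (GaussDiagram.Equivalent.nEquivalent h')))⟩

end LongVirtualKnot

/-! Both directions go through words whose letters carry colours. If killing any single one of `n`
colours makes an element of a free group trivial, then the element lies in `Γ_n`
(`mem_lowerCentralSubgroup_of_killColors_eq_one`). Conversely, every element of `Γ_n` of a quotient
of a free group lifts to a coloured element of this kind (`exists_colored`), because an iterated
commutator of entries in `n` different colours dies with each of its colours.

From `L_n`-moves to variations: a braid in `Γ_n` is thus represented by a coloured word that freely
reduces to nothing once any non-empty set of its `n` colours is removed. Free reduction is a
sequence of RII moves, so the diagram of this word is `(n-1)`-trivial (`PVWord.exists_nTrivial`).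
Two words for the same braid have diagrams related by RII and RIII, and such diagrams stay
equivalent after being attached. For strands embedded backwards this needs RIII with reversed
pieces, which follows from RII and the given RIII (`Triangle.regularEquivalent`).

From variations to `L_n`-moves: cut the interval into slots and read a diagram as a word of arrows
between slots, closed up by running through the slots one after another (`exists_slotWord`). Write
`w_S` for the word `w` without the colours in `S`, where the arrows of the attached diagram are
coloured by the sets `A_c`. For every non-empty `S` the closure of `w_S` is equivalent to the
original diagram, and `w` itself has to be compared with `w_R`, `R` being the set of all colours. If
`w_c = w_R` held in the free group for every colour `c`, then `w_R⁻¹ w` would lie in `Γ_n` and could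
be deleted. But only the closures are known to agree.

`lEquivalent_eraseColors` repairs this one colour `j` at a time. Write `y = y_j z` with `z = y_j⁻¹
y`, and slide `z` to slots beyond those of `y_j`. The closure is then a juxtaposition, in which
`y_j` may be replaced by `y_R`.

Sliding (`exists_slide`) works because the end of slot `i` is the beginning of slot `i + 1`: with
`s` the shift of slots, `v z` and `s(z) v` have the same closure. So `z` may be replaced by the
conjugate `v⁻¹ s(z) v`. After iteration it becomes a far shift of `z` times a commutator one step
deeper in the lower central series. Repeating this, the error reaches `Γ_n` and is deleted.

An `L_n`-move requires an element of depth exactly `n`. Elements of greater depth are treated by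
comparing two moves, with an element of exact depth `n` detected in the infinite dihedral group
(`exists_mem_lowerCentralSubgroup_notMem`). -/

open scoped commutatorElement

/-! ## Lower central series -/

/-- Three subgroups lemma, with induction on `j`, in the quotient by the target term, where
containment becomes triviality of a commutator. The series is indexed from 0; in terms of `Γ` this
is `[Γ_a, Γ_b] ≤ Γ_{a+b}`. -/
theorem commutator_lowerCentralSeries_le (G : Type*) [Group G] (i j : ℕ) :
    ⁅(⊤ : Subgroup G).lowerCentralSeries i, (⊤ : Subgroup G).lowerCentralSeries j⁆ ≤
      (⊤ : Subgroup G).lowerCentralSeries (i + j + 1) := by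
  induction j generalizing i with
  | zero => exact le_of_eq rfl
  | succ j ih =>
    set L := (⊤ : Subgroup G).lowerCentralSeries with hL
    have hs : ∀ m, L (m + 1) = ⁅L m, ⊤⁆ := fun m => rfl
    set N := L (i + (j + 1) + 1) with hN
    let π := QuotientGroup.mk' N
    have key : ∀ H : Subgroup G, H ≤ N ↔ H.map π = ⊥ := fun H => by
      rw [(Subgroup.map_eq_bot_iff _), QuotientGroup.ker_mk']
    rw [hs j, Subgroup.commutator_comm, key]
    simp only [Subgroup.map_commutator]
    refine Subgroup.commutator_commutator_eq_bot_of_rotate ?_ ?_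
    · simp only [← Subgroup.map_commutator]
      rw [← key, Subgroup.commutator_comm ⊤, ← hs]
      refine (ih (i + 1)).trans (le_of_eq ?_)
      rw [hN]; congr 1; omega
    · simp only [← Subgroup.map_commutator]
      rw [← key]
      exact Subgroup.commutator_mono (ih i) le_rfl

instance (G : Type*) [Group G] (n : ℕ) : (lowerCentralSubgroup G n).Normal := by
  unfold lowerCentralSubgroup; infer_instance

theorem map_mem_lowerCentralSubgroup {G H : Type*} [Group G] [Group H] (f : G →* H) {n : ℕ} {g : G}
    (hg : g ∈ lowerCentralSubgroup G n) : f g ∈ lowerCentralSubgroup H n := by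
  have h := Subgroup.mem_map_of_mem f hg
  rw [lowerCentralSubgroup, Subgroup.map_lowerCentralSeries] at h
  exact Subgroup.lowerCentralSeries_mono _ le_top h

theorem mem_lowerCentralSubgroup_of_le {G : Type*} [Group G] {m n : ℕ} (h : m ≤ n) {g : G}
    (hg : g ∈ lowerCentralSubgroup G n) : g ∈ lowerCentralSubgroup G m :=
  Subgroup.lowerCentralSeries_antitone _ (Nat.sub_le_sub_right h 1) hg

theorem commutator_mem_lowerCentralSubgroup {G : Type*} [Group G] {m n : ℕ} {g h : G}
    (hg : g ∈ lowerCentralSubgroup G m) (hh : h ∈ lowerCentralSubgroup G n) :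
    ⁅g, h⁆ ∈ lowerCentralSubgroup G (m + n) := by
  -- Truncated subtraction makes the term of index 0 the whole group, and the claim is then
  -- normality of the other term. This case occurs for the empty set of colours.
  rcases Nat.eq_zero_or_pos m with rfl | hm
  · rw [zero_add]
    exact Subgroup.commutator_le_right (⊤ : Subgroup G) _ (Subgroup.commutator_mem_commutator
      (Subgroup.mem_top g) hh)
  rcases Nat.eq_zero_or_pos n with rfl | hn
  · exact Subgroup.commutator_le_left _ (⊤ : Subgroup G) (Subgroup.commutator_mem_commutator
      hg (Subgroup.mem_top h))
  have := commutator_lowerCentralSeries_le G (m - 1) (n - 1)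
    (Subgroup.commutator_mem_commutator hg hh)
  rwa [show m - 1 + (n - 1) + 1 = m + n - 1 by omega] at this

/-! ## Words with coloured letters -/

/-- The endomorphism of a free group on coloured letters that kills all letters whose colour
belongs to `S`. -/
def killColors {Y : Type*} (S : Finset ℕ) : FreeGroup (Y × ℕ) →* FreeGroup (Y × ℕ) :=
  FreeGroup.lift fun x => if x.2 ∈ S then 1 else FreeGroup.of x

/-- The word without its letters whose colour belongs to `S`. -/
def eraseColors {Y : Type*} (S : Finset ℕ) (w : List ((Y × ℕ) × Bool)) : List ((Y × ℕ) × Bool) :=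
  w.filter fun x => x.1.2 ∉ S

theorem FreeGroup.mk_cons {X : Type*} (x : X) (b : Bool) (w : List (X × Bool)) :
    FreeGroup.mk ((x, b) :: w) =
      (if b then FreeGroup.of x else (FreeGroup.of x)⁻¹) * FreeGroup.mk w := by
  cases b <;> simp [FreeGroup.of, FreeGroup.invRev]

theorem killColors_of {Y : Type*} (S : Finset ℕ) (x : Y × ℕ) :
    killColors S (FreeGroup.of x) = if x.2 ∈ S then 1 else FreeGroup.of x := by
  simp [killColors]

/-- Deleting letters is a homomorphism on the free group, so identities between words survive the
deletion of colours. -/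
theorem mk_eraseColors {Y : Type*} (S : Finset ℕ) (w : List ((Y × ℕ) × Bool)) :
    FreeGroup.mk (eraseColors S w) = killColors S (FreeGroup.mk w) := by
  induction w with
  | nil => simp [eraseColors, ← FreeGroup.one_eq_mk]
  | cons x w ih =>
    obtain ⟨x, b⟩ := x
    rw [FreeGroup.mk_cons, map_mul, ← ih]
    by_cases h : x.2 ∈ S
    · have : eraseColors S ((x, b) :: w) = eraseColors S w := by simp [eraseColors, h]
      rw [this]
      cases b <;> simp [killColors_of, h]
    · have : eraseColors S ((x, b) :: w) = (x, b) :: eraseColors S w := by simp [eraseColors, h]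
      rw [this, FreeGroup.mk_cons]
      cases b <;> simp [killColors_of, h]

theorem killColors_killColors {Y : Type*} (S T : Finset ℕ) (g : FreeGroup (Y × ℕ)) :
    killColors S (killColors T g) = killColors (S ∪ T) g := by
  suffices h : (killColors S).comp (killColors T) = killColors (Y := Y) (S ∪ T) from
    DFunLike.congr_fun h g
  ext x
  by_cases hT : x.2 ∈ T <;> by_cases hS : x.2 ∈ S <;> simp [killColors_of, hT, hS]

/-- The normal subgroups of a free group on coloured letters that are generated by the
commutators in which each colour of `S` is entangled. -/
inductive Entangled {Y : Type*} : Finset ℕ → FreeGroup (Y × ℕ) → Prop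
  | empty (g) : Entangled ∅ g
  | letter (x) : Entangled {x.2} (FreeGroup.of x)
  | one (S) : Entangled S 1
  | mul {S g h} : Entangled S g → Entangled S h → Entangled S (g * h)
  | inv {S g} : Entangled S g → Entangled S g⁻¹
  | conj {S g} (h) : Entangled S g → Entangled S (h * g * h⁻¹)
  | comm {S T g h} : Entangled S g → Entangled T h → Disjoint S T → Entangled (S ∪ T) ⁅g, h⁆

namespace Entangled

variable {Y : Type*}

/-- The entangled elements form a subgroup. -/
def subgroup (Y : Type*) (S : Finset ℕ) : Subgroup (FreeGroup (Y × ℕ)) where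
  carrier := {g | Entangled S g}
  mul_mem' := Entangled.mul
  one_mem' := Entangled.one S
  inv_mem' := Entangled.inv

instance (S : Finset ℕ) : (subgroup Y S).Normal := ⟨fun _ h g => Entangled.conj g h⟩

/-- In a commutator of disjointly coloured elements both the numbers of colours and the depths add
up. -/
theorem mem_lowerCentralSubgroup {S : Finset ℕ} {g : FreeGroup (Y × ℕ)} (h : Entangled S g) :
    g ∈ lowerCentralSubgroup (FreeGroup (Y × ℕ)) S.card := by
  induction h with
  | empty g => exact Subgroup.mem_top g
  | letter x => exact Subgroup.mem_top _
  | one S => exact Subgroup.one_mem _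
  | mul _ _ h1 h2 => exact Subgroup.mul_mem _ h1 h2
  | inv _ h => exact Subgroup.inv_mem _ h
  | conj g _ h => exact Subgroup.Normal.conj_mem inferInstance _ h g
  | comm _ _ hd h1 h2 =>
    rw [Finset.card_union_of_disjoint hd]
    exact commutator_mem_lowerCentralSubgroup h1 h2

theorem killColors_mem {S : Finset ℕ} {g : FreeGroup (Y × ℕ)} (h : Entangled S g) {c : ℕ}
    (hc : c ∉ S) : Entangled S (killColors {c} g) := by
  induction h with
  | empty g => exact .empty _
  | letter x =>
    have : ¬ x.2 = c := fun h => hc (by simp [h])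
    simpa [killColors_of, this] using Entangled.letter x
  | one S => simpa using Entangled.one S
  | mul _ _ h1 h2 => simpa using (h1 hc).mul (h2 hc)
  | inv _ h => simpa using (h hc).inv
  | conj g _ h => simpa using (h hc).conj _
  | comm _ _ hd h1 h2 =>
    rw [Finset.mem_union, not_or] at hc
    rw [map_commutatorElement]
    exact (h1 hc.1).comm (h2 hc.2) hd

theorem commute_quotient {S T U : Finset ℕ} {g h : FreeGroup (Y × ℕ)} (hg : Entangled S g)
    (hh : Entangled T h) (hd : Disjoint S T) (hU : S ∪ T = U) :
    Commute (QuotientGroup.mk' (subgroup Y U) g) (QuotientGroup.mk' (subgroup Y U) h) := by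
  rw [← commutatorElement_eq_one_iff_commute, ← map_commutatorElement]
  subst hU
  exact (QuotientGroup.eq_one_iff (N := subgroup Y (S ∪ T)) _).2 (hg.comm hh hd)

theorem mul_inv_mem_iff {S : Finset ℕ} {g h : FreeGroup (Y × ℕ)} : Entangled S (g * h⁻¹) ↔
    QuotientGroup.mk' (subgroup Y S) g = QuotientGroup.mk' (subgroup Y S) h := by
  rw [← mul_inv_eq_one, ← map_inv, ← map_mul]
  exact (QuotientGroup.eq_one_iff (N := subgroup Y S) _).symm

theorem mul_killColors_inv_singleton (g : FreeGroup (Y × ℕ)) (c : ℕ) :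
    Entangled {c} (g * (killColors {c} g)⁻¹) := by
  rw [mul_inv_mem_iff]
  suffices h : QuotientGroup.mk' (subgroup Y {c}) =
      (QuotientGroup.mk' (subgroup Y {c})).comp (killColors {c}) from DFunLike.congr_fun h g
  ext x
  by_cases h : x.2 = c
  · have := Entangled.letter x
    rw [h] at this
    simpa [killColors_of, h] using (QuotientGroup.eq_one_iff (N := subgroup Y {c}) _).2 this
  · simp [killColors_of, h]

/-- By induction on the construction of `g`, an element and its image under `killColors {c}` are
congruent modulo the elements entangled in `insert c S`. The congruence passes to products and
inverses. For conjugates and commutators, the discrepancy between a constituent and its image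
carries `c`, and hence commutes in the quotient with elements carrying the remaining colours. -/
theorem mul_killColors_inv {S : Finset ℕ} {g : FreeGroup (Y × ℕ)} (h : Entangled S g) {c : ℕ}
    (hc : c ∉ S) : Entangled (insert c S) (g * (killColors {c} g)⁻¹) := by
  induction h with
  | empty g => exact mul_killColors_inv_singleton g c
  | letter x =>
    have : ¬ x.2 = c := fun h => hc (by simp [h])
    simpa [killColors_of, this] using Entangled.one _
  | one S => simpa using Entangled.one _
  | mul _ _ h1 h2 =>
    have h1 := h1 hc
    have h2 := h2 hc
    rw [mul_inv_mem_iff] at *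
    simp only [map_mul, h1, h2]
  | inv _ h =>
    have h := h hc
    rw [mul_inv_mem_iff] at *
    simp only [map_inv, h]
  | @conj S g h hg ih =>
    have ih := ih hc
    rw [mul_inv_mem_iff] at *
    -- The conjugators `h` and `killColors {c} h` differ by an element of colour `c`, which commutes
    -- modulo `insert c S` with everything entangled in `S`.
    have h1 := commute_quotient (U := insert c S) (mul_killColors_inv_singleton h c)
      ((hg.killColors_mem hc).conj (killColors {c} h)) (by simpa using hc) rfl
    simp only [map_mul, map_inv, ih] at h1 ⊢
    have h2 := h1.eq
    rw [← mul_inv_eq_iff_eq_mul] at h2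
    rw [← h2]
    group
  | @comm S T a b ha hb hd iha ihb =>
    rw [Finset.mem_union, not_or] at hc
    have iha := iha hc.1
    have ihb := ihb hc.2
    have e1 : insert c S ∪ T = insert c (S ∪ T) := by rw [Finset.insert_union]
    have e2 : S ∪ insert c T = insert c (S ∪ T) := by rw [Finset.union_insert]
    have d1 : Disjoint (insert c S) T := Finset.disjoint_insert_left.2 ⟨hc.2, hd⟩
    have d2 : Disjoint S (insert c T) := Finset.disjoint_insert_right.2 ⟨hc.1, hd⟩
    have ha0 := ha.killColors_mem hc.1
    have hb0 := hb.killColors_mem hc.2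
    rw [mul_inv_mem_iff]
    -- `A A0⁻¹` carries `c` and `S`, so it commutes with what carries `T`; `B B0⁻¹` carries `c` and
    -- `T`, so it commutes with what carries `S`. The calculation first replaces `A` by `A0`, then
    -- `B` by `B0`.
    have k1 := commute_quotient iha (hb.conj (killColors {c} a)) d1 e1
    have k2 := commute_quotient iha hb d1 e1
    have k3 := commute_quotient ha0 ihb d2 e2
    have k4 := commute_quotient (ha0.inv.conj (killColors {c} b)) ihb d2 e2
    simp only [map_mul, map_inv, map_commutatorElement] at k1 k2 k3 k4 ⊢
    set π := QuotientGroup.mk' (subgroup Y (insert c (S ∪ T)))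
    set A := π a; set B := π b
    set A0 := π (killColors {c} a); set B0 := π (killColors {c} b)
    calc ⁅A, B⁆ = (A * A0⁻¹) * (A0 * B * A0⁻¹) * (A * A0⁻¹)⁻¹ * B⁻¹ := by
          rw [commutatorElement_def]; group
      _ = A0 * B * A0⁻¹ * B⁻¹ := by rw [k1.eq]; group
      _ = (A0 * (B * B0⁻¹)) * (B0 * A0⁻¹ * B0⁻¹) * (B * B0⁻¹)⁻¹ := by group
      _ = ((B * B0⁻¹) * A0) * (B0 * A0⁻¹ * B0⁻¹) * (B * B0⁻¹)⁻¹ := by rw [k3.eq]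
      _ = (B * B0⁻¹) * (A0 * ((B0 * A0⁻¹ * B0⁻¹) * (B * B0⁻¹)⁻¹)) := by group
      _ = (B * B0⁻¹) * (A0 * ((B * B0⁻¹)⁻¹ * (B0 * A0⁻¹ * B0⁻¹))) := by rw [k4.inv_right.eq]
      _ = (B * B0⁻¹) * (A0 * (B * B0⁻¹)⁻¹) * (B0 * A0⁻¹ * B0⁻¹) := by group
      _ = ⁅A0, B0⁆ := by rw [k3.inv_right.eq, commutatorElement_def]; group

/-- The colours are added one by one: since `killColors {n} g = 1`, the element `g` equals `g *
(killColors {n} g)⁻¹`, which gains the colour `n` by `mul_killColors_inv`. -/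
theorem of_killColors_eq_one {n : ℕ} {g : FreeGroup (Y × ℕ)}
    (h : ∀ c < n, killColors {c} g = 1) : Entangled (Finset.range n) g := by
  induction n with
  | zero => exact .empty g
  | succ n ih =>
    have h1 := (ih fun c hc => h c (by omega)).mul_killColors_inv (c := n) (by simp)
    rwa [h n (by omega), inv_one, mul_one, ← Finset.range_add_one] at h1

end Entangled

theorem mem_lowerCentralSubgroup_of_killColors_eq_one {Y : Type*} {n : ℕ}
    {g : FreeGroup (Y × ℕ)} (h : ∀ c < n, killColors {c} g = 1) :
    g ∈ lowerCentralSubgroup (FreeGroup (Y × ℕ)) n := by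
  simpa using (Entangled.of_killColors_eq_one h).mem_lowerCentralSubgroup

/-- Forgetting the colours of the letters. -/
def forgetColors {Y : Type*} : FreeGroup (Y × ℕ) →* FreeGroup Y := FreeGroup.map Prod.fst

/-- In a commutator `⁅u, v⁆` where `u` dies with each of the first `n` colours and all letters of
`v` have the new colour `n`, killing any of the `n + 1` colours kills one of the two entries. -/
theorem exists_colored {G Y : Type*} [Group G] (f : FreeGroup Y →* G)
    (hf : Function.Surjective f) {n : ℕ} (hn : 1 ≤ n) {g : G}
    (hg : g ∈ lowerCentralSubgroup G n) :
    ∃ u : FreeGroup (Y × ℕ), f (forgetColors u) = g ∧ ∀ c < n, killColors {c} u = 1 := by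
  have color : ∀ (g : G) (n : ℕ), ∃ u : FreeGroup (Y × ℕ), f (forgetColors u) = g ∧
      killColors {n} u = 1 := fun g n => by
    obtain ⟨v, rfl⟩ := hf g
    refine ⟨FreeGroup.map (fun y => (y, n)) v, ?_, ?_⟩
    · simp [forgetColors, FreeGroup.map.comp, Function.comp_def]
    · suffices h : (killColors {n}).comp (FreeGroup.map fun y : Y => (y, n)) = 1 from
        DFunLike.congr_fun h v
      ext; simp [killColors_of]
  induction n, hn using Nat.le_induction generalizing g with
  | base =>
    obtain ⟨u, hu, hk⟩ := color g 0
    exact ⟨u, hu, fun c hc => by obtain rfl : c = 0 := by omega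
                                 exact hk⟩
  | succ n hn ih =>
    -- As an intersection of kernels `K` is a subgroup, so its image contains the subgroup generated
    -- by the commutators as soon as it contains each of them.
    let K : Subgroup (FreeGroup (Y × ℕ)) := ⨅ c : Fin (n + 1), (killColors {c.1}).ker
    have hK : ∀ u, u ∈ K ↔ ∀ c < n + 1, killColors {c} u = 1 := fun u => by
      simp only [K, Subgroup.mem_iInf, MonoidHom.mem_ker]
      exact ⟨fun h c hc => h ⟨c, hc⟩, fun h c => h c.1 c.2⟩
    have h1 : lowerCentralSubgroup G (n + 1) ≤ K.map (f.comp forgetColors) := by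
      have : lowerCentralSubgroup G (n + 1) = ⁅lowerCentralSubgroup G n, ⊤⁆ := by
        obtain ⟨m, rfl⟩ : ∃ m, n = m + 1 := ⟨n - 1, by omega⟩
        rfl
      rw [this, Subgroup.commutator_le]
      intro a ha b _
      obtain ⟨u, rfl, hu⟩ := ih ha
      obtain ⟨v, rfl, hv⟩ := color b n
      refine ⟨⁅u, v⁆, (hK _).2 fun c hc => ?_, by simp [map_commutatorElement]⟩
      rw [map_commutatorElement]
      rcases Nat.lt_succ_iff_lt_or_eq.1 hc with h | rfl
      · simp [hu c h]
      · simp [hv]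
    obtain ⟨u, hu, rfl⟩ := h1 hg
    exact ⟨u, rfl, (hK u).1 hu⟩

/-! ## The lower central series of the pure virtual braid group is strictly decreasing -/

/-- Rotations commute, and the commutator of a rotation with a reflection doubles the rotation. Thus
every step of the series contributes a factor 2. Here `ZMod 0` is `ℤ`. -/
theorem dihedralGroup_mem_lowerCentralSubgroup (m : ℕ) {g : DihedralGroup 0}
    (hg : g ∈ lowerCentralSubgroup (DihedralGroup 0) (m + 2)) :
    ∃ i : ZMod 0, g = DihedralGroup.r (2 ^ (m + 1) * i) := by
  let A : ℕ → Subgroup (DihedralGroup 0) := fun m =>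
    { carrier := {g | ∃ i : ZMod 0, g = DihedralGroup.r (2 ^ m * i)}
      mul_mem' := by
        rintro _ _ ⟨i, rfl⟩ ⟨j, rfl⟩
        exact ⟨i + j, by rw [DihedralGroup.r_mul_r, mul_add]⟩
      one_mem' := ⟨0, by rw [mul_zero]; rfl⟩
      inv_mem' := by
        rintro _ ⟨i, rfl⟩
        exact ⟨-i, by rw [DihedralGroup.inv_r, mul_neg]⟩ }
  suffices h : lowerCentralSubgroup (DihedralGroup 0) (m + 2) ≤ A (m + 1) from h hg
  clear hg
  have hrr : ∀ i j : ZMod 0, ⁅DihedralGroup.r i, DihedralGroup.r j⁆ = DihedralGroup.r 0 := by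
    intro i j
    simp only [commutatorElement_def, DihedralGroup.inv_r, DihedralGroup.r_mul_r]
    ring_nf
  have hrs : ∀ i j : ZMod 0, ⁅DihedralGroup.r i, DihedralGroup.sr j⁆ =
      DihedralGroup.r (2 * i) := by
    intro i j
    simp only [commutatorElement_def, DihedralGroup.r_mul_sr, DihedralGroup.inv_r,
      DihedralGroup.sr_mul_r, DihedralGroup.inv_sr, DihedralGroup.sr_mul_sr]
    ring_nf
  induction m with
  | zero =>
    change ⁅(⊤ : Subgroup (DihedralGroup 0)), ⊤⁆ ≤ _
    rw [Subgroup.commutator_le]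
    rintro (i | i) - (j | j) -
    · exact ⟨0, by rw [hrr, mul_zero]⟩
    · exact ⟨i, by rw [hrs, zero_add, pow_one]⟩
    · exact ⟨-j, by rw [← commutatorElement_inv, hrs, DihedralGroup.inv_r]; ring_nf⟩
    · refine ⟨j - i, ?_⟩
      simp only [commutatorElement_def, DihedralGroup.inv_sr, DihedralGroup.sr_mul_sr,
        DihedralGroup.r_mul_sr]
      ring_nf
  | succ m ih =>
    change ⁅lowerCentralSubgroup (DihedralGroup 0) (m + 2), ⊤⁆ ≤ _
    rw [Subgroup.commutator_le]
    intro a ha b _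
    obtain ⟨i, rfl⟩ := ih ha
    rcases b with j | j
    · exact ⟨0, by rw [hrr, mul_zero]⟩
    · exact ⟨i, by rw [hrs]; ring_nf⟩

/-- A homomorphism from the pure virtual braid group to the infinite dihedral group that sends
`μ 0 1` to a rotation and `μ 1 0` to a reflection. -/
theorem exists_hom_dihedralGroup {k : ℕ} {p q : Fin k} (hpq : p ≠ q) :
    ∃ f : PureVirtualBraidGroup k →* DihedralGroup 0,
      f (PresentedGroup.of ⟨(p, q), hpq⟩) = DihedralGroup.r 1 ∧
      f (PresentedGroup.of ⟨(q, p), hpq.symm⟩) = DihedralGroup.sr 0 := by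
  let φ : PVGen k → DihedralGroup 0 := fun x =>
    if x.1 = (p, q) then DihedralGroup.r 1
    else if x.1 = (q, p) then DihedralGroup.sr 0 else 1
  -- No relator involves two different letters that both have their indices in `{p, q}`. So on each
  -- side of a relation at most one letter has a non-trivial image, and the order of the letters is
  -- irrelevant.
  have hφ : ∀ x : PVGen k, ¬ ((x.1.1 = p ∨ x.1.1 = q) ∧ (x.1.2 = p ∨ x.1.2 = q)) → φ x = 1 := by
    intro x hx
    have h1 : ¬ x.1 = (p, q) := fun h => hx (by simp [h])
    have h2 : ¬ x.1 = (q, p) := fun h => hx (by simp [h])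
    simp [φ, h1, h2]
  have hrel : ∀ r ∈ pvRelators k, FreeGroup.lift φ r = 1 := by
    rintro r (⟨i, j, l, hij, hil, hjl, rfl⟩ | ⟨i, j, l, m, hij, hlm, hd, rfl⟩)
    · simp only [pvLetter, map_mul, map_inv, FreeGroup.lift_apply_of, mul_inv_eq_one]
      have h1 := hφ ⟨(i, j), hij⟩
      have h2 := hφ ⟨(i, l), hil⟩
      have h3 := hφ ⟨(j, l), hjl⟩
      by_cases hi : i = p ∨ i = q
      · by_cases hj : j = p ∨ j = q
        · have hl : ¬ (l = p ∨ l = q) := by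
            clear h1 h2 h3 hφ φ
            grind
          rw [h2 fun h => hl h.2, h3 fun h => hl h.2]
          simp only [one_mul, mul_one]
        · rw [h1 fun h => hj h.2, h3 fun h => hj h.1]
      · rw [h1 fun h => hi h.1, h2 fun h => hi h.1]
        simp only [one_mul, mul_one]
    · simp only [pvLetter, map_mul, map_inv, FreeGroup.lift_apply_of, mul_inv_eq_one]
      have h1 := hφ ⟨(i, j), hij⟩
      have h2 := hφ ⟨(l, m), hlm⟩
      by_cases hi : (i = p ∨ i = q) ∧ (j = p ∨ j = q)
      · have : ¬ ((l = p ∨ l = q) ∧ (m = p ∨ m = q)) := by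
          rintro ⟨h, -⟩
          rw [Set.disjoint_left] at hd
          refine hd (a := l) ?_ (by simp)
          clear h1 h2 hφ φ
          simp only [Set.mem_insert_iff, Set.mem_singleton_iff]
          grind
        rw [h2 this]
        simp
      · rw [h1 hi]
        simp
  refine ⟨PresentedGroup.toGroup hrel, ?_, ?_⟩
  · simp [PresentedGroup.toGroup.of, φ]
  · simp [PresentedGroup.toGroup.of, φ, hpq]

/-- Commutating `μ p q` repeatedly with `μ q p` gives elements whose dihedral images are the
rotations by `2 ^ m`. These are not multiples of `2 ^ (m + 1)`, so the elements are no deeper than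
they have to be. -/
theorem exists_mem_lowerCentralSubgroup_notMem {k : ℕ} {p q : Fin k} (hpq : p ≠ q) {n : ℕ}
    (hn : 1 ≤ n) : ∃ g : PureVirtualBraidGroup k, g ∈ lowerCentralSubgroup _ n ∧
      g ∉ lowerCentralSubgroup _ (n + 1) := by
  obtain ⟨f, hr, hs⟩ := exists_hom_dihedralGroup hpq
  have key : ∀ m, ∃ g : PureVirtualBraidGroup k, g ∈ lowerCentralSubgroup _ (m + 1) ∧
      f g = DihedralGroup.r (2 ^ m) := by
    intro m
    induction m with
    | zero => exact ⟨_, Subgroup.mem_top _, by rw [hr, pow_zero]⟩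
    | succ m ih =>
      obtain ⟨g, hg, hf⟩ := ih
      refine ⟨⁅g, PresentedGroup.of ⟨(q, p), hpq.symm⟩⁆,
        commutator_mem_lowerCentralSubgroup (m := m + 1) (n := 1) hg (Subgroup.mem_top _), ?_⟩
      rw [map_commutatorElement, hf, hs]
      simp only [commutatorElement_def, DihedralGroup.r_mul_sr, DihedralGroup.inv_r,
          DihedralGroup.sr_mul_r, DihedralGroup.inv_sr, DihedralGroup.sr_mul_sr]
      ring_nf
  obtain ⟨m, rfl⟩ : ∃ m, n = m + 1 := ⟨n - 1, by omega⟩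
  obtain ⟨g, hg, hf⟩ := key m
  refine ⟨g, hg, fun h => ?_⟩
  obtain ⟨i, hi⟩ := dihedralGroup_mem_lowerCentralSubgroup m (map_mem_lowerCentralSubgroup f h)
  rw [hf] at hi
  have h2 : (2 ^ m : ZMod 0) = 2 ^ (m + 1) * i := by injection hi
  rw [pow_succ, mul_assoc] at h2
  have h3 : (2 ^ m : ℤ) ≠ 0 := by positivity
  have h4 : (1 : ℤ) = 2 * (show ℤ from i) :=
    mul_left_cancel₀ h3 ((mul_one _).trans h2)
  omega

/-! ## Lists with adjacent entries -/

/-- Local moves on diagrams change the images of two neighbouring ends individually but not their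
concatenation. The pairs in `P` are treated one by one; a pair may also be absent from `l`, when it
lies on another strand. -/
theorem List.Nodup.flatMap_eq_of_pairs {α β : Type*} {l : List α} (hl : l.Nodup)
    (P : List (α × α)) :
    ∀ g h : α → List β,
    (∀ p ∈ P, p.1 ≠ p.2 ∧ ([p.1, p.2] <:+: l ∨ p.1 ∉ l ∧ p.2 ∉ l)) →
    P.Pairwise (fun p q => p.1 ≠ q.1 ∧ p.1 ≠ q.2 ∧ p.2 ≠ q.1 ∧ p.2 ≠ q.2) →
    (∀ p ∈ P, g p.1 ++ g p.2 = h p.1 ++ h p.2) →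
    (∀ z ∈ l, (∀ p ∈ P, z ≠ p.1 ∧ z ≠ p.2) → g z = h z) → l.flatMap g = l.flatMap h := by
  classical
  induction P with
  | nil => exact fun g h _ _ _ h4 => List.flatMap_congr fun z hz => h4 z hz (by simp)
  | cons p P ih =>
    intro g h h1 h2 h3 h4
    obtain ⟨hne, hp⟩ := h1 p (by simp)
    rw [List.pairwise_cons] at h2
    -- Interpolates between the two substitutions: already `h` on the first pair, still `g`
    -- elsewhere.
    let k : α → List β := fun z => if z = p.1 ∨ z = p.2 then h z else g z
    trans l.flatMap k
    · rcases hp with ⟨A, B, rfl⟩ | ⟨ha, hb⟩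
      · have hA : A.flatMap g = A.flatMap k := List.flatMap_congr fun z hz => by
          have h5 : z ≠ p.1 := by rintro rfl; simp [List.nodup_append] at hl; grind
          have h6 : z ≠ p.2 := by rintro rfl; simp [List.nodup_append] at hl; grind
          simp [k, h5, h6]
        have hB : B.flatMap g = B.flatMap k := List.flatMap_congr fun z hz => by
          have h5 : z ≠ p.1 := by rintro rfl; simp [List.nodup_append] at hl; grind
          have h6 : z ≠ p.2 := by rintro rfl; simp [List.nodup_append] at hl; grind
          simp [k, h5, h6]
        have h7 := h3 p (by simp)
        simp only [List.flatMap_append, hA, hB, List.flatMap_cons, List.flatMap_nil,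
          List.append_nil, h7]
        simp [k]
      · refine List.flatMap_congr fun z hz => ?_
        have h5 : z ≠ p.1 := by rintro rfl; exact ha hz
        have h6 : z ≠ p.2 := by rintro rfl; exact hb hz
        simp [k, h5, h6]
    · refine ih k h (fun q hq => h1 q (by simp [hq])) h2.2 (fun q hq => ?_) fun z hz hq => ?_
      · obtain ⟨h5, h6, h7, h8⟩ := h2.1 q hq
        simp only [k, h5.symm, h7.symm, h6.symm, h8.symm, or_self, if_false]
        exact h3 q (by simp [hq])
      · by_cases h5 : z = p.1 ∨ z = p.2
        · simp [k, h5]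
        · simp only [k, h5, if_false]
          rw [not_or] at h5
          refine h4 z hz fun q hq' => ?_
          rcases List.mem_cons.1 hq' with rfl | hq'
          · exact h5
          · exact hq q hq'

attribute [ext] GaussDiagram

namespace GaussDiagram

variable {k : ℕ}

/-! ## Basic properties of Gauss diagrams -/

theorem mem_arrows_of_mem_strand {D : GaussDiagram k} {x : ArrowEnd} {i : Fin k}
    (h : x ∈ D.strand i) : x.1 ∈ D.arrows := by
  by_contra hx
  have h1 := D.count_eq x
  rw [if_neg hx, Finset.sum_eq_zero_iff] at h1
  exact List.count_eq_zero.1 (h1 i (Finset.mem_univ i)) h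

theorem exists_mem_strand (D : GaussDiagram k) {x : ArrowEnd} (h : x.1 ∈ D.arrows) :
    ∃ i, x ∈ D.strand i := by
  by_contra! hx
  have h1 := D.count_eq x
  rw [if_pos h, Finset.sum_eq_zero fun i _ => List.count_eq_zero.2 (hx i)] at h1
  exact zero_ne_one h1

theorem count_strand_le_one (D : GaussDiagram k) (x : ArrowEnd) (i : Fin k) :
    (D.strand i).count x ≤ 1 := by
  have h1 := D.count_eq x
  have h2 := Finset.single_le_sum (f := fun i => (D.strand i).count x) (fun _ _ => Nat.zero_le _)
    (Finset.mem_univ i)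
  split_ifs at h1 <;> omega

theorem nodup_strand (D : GaussDiagram k) (i : Fin k) : (D.strand i).Nodup :=
  List.nodup_iff_count_le_one.2 fun x => D.count_strand_le_one x i

theorem strand_unique {D : GaussDiagram k} {x : ArrowEnd} {i j : Fin k} (hi : x ∈ D.strand i)
    (hj : x ∈ D.strand j) : i = j := by
  by_contra hij
  have h1 := D.count_eq x
  have h2 := Finset.add_le_sum (f := fun i => (D.strand i).count x) (fun _ _ => Nat.zero_le _)
    (Finset.mem_univ i) (Finset.mem_univ j) hij
  have h3 := List.count_pos_iff.2 hi
  have h4 := List.count_pos_iff.2 hj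
  split_ifs at h1 <;> omega

theorem Next.infix_or {D : GaussDiagram k} {x y : ArrowEnd} (h : D.Next x y) (m : Fin k) :
    [x, y] <:+: D.strand m ∨ x ∉ D.strand m ∧ y ∉ D.strand m := by
  obtain ⟨i, hi⟩ := h
  by_cases him : i = m
  · exact Or.inl (him ▸ hi)
  · exact Or.inr ⟨fun h => him (strand_unique (hi.subset (by simp)) h),
      fun h => him (strand_unique (hi.subset (by simp)) h)⟩

theorem Next.ne {D : GaussDiagram k} {x y : ArrowEnd} (h : D.Next x y) : x ≠ y := by
  obtain ⟨i, hi⟩ := h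
  have := hi.sublist.nodup (D.nodup_strand i)
  simpa using this

theorem Next.left_mem {D : GaussDiagram k} {x y : ArrowEnd} (h : D.Next x y) :
    x.1 ∈ D.arrows := by
  obtain ⟨i, hi⟩ := h
  exact mem_arrows_of_mem_strand (hi.subset (by simp))

theorem Next.right_mem {D : GaussDiagram k} {x y : ArrowEnd} (h : D.Next x y) :
    y.1 ∈ D.arrows := by
  obtain ⟨i, hi⟩ := h
  exact mem_arrows_of_mem_strand (hi.subset (by simp))

theorem arrows_eq_of_strand {D D' : GaussDiagram k} (h : ∀ i, D.strand i = D'.strand i) :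
    D.arrows = D'.arrows := by
  ext a
  constructor <;> intro ha
  · obtain ⟨i, hi⟩ := D.exists_mem_strand (x := (a, false)) ha
    exact mem_arrows_of_mem_strand (h i ▸ hi)
  · obtain ⟨i, hi⟩ := D'.exists_mem_strand (x := (a, false)) ha
    exact mem_arrows_of_mem_strand (h i ▸ hi)

/-- `Same` asks for a permutation of all labels, while relabellings are naturally given only on the
arrows in use. The complements of a finite set and of its image are both countably infinite, so an
extension exists. -/
theorem exists_perm_of_injOn {s : Finset ℕ} {f : ℕ → ℕ} (hf : Set.InjOn f s) :
    ∃ τ : Equiv.Perm ℕ, ∀ a ∈ s, τ a = f a := by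
  classical
  let e : {x // x ∈ s} ≃ {x // x ∈ s.image f} :=
    Equiv.ofBijective (fun x => ⟨f x.1, Finset.mem_image_of_mem f x.2⟩) ⟨fun x y h =>
      Subtype.ext (hf x.2 y.2 (congrArg Subtype.val h)), fun ⟨y, hy⟩ => by
        obtain ⟨x, hx, rfl⟩ := Finset.mem_image.1 hy
        exact ⟨⟨x, hx⟩, rfl⟩⟩
  have inf : ∀ t : Finset ℕ, Infinite {x // ¬ x ∈ t} := fun t =>
    (Set.Finite.infinite_compl t.finite_toSet).to_subtype
  have := inf s
  have := inf (s.image f)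
  obtain ⟨e'⟩ := nonempty_equiv_of_countable (α := {x // ¬ x ∈ s}) (β := {x // ¬ x ∈ s.image f})
  refine ⟨Equiv.subtypeCongr e e', fun a ha => ?_⟩
  have h : Equiv.subtypeCongr e e' a = (e ⟨a, ha⟩ : ℕ) := by
    simp [Equiv.subtypeCongr, Equiv.sumCompl, ha]
  rw [h]
  rfl

theorem same_of_injOn {D D' : GaussDiagram k} (f : ℕ → ℕ) (hf : Set.InjOn f D.arrows)
    (hs : ∀ i, D'.strand i = (D.strand i).map fun x => (f x.1, x.2))
    (hsign : ∀ a ∈ D.arrows, D'.sign (f a) = D.sign a) : Same D D' := by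
  obtain ⟨τ, hτ⟩ := exists_perm_of_injOn hf
  refine ⟨τ, fun i => ?_, fun a ha => by rw [hτ a ha, hsign a ha]⟩
  rw [hs i]
  exact List.map_congr_left fun x hx => by rw [hτ _ (mem_arrows_of_mem_strand hx)]

theorem same_of_eq {D D' : GaussDiagram k} (hs : ∀ i, D'.strand i = D.strand i)
    (hsign : ∀ a ∈ D.arrows, D'.sign a = D.sign a) : Same D D' :=
  ⟨1, fun i => by simp [hs i], hsign⟩

theorem Same.refl (D : GaussDiagram k) : Same D D := same_of_eq (fun _ => rfl) fun _ _ => rfl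

theorem Same.symm {D D' : GaussDiagram k} (h : Same D D') : Same D' D := by
  obtain ⟨τ, hs, hsign⟩ := h
  refine ⟨τ.symm, fun i => by simp [hs i, Function.comp_def], fun a ha => ?_⟩
  obtain ⟨i, hi⟩ := D'.exists_mem_strand (x := (a, false)) ha
  rw [hs i] at hi
  obtain ⟨y, hy, hya⟩ := List.mem_map.1 hi
  have : τ y.1 = a := congrArg Prod.fst hya
  rw [← this, Equiv.symm_apply_apply, hsign _ (mem_arrows_of_mem_strand hy)]

/-- Equivalence by second Reidemeister moves. -/
def RIIEquivalent : GaussDiagram k → GaussDiagram k → Prop :=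
  Relation.EqvGen fun D D' => Same D D' ∨ ReidemeisterII D D'

/-- Equivalence by second and third Reidemeister moves. -/
def RegularEquivalent : GaussDiagram k → GaussDiagram k → Prop :=
  Relation.EqvGen fun D D' => Same D D' ∨ ReidemeisterII D D' ∨ ReidemeisterIII D D'

theorem RIIEquivalent.regularEquivalent {D D' : GaussDiagram k} (h : RIIEquivalent D D') :
    RegularEquivalent D D' :=
  Relation.EqvGen.mono (fun _ _ H => Or.imp id Or.inl H) _ _ h

theorem RegularEquivalent.equivalent {D D' : GaussDiagram k} (h : RegularEquivalent D D') :
    Equivalent D D' :=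
  Relation.EqvGen.mono (fun _ _ H => Or.imp id Or.inr H) _ _ h

theorem Same.riiEquivalent {D D' : GaussDiagram k} (h : Same D D') : RIIEquivalent D D' :=
  .rel _ _ (Or.inl h)

theorem Same.equivalent {D D' : GaussDiagram k} (h : Same D D') : Equivalent D D' :=
  .rel _ _ (Or.inl h)

theorem RIIEquivalent.symm {D D' : GaussDiagram k} (h : RIIEquivalent D D') :
    RIIEquivalent D' D := Relation.EqvGen.symm _ _ h

theorem RIIEquivalent.trans {D D' D'' : GaussDiagram k} (h : RIIEquivalent D D')
    (h' : RIIEquivalent D' D'') : RIIEquivalent D D'' := Relation.EqvGen.trans _ _ _ h h'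

theorem RegularEquivalent.symm {D D' : GaussDiagram k} (h : RegularEquivalent D D') :
    RegularEquivalent D' D := Relation.EqvGen.symm _ _ h

theorem RegularEquivalent.trans {D D' D'' : GaussDiagram k} (h : RegularEquivalent D D')
    (h' : RegularEquivalent D' D'') : RegularEquivalent D D'' := Relation.EqvGen.trans _ _ _ h h'

theorem Equivalent.symm {D D' : GaussDiagram k} (h : Equivalent D D') :
    Equivalent D' D := Relation.EqvGen.symm _ _ h

theorem Equivalent.trans {D D' D'' : GaussDiagram k} (h : Equivalent D D')
    (h' : Equivalent D' D'') : Equivalent D D'' := Relation.EqvGen.trans _ _ _ h h'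

/-! ## Substituting lists for the endpoints of a Gauss diagram -/

theorem count_flatMap_eq (l : List ArrowEnd) (f : ArrowEnd → List ArrowEnd) (w v : ArrowEnd)
    (h : ∀ z ∈ l, (f z).count w = if z = v then 1 else 0) : (l.flatMap f).count w = l.count v := by
  induction l with
  | nil => rfl
  | cons z l ih =>
    rw [List.flatMap_cons, List.count_append, ih fun z hz => h z (by simp [hz]), h z (by simp),
      List.count_cons, add_comm]
    simp

/-- The diagram with every endpoint `z` replaced by the list `f z`; the endpoint `w` of the new
diagram comes from the endpoint `source w` of the old one. -/
def substitute (D : GaussDiagram k) (f : ArrowEnd → List ArrowEnd) (A : Finset ℕ) (s : ℕ → ℤˣ)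
    (source : ArrowEnd → ArrowEnd)
    (hf : ∀ w z, z.1 ∈ D.arrows → (f z).count w = if z = source w then 1 else 0)
    (hA : ∀ w, (source w).1 ∈ D.arrows ↔ w.1 ∈ A) : GaussDiagram k where
  arrows := A
  sign := s
  strand i := (D.strand i).flatMap f
  count_eq w := by
    simp only [count_flatMap_eq _ f w (source w) fun z hz => hf w z (mem_arrows_of_mem_strand hz),
      D.count_eq, hA]

/-- The diagram with its endpoints permuted. -/
def permute (D : GaussDiagram k) (σ : Equiv.Perm ArrowEnd)
    (hσ : ∀ x, (σ x).1 ∈ D.arrows ↔ x.1 ∈ D.arrows) : GaussDiagram k where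
  arrows := D.arrows
  sign := D.sign
  strand i := (D.strand i).map σ
  count_eq x := by
    have h : ∀ i, ((D.strand i).map σ).count x = (D.strand i).count (σ.symm x) := fun i => by
      conv_lhs => rw [← Equiv.apply_symm_apply σ x]
      exact List.count_map_of_injective _ σ σ.injective _
    simp only [h, D.count_eq]
    congr 1
    rw [← hσ (σ.symm x), Equiv.apply_symm_apply]

theorem infix_flatMap_of_infix {l l' : List ArrowEnd} {f : ArrowEnd → List ArrowEnd}
    (h : l' <:+: l) : l'.flatMap f <:+: l.flatMap f := by
  obtain ⟨A, B, rfl⟩ := h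
  exact ⟨A.flatMap f, B.flatMap f, by simp⟩

end GaussDiagram

namespace GaussDiagram

variable {k : ℕ}

/-! ## Variants of the third Reidemeister move -/

/-- `x` and `y` are consecutive ends, in this order if `o` holds and in the other order
otherwise. -/
def NextIf (D : GaussDiagram k) (o : Bool) (x y : ArrowEnd) : Prop :=
  if o then D.Next x y else D.Next y x

/-- A third Reidemeister move follows from one in which the arrow `d` is replaced by an arrow of
the opposite sign on the other side of the two ends `p` and `q` next to the ends of `d`: the new
arrow is created together with an arrow that takes the place of `d` after the move, and is then
cancelled with `d`. -/
theorem regularEquivalent_of_flip {G G' : GaussDiagram k} {d : ℕ} {p q u v : ArrowEnd}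
    {op oq : Bool} (hp : G.NextIf op p (ArrowEnd.tail d)) (hq : G.NextIf oq q (ArrowEnd.head d))
    (huv : G.Next u v) (hpd : p.1 ≠ d) (hqd : q.1 ≠ d) (hud : u.1 ≠ d) (hvd : v.1 ≠ d)
    (hpq : p ≠ q) (hup : u ≠ p) (huq : u ≠ q) (hvp : v ≠ p) (hvq : v ≠ q)
    (hsign : ∀ a ∈ G.arrows, G'.sign a = G.sign a) (σ' : Equiv.Perm ArrowEnd)
    (hs : ∀ i, G'.strand i = (G.strand i).map σ')
    (hσ' : σ' p = ArrowEnd.tail d ∧ σ' (ArrowEnd.tail d) = p ∧ σ' q = ArrowEnd.head d ∧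
      σ' (ArrowEnd.head d) = q ∧ σ' u = v ∧ σ' v = u)
    (hσ'0 : ∀ z, z ≠ p → z ≠ ArrowEnd.tail d → z ≠ q → z ≠ ArrowEnd.head d → z ≠ u → z ≠ v →
      σ' z = z)
    (hR : ∀ (y : ℕ) (H H' : GaussDiagram k), y ∉ G.arrows →
      H.NextIf op (ArrowEnd.tail y) p → H.NextIf oq (ArrowEnd.head y) q → H.Next u v →
      H.sign y = - G.sign d → (∀ a ∈ G.arrows, H.sign a = G.sign a) → H'.sign = H.sign →
      (∀ i, H'.strand i = (H.strand i).map (Equiv.swap (ArrowEnd.tail y) p *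
        Equiv.swap (ArrowEnd.head y) q * Equiv.swap u v)) → ReidemeisterIII H H') :
    RegularEquivalent G G' := by
  classical
  -- The new arrow `y` has the sign opposite to `d` and takes part in the move; `x` has the sign of
  -- `d`. If `op` holds, the ends near `p` are in turn `p d`, `x y p d` (RII), `x p y d` (RIII) and
  -- `x p` (RII on `y` and `d`), and similarly near `q`. So `x` ends up where `d` should be.
  obtain ⟨y, hy⟩ := Infinite.exists_notMem_finset G.arrows
  obtain ⟨x, hx⟩ := Infinite.exists_notMem_finset (insert y G.arrows)
  rw [Finset.mem_insert, not_or] at hx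
  obtain ⟨hxy, hx⟩ := hx
  have memd : d ∈ G.arrows := by
    cases op
    · exact hp.left_mem (x := ArrowEnd.tail d)
    · exact hp.right_mem (y := ArrowEnd.tail d)
  have memp : p.1 ∈ G.arrows := by
    cases op
    · exact hp.right_mem
    · exact hp.left_mem
  have memq : q.1 ∈ G.arrows := by
    cases oq
    · exact hq.right_mem
    · exact hq.left_mem
  have memu := huv.left_mem
  have memv := huv.right_mem
  have huv' := huv.ne
  have nx : ∀ z : ArrowEnd, z.1 ∈ G.arrows → z.1 ≠ x := fun z hz h => hx (h ▸ hz)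
  have ny : ∀ z : ArrowEnd, z.1 ∈ G.arrows → z.1 ≠ y := fun z hz h => hy (h ▸ hz)
  have ndx : d ≠ x := nx (d, false) memd
  have ndy : d ≠ y := ny (d, false) memd
  -- the diagram with the two new arrows
  let f : ArrowEnd → List ArrowEnd := fun z =>
    if z = p then (if op then [(x, false), (y, false), p] else [p, (y, false), (x, false)])
    else if z = q then (if oq then [(x, true), (y, true), q] else [q, (y, true), (x, true)])
    else [z]
  let source : ArrowEnd → ArrowEnd := fun w =>
    if w.1 = x ∨ w.1 = y then (if w.2 then q else p) else w
  let H : GaussDiagram k := G.substitute f (insert x (insert y G.arrows))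
    (fun a => if a = x then G.sign d else if a = y then - G.sign d else G.sign a) source
    (by
      rintro ⟨w, s⟩ z hz
      have h1 := nx z hz
      have h2 := ny z hz
      have h3 := nx p memp
      have h4 := ny p memp
      have h5 := nx q memq
      have h6 := ny q memq
      simp only [f, source]
      clear hR hσ' hσ'0 hs hsign hp hq huv
      rcases z with ⟨z, s'⟩
      rcases p with ⟨p, sp⟩
      rcases q with ⟨q, sq⟩
      cases op <;> cases oq <;> cases s <;>
        grind)
    (by
      rintro ⟨w, s⟩
      simp only [source, Finset.mem_insert]
      by_cases h : w = x ∨ w = y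
      · cases s <;> simp [h, memp, memq, ← or_assoc]
      · simp only [h, if_false]
        rw [not_or] at h
        simp [h.1, h.2])
  have Hs : ∀ i, H.strand i = (G.strand i).flatMap f := fun i => rfl
  have fp : f p = if op then [(x, false), (y, false), p] else [p, (y, false), (x, false)] := by
    simp [f]
  have fq : f q = if oq then [(x, true), (y, true), q] else [q, (y, true), (x, true)] := by
    simp [f, hpq.symm]
  have f0 : ∀ z, z ≠ p → z ≠ q → f z = [z] := fun z h1 h2 => by simp [f, h1, h2]
  have hdp : ∀ s, (d, s) ≠ p := fun s h => hpd (by rw [← h])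
  have hdq : ∀ s, (d, s) ≠ q := fun s h => hqd (by rw [← h])
  have hdu : ∀ s, (d, s) ≠ u := fun s h => hud (by rw [← h])
  have hdv : ∀ s, (d, s) ≠ v := fun s h => hvd (by rw [← h])
  have hyz : ∀ s z, z.1 ∈ G.arrows → (y, s) ≠ z := fun s z hz h => ny z hz (by rw [← h])
  have hxz : ∀ s z, z.1 ∈ G.arrows → (x, s) ≠ z := fun s z hz h => nx z hz (by rw [← h])
  -- the infixes of the strands of `H` that come from pairs of consecutive ends of `G`
  have pinf : ∃ i, (if op then [(x, false), (y, false), p, (d, false)]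
      else [(d, false), p, (y, false), (x, false)]) <:+: H.strand i := by
    cases op <;> obtain ⟨i, hi⟩ := hp <;> refine ⟨i, ?_⟩ <;> rw [Hs] <;>
      simpa [fp, f0 _ (hdp false) (hdq false)] using infix_flatMap_of_infix (f := f) hi
  have qinf : ∃ i, (if oq then [(x, true), (y, true), q, (d, true)]
      else [(d, true), q, (y, true), (x, true)]) <:+: H.strand i := by
    cases oq <;> obtain ⟨i, hi⟩ := hq <;> refine ⟨i, ?_⟩ <;> rw [Hs] <;>
      simpa [fq, f0 _ (hdp true) (hdq true)] using infix_flatMap_of_infix (f := f) hi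
  have uinf : H.Next u v := by
    obtain ⟨i, hi⟩ := huv
    refine ⟨i, ?_⟩
    rw [Hs]
    simpa [f0 _ hup huq, f0 _ hvp hvq] using infix_flatMap_of_infix (f := f) hi
  -- the third Reidemeister move
  let σ : Equiv.Perm ArrowEnd := Equiv.swap (ArrowEnd.tail y) p *
    Equiv.swap (ArrowEnd.head y) q * Equiv.swap u v
  have σyt : σ (y, false) = p := by
    simp [σ, Equiv.swap_apply_of_ne_of_ne (hyz false u memu) (hyz false v memv),
      Equiv.swap_apply_of_ne_of_ne (a := (y, true)) (x := (y, false)) (by simp)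
      (hyz false q memq)]
  have σyh : σ (y, true) = q := by
    simp [σ, Equiv.swap_apply_of_ne_of_ne (hyz true u memu) (hyz true v memv),
      Equiv.swap_apply_of_ne_of_ne (hyz false q memq).symm hpq.symm]
  have σp : σ p = (y, false) := by
    simp [σ, Equiv.swap_apply_of_ne_of_ne hup.symm hvp.symm,
      Equiv.swap_apply_of_ne_of_ne (hyz true p memp).symm hpq]
  have σq : σ q = (y, true) := by
    simp [σ, Equiv.swap_apply_of_ne_of_ne huq.symm hvq.symm,
      Equiv.swap_apply_of_ne_of_ne (a := (y, false)) (x := (y, true)) (by simp)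
      (hyz true p memp)]
  have σu : σ u = v := by
    simp [σ, Equiv.swap_apply_of_ne_of_ne (hyz true v memv).symm hvq,
      Equiv.swap_apply_of_ne_of_ne (hyz false v memv).symm hvp]
  have σv : σ v = u := by
    simp [σ, Equiv.swap_apply_of_ne_of_ne (hyz true u memu).symm huq,
      Equiv.swap_apply_of_ne_of_ne (hyz false u memu).symm hup]
  have σ0 : ∀ z, z ≠ p → z ≠ q → z ≠ u → z ≠ v → z.1 ≠ y → σ z = z := by
    intro z h1 h2 h3 h4 h5
    have h6 : ∀ s, z ≠ (y, s) := fun s h => h5 (by rw [h])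
    simp [σ, Equiv.swap_apply_of_ne_of_ne h3 h4, Equiv.swap_apply_of_ne_of_ne (h6 true) h2,
      Equiv.swap_apply_of_ne_of_ne (h6 false) h1]
  have σx : ∀ s, σ (x, s) = (x, s) := fun s =>
    σ0 _ (hxz s p memp) (hxz s q memq) (hxz s u memu) (hxz s v memv) hxy
  have σd : ∀ s, σ (d, s) = (d, s) := fun s => σ0 _ (hdp s) (hdq s) (hdu s) (hdv s) ndy
  let H' : GaussDiagram k := H.permute σ (by
    have hHA : H.arrows = insert x (insert y G.arrows) := rfl
    intro z
    rw [hHA]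
    by_cases h1 : z = p
    · simp [h1, σp, memp]
    by_cases h2 : z = q
    · simp [h2, σq, memq]
    by_cases h3 : z = u
    · simp [h3, σu, memu, memv]
    by_cases h4 : z = v
    · simp [h4, σv, memu, memv]
    by_cases h5 : z.1 = y
    · obtain ⟨z, s⟩ := z
      obtain rfl : z = y := h5
      cases s
      · simp [σyt, memp]
      · simp [σyh, memq]
    rw [σ0 z h1 h2 h3 h4 h5])
  have hdsub : ∀ {a b c e : ArrowEnd} {l : List ArrowEnd}, [a, b, c, e] <:+: l →
      [a, b] <:+: l ∧ [b, c] <:+: l ∧ [c, e] <:+: l := by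
    rintro a b c e l ⟨A, B, rfl⟩
    exact ⟨⟨A, c :: e :: B, by simp⟩, ⟨A ++ [a], e :: B, by simp⟩, ⟨A ++ [a, b], B, by simp⟩⟩
  have step1 : ReidemeisterII H (H.remove {x, y}) := by
    refine ⟨x, y, ?_, ?_, ?_, rfl⟩
    · obtain ⟨i, hi⟩ := pinf
      cases op
      · exact Or.inr ⟨i, (hdsub hi).2.2⟩
      · exact Or.inl ⟨i, (hdsub hi).1⟩
    · obtain ⟨i, hi⟩ := qinf
      cases oq
      · exact Or.inr ⟨i, (hdsub hi).2.2⟩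
      · exact Or.inl ⟨i, (hdsub hi).1⟩
    · simp [H, substitute, Ne.symm hxy]
  have step0 : Same (H.remove {x, y}) G := by
    refine same_of_eq (fun i => ?_) fun a ha => ?_
    · change G.strand i = (H.strand i).filter _
      rw [Hs, List.filter_flatMap]
      conv_lhs => rw [← List.flatMap_singleton' (G.strand i)]
      refine List.flatMap_congr fun z hz => ?_
      have hz := mem_arrows_of_mem_strand hz
      by_cases h1 : z = p
      · subst h1
        rw [fp]
        cases op <;> simp [nx z hz, ny z hz]
      by_cases h2 : z = q
      · subst h2
        rw [fq]
        cases oq <;> simp [nx z hz, ny z hz]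
      rw [f0 z h1 h2]
      simp [nx z hz, ny z hz]
    · have ha' : ¬ a = x ∧ ¬ a = y := by simpa [remove] using (Finset.mem_sdiff.1 ha).2
      simp [H, remove, substitute, ha'.1, ha'.2]
  have step2 : ReidemeisterIII H H' := by
    refine hR y H H' hy ?_ ?_ uinf ?_ (fun a ha => ?_) rfl fun i => rfl
    · obtain ⟨i, hi⟩ := pinf
      cases op
      · exact ⟨i, (hdsub hi).2.1⟩
      · exact ⟨i, (hdsub hi).2.1⟩
    · obtain ⟨i, hi⟩ := qinf
      cases oq
      · exact ⟨i, (hdsub hi).2.1⟩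
      · exact ⟨i, (hdsub hi).2.1⟩
    · simp [H, substitute, Ne.symm hxy]
    · simp [H, substitute, nx (a, false) ha, ny (a, false) ha]
  have step3 : ReidemeisterII H' (H'.remove {d, y}) := by
    have hmap : ∀ {i l}, l <:+: H.strand i → l.map σ <:+: H'.strand i := fun h => h.map σ
    refine ⟨d, y, ?_, ?_, ?_, rfl⟩
    · obtain ⟨i, hi⟩ := pinf
      have hi := hmap hi
      cases op
      · simp only [Bool.false_eq_true, if_false, List.map_cons, σd, σp] at hi
        exact Or.inl ⟨i, (hdsub hi).1⟩
      · simp only [if_true, List.map_cons, σd, σp] at hi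
        exact Or.inr ⟨i, (hdsub hi).2.2⟩
    · obtain ⟨i, hi⟩ := qinf
      have hi := hmap hi
      cases oq
      · simp only [Bool.false_eq_true, if_false, List.map_cons, σd, σq] at hi
        exact Or.inl ⟨i, (hdsub hi).1⟩
      · simp only [if_true, List.map_cons, σd, σq] at hi
        exact Or.inr ⟨i, (hdsub hi).2.2⟩
    · simp [H', H, permute, substitute, Ne.symm hxy, ndx, ndy]
  have step4 : Same (H'.remove {d, y}) G' := by
    -- The surviving arrow `x` receives the label of the cancelled arrow `d`. The strands agree end
    -- by end except at the two pairs formed by `p`, `q` and the ends of `d`, where only the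
    -- concatenations agree.
    refine same_of_injOn (Equiv.swap x d) (Equiv.injective _).injOn (fun i => ?_) fun a ha => ?_
    · change G'.strand i = (((H.strand i).map σ).filter _).map _
      rw [hs i, Hs, List.map_flatMap, List.filter_flatMap, List.map_flatMap]
      conv_lhs => rw [← List.flatMap_singleton' (G.strand i), List.map_flatMap]
      have e0 : ∀ z : ArrowEnd, z.1 ∈ G.arrows → z.1 ≠ d →
          ((if z.1 ∉ ({d, y} : Finset ℕ) then [z] else []).map
            fun w : ArrowEnd => (Equiv.swap x d w.1, w.2)) = [z] := by
        intro z hz hzd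
        simp [hzd, ny z hz, Equiv.swap_apply_of_ne_of_ne (nx z hz) hzd]
      have sp : Equiv.swap x d p.1 = p.1 := Equiv.swap_apply_of_ne_of_ne (nx p memp) hpd
      have sq : Equiv.swap x d q.1 = q.1 := Equiv.swap_apply_of_ne_of_ne (nx q memq) hqd
      have np := ny p memp
      have nq := ny q memq
      have xd := Ne.symm ndx
      refine (G.nodup_strand i).flatMap_eq_of_pairs
        [if op then (p, (d, false)) else ((d, false), p),
          if oq then (q, (d, true)) else ((d, true), q)] _ _ ?_ ?_ ?_ ?_
      · intro z hz
        simp only [List.mem_cons, List.not_mem_nil, or_false] at hz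
        rcases hz with rfl | rfl
        · cases op
          · exact ⟨hdp false, hp.infix_or i⟩
          · exact ⟨(hdp false).symm, hp.infix_or i⟩
        · cases oq
          · exact ⟨hdq true, hq.infix_or i⟩
          · exact ⟨(hdq true).symm, hq.infix_or i⟩
      · cases op <;> cases oq <;>
          simp [hpq, hdq, (hdp _).symm]
      · intro z hz
        simp only [List.mem_cons, List.not_mem_nil, or_false] at hz
        rcases hz with rfl | rfl
        · cases op
          · simp [hσ', fp, f0 _ (hdp false) (hdq false), σd, σp, σyt, σx, hpd, np, sp, xd, hxy]
          · simp [hσ', fp, f0 _ (hdp false) (hdq false), σd, σp, σyt, σx, hpd, np, sp, xd, hxy]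
        · cases oq
          · simp [hσ', fq, f0 _ (hdp true) (hdq true), σd, σq, σyh, σx, hqd, nq, sq, xd, hxy]
          · simp [hσ', fq, f0 _ (hdp true) (hdq true), σd, σq, σyh, σx, hqd, nq, sq, xd, hxy]
      · intro z hz hz'
        have memz := mem_arrows_of_mem_strand hz
        simp only [List.mem_cons, List.not_mem_nil, or_false] at hz'
        have h1 : z ≠ p ∧ z ≠ (d, false) := by
          have := hz' _ (Or.inl rfl)
          cases op
          · exact ⟨this.2, this.1⟩
          · exact this
        have h2 : z ≠ q ∧ z ≠ (d, true) := by
          have := hz' _ (Or.inr rfl)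
          cases oq
          · exact ⟨this.2, this.1⟩
          · exact this
        have hzd : z.1 ≠ d := by
          intro h
          obtain ⟨z, s⟩ := z
          obtain rfl : z = d := h
          cases s
          · exact h1.2 rfl
          · exact h2.2 rfl
        rw [f0 z h1.1 h2.1]
        by_cases h3 : z = u
        · subst h3
          simp [σu, hσ', hvd, ny v memv, Equiv.swap_apply_of_ne_of_ne (nx v memv) hvd]
        by_cases h4 : z = v
        · subst h4
          simp [σv, hσ', hud, ny u memu, Equiv.swap_apply_of_ne_of_ne (nx u memu) hud]
        simp [σ0 z h1.1 h2.1 h3 h4 (ny z memz), hσ'0 z h1.1 h1.2 h2.1 h2.2 h3 h4, hzd,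
          ny z memz, Equiv.swap_apply_of_ne_of_ne (nx z memz) hzd]
    · have ha' : ¬ a = d ∧ ¬ a = y := by simpa [remove] using (Finset.mem_sdiff.1 ha).2
      have ha'' : a = x ∨ a = y ∨ a ∈ G.arrows := by
        have : a ∈ insert x (insert y G.arrows) := (Finset.mem_sdiff.1 ha).1
        simpa using this
      rcases ha'' with rfl | rfl | ha''
      · rw [Equiv.swap_apply_left, hsign d memd]
        simp [H', H, remove, permute, substitute]
      · exact absurd rfl ha'.2
      · have hax := nx (a, false) ha''
        rw [Equiv.swap_apply_of_ne_of_ne hax ha'.1, hsign a ha'']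
        simp only at hax
        simp [H', H, remove, permute, substitute, hax, ha'.2]
  have h1 : RegularEquivalent H G :=
    RegularEquivalent.trans (.rel _ _ (Or.inr (Or.inl step1))) (.rel _ _ (Or.inl step0))
  have h2 : RegularEquivalent H' G' :=
    RegularEquivalent.trans (.rel _ _ (Or.inr (Or.inl step3))) (.rel _ _ (Or.inl step4))
  exact h1.symm.trans (RegularEquivalent.trans (.rel _ _ (Or.inr (Or.inr step2))) h2)

end GaussDiagram

/-! ### Third Reidemeister moves with reversed pieces of strands. -/

namespace GaussDiagram

variable {k : ℕ}

/-- The permutation of the ends of three arrows in a third Reidemeister move. -/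
abbrev triangleSwap (a b c : ℕ) : Equiv.Perm ArrowEnd :=
  Equiv.swap (ArrowEnd.tail a) (ArrowEnd.tail b) *
    Equiv.swap (ArrowEnd.head a) (ArrowEnd.tail c) *
    Equiv.swap (ArrowEnd.head b) (ArrowEnd.head c)

theorem triangleSwap_apply {a b c : ℕ} (hab : a ≠ b) (hac : a ≠ c) (hbc : b ≠ c) :
    triangleSwap a b c (a, false) = (b, false) ∧ triangleSwap a b c (b, false) = (a, false) ∧
    triangleSwap a b c (a, true) = (c, false) ∧ triangleSwap a b c (c, false) = (a, true) ∧
    triangleSwap a b c (b, true) = (c, true) ∧ triangleSwap a b c (c, true) = (b, true) := by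
  simp [Equiv.swap_apply_def, hab, hac, hbc, hab.symm, hac.symm, hbc.symm]

theorem triangleSwap_apply_of_ne {a b c : ℕ} {z : ArrowEnd} (h1 : z ≠ (a, false))
    (h2 : z ≠ (b, false)) (h3 : z ≠ (a, true)) (h4 : z ≠ (c, false)) (h5 : z ≠ (b, true))
    (h6 : z ≠ (c, true)) : triangleSwap a b c z = z := by
  simp [Equiv.swap_apply_of_ne_of_ne, h1, h2, h3, h4, h5, h6]

theorem triangleSwap_involutive {a b c : ℕ} (hab : a ≠ b) (hac : a ≠ c) (hbc : b ≠ c)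
    (z : ArrowEnd) : triangleSwap a b c (triangleSwap a b c z) = z := by
  obtain ⟨e1, e2, e3, e4, e5, e6⟩ := triangleSwap_apply hab hac hbc
  by_cases h1 : z = (a, false)
  · rw [h1, e1, e2]
  by_cases h2 : z = (b, false)
  · rw [h2, e2, e1]
  by_cases h3 : z = (a, true)
  · rw [h3, e3, e4]
  by_cases h4 : z = (c, false)
  · rw [h4, e4, e3]
  by_cases h5 : z = (b, true)
  · rw [h5, e5, e6]
  by_cases h6 : z = (c, true)
  · rw [h6, e6, e5]
  rw [triangleSwap_apply_of_ne h1 h2 h3 h4 h5 h6, triangleSwap_apply_of_ne h1 h2 h3 h4 h5 h6]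

/-- The sign by which the reversal of a piece of strand changes the signs of arrows. -/
def orientationSign (o : Bool) : ℤˣ := if o then 1 else -1

theorem equiv_triangleSwap_eq {a b c : ℕ} {σ : Equiv.Perm ArrowEnd} (hab : a ≠ b) (hac : a ≠ c)
    (hbc : b ≠ c) (h1 : σ (a, false) = (b, false)) (h2 : σ (b, false) = (a, false))
    (h3 : σ (a, true) = (c, false)) (h4 : σ (c, false) = (a, true))
    (h5 : σ (b, true) = (c, true)) (h6 : σ (c, true) = (b, true))
    (h0 : ∀ z, z ≠ (a, false) → z ≠ (b, false) → z ≠ (a, true) → z ≠ (c, false) → z ≠ (b, true) →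
      z ≠ (c, true) → σ z = z) : σ = triangleSwap a b c := by
  obtain ⟨e1, e2, e3, e4, e5, e6⟩ := triangleSwap_apply hab hac hbc
  refine Equiv.ext fun z => ?_
  by_cases k1 : z = (a, false)
  · rw [k1, e1, h1]
  by_cases k2 : z = (b, false)
  · rw [k2, e2, h2]
  by_cases k3 : z = (a, true)
  · rw [k3, e3, h3]
  by_cases k4 : z = (c, false)
  · rw [k4, e4, h4]
  by_cases k5 : z = (b, true)
  · rw [k5, e5, h5]
  by_cases k6 : z = (c, true)
  · rw [k6, e6, h6]
  rw [triangleSwap_apply_of_ne k1 k2 k3 k4 k5 k6, h0 z k1 k2 k3 k4 k5 k6]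

/-- The data of a third Reidemeister move in which the pieces of strands may be reversed. -/
structure Triangle (G : GaussDiagram k) (a b c : ℕ) (o₁ o₂ o₃ : Bool) : Prop where
  ne_ab : a ≠ b
  ne_ac : a ≠ c
  ne_bc : b ≠ c
  next₁ : G.NextIf o₁ (ArrowEnd.tail a) (ArrowEnd.tail b)
  next₂ : G.NextIf o₂ (ArrowEnd.head a) (ArrowEnd.tail c)
  next₃ : G.NextIf o₃ (ArrowEnd.head b) (ArrowEnd.head c)
  sign_ab : G.sign a * orientationSign o₂ = G.sign b * orientationSign o₃
  sign_bc : G.sign b * orientationSign o₁ = G.sign c * orientationSign o₂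

/-- These are the cases with an even number of reversed pieces. If two are reversed, the flip is
applied to the arrow that joins them: its replacement lies on the other side of its neighbours,
which restores the standard order on both pieces, and has the sign that the standard move needs. The
sign conditions of `Triangle` say that the three signs agree after all pieces have been turned to
the standard direction. -/
theorem Triangle.regularEquivalent_of_even {G G' : GaussDiagram k} {a b c : ℕ} {o₁ o₂ o₃ : Bool}
    (h : G.Triangle a b c o₁ o₂ o₃)
    (ho : o₁ = true ∧ o₂ = true ∧ o₃ = true ∨ o₁ = false ∧ o₂ = false ∧ o₃ = true ∨
      o₁ = false ∧ o₂ = true ∧ o₃ = false ∨ o₁ = true ∧ o₂ = false ∧ o₃ = false)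
    (hsign : G'.sign = G.sign) (hs : ∀ i, G'.strand i = (G.strand i).map (triangleSwap a b c)) :
    RegularEquivalent G G' := by
  obtain ⟨hab, hac, hbc, n1, n2, n3, s1, s2⟩ := h
  have e := triangleSwap_apply hab hac hbc
  rcases ho with ⟨rfl, rfl, rfl⟩ | ⟨rfl, rfl, rfl⟩ | ⟨rfl, rfl, rfl⟩ | ⟨rfl, rfl, rfl⟩ <;>
    simp only [orientationSign, if_true, if_false, Bool.false_eq_true, mul_one, mul_neg] at s1 s2
  · exact .rel _ _ (Or.inr (Or.inr ⟨a, b, c, hab, hac, hbc, n1, n2, n3, s1, s2, hsign, hs⟩))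
  · refine regularEquivalent_of_flip (d := a) (p := (b, false)) (q := (c, false)) (u := (b, true))
      (v := (c, true)) (op := true) (oq := true) n1 n2 n3 hab.symm hac.symm hab.symm hac.symm
      (by simp [hbc]) (by simp) (by simp) (by simp) (by simp) (fun _ _ => by rw [hsign]) _ hs
      ⟨e.2.1, e.1, e.2.2.2.1, e.2.2.1, e.2.2.2.2⟩
      (fun z h1 h2 h3 h4 h5 h6 => triangleSwap_apply_of_ne h2 h1 h4 h3 h5 h6) ?_
    intro y H H' hy m1 m2 m3 t1 t2 t3 t4
    have hyb : y ≠ b := by rintro rfl; exact hy n1.left_mem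
    have hyc : y ≠ c := by rintro rfl; exact hy n2.left_mem
    have hb := t2 b n1.left_mem
    have hc := t2 c n2.left_mem
    exact ⟨y, b, c, hyb, hyc, hbc, m1, m2, m3, by rw [t1, hb, ← s1],
      by rw [hb, hc]; simpa using s2, t3, t4⟩
  · refine regularEquivalent_of_flip (d := b) (p := (a, false)) (q := (c, true)) (u := (a, true))
      (v := (c, false)) (op := false) (oq := true) n1 n3 n2 hab hbc.symm hab hbc.symm
      (by simp) (by simp) (by simp [hac]) (by simp [hac.symm]) (by simp)
      (fun _ _ => by rw [hsign]) _ hs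
      ⟨e.1, e.2.1, e.2.2.2.2.2, e.2.2.2.2.1, e.2.2.1, e.2.2.2.1⟩
      (fun z h1 h2 h3 h4 h5 h6 => triangleSwap_apply_of_ne h1 h2 h5 h6 h4 h3) ?_
    intro y H H' hy m1 m2 m3 t1 t2 t3 t4
    have hya : y ≠ a := by rintro rfl; exact hy n2.left_mem
    have hyc : y ≠ c := by rintro rfl; exact hy n2.right_mem
    have ha := t2 a n2.left_mem
    have hc := t2 c n2.right_mem
    refine ⟨a, y, c, hya.symm, hac, hyc, m1, m3, m2, by rw [t1, ha, s1],
      by rw [hc, t1, s2], t3, fun i => ?_⟩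
    rw [t4 i, equiv_triangleSwap_eq (σ := Equiv.swap (ArrowEnd.tail y) (a, false) *
      Equiv.swap (ArrowEnd.head y) (c, true) * Equiv.swap (a, true) (c, false)) hya.symm hac hyc]
    case h0 =>
      intro z h1 h2 h3 h4 h5 h6
      simp [Equiv.swap_apply_of_ne_of_ne, h1, h2, h3, h4, h5, h6]
    all_goals
      simp [Equiv.swap_apply_def, hac, hyc, hac.symm, hya, hya.symm, hyc.symm]
  · refine regularEquivalent_of_flip (d := c) (p := (a, true)) (q := (b, true)) (u := (a, false))
      (v := (b, false)) (op := false) (oq := false) n2 n3 n1 hac hbc hac hbc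
      (by simp [hab]) (by simp) (by simp) (by simp) (by simp)
      (fun _ _ => by rw [hsign]) _ hs
      ⟨e.2.2.1, e.2.2.2.1, e.2.2.2.2.1, e.2.2.2.2.2, e.1, e.2.1⟩
      (fun z h1 h2 h3 h4 h5 h6 => triangleSwap_apply_of_ne h5 h6 h1 h2 h3 h4) ?_
    intro y H H' hy m1 m2 m3 t1 t2 t3 t4
    have hya : y ≠ a := by rintro rfl; exact hy n1.left_mem
    have hyb : y ≠ b := by rintro rfl; exact hy n1.right_mem
    have ha := t2 a n1.left_mem
    have hb := t2 b n1.right_mem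
    refine ⟨a, b, y, hab, hya.symm, hyb.symm, m3, m1, m2, by rw [hb, ha]; simpa using s1,
      by rw [hb, t1, s2], t3, fun i => ?_⟩
    rw [t4 i, equiv_triangleSwap_eq (σ := Equiv.swap (ArrowEnd.tail y) (a, true) *
      Equiv.swap (ArrowEnd.head y) (b, true) * Equiv.swap (a, false) (b, false)) hab hya.symm hyb.symm]
    case h0 =>
      intro z h1 h2 h3 h4 h5 h6
      simp [Equiv.swap_apply_of_ne_of_ne, h1, h2, h3, h4, h5, h6]
    all_goals
      simp [Equiv.swap_apply_def, hab, hyb, hab.symm, hya, hya.symm, hyb.symm]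

theorem NextIf.map {G G' : GaussDiagram k} {σ : Equiv.Perm ArrowEnd} {o : Bool} {x y : ArrowEnd}
    (h : G.NextIf o x y) (hs : ∀ i, G'.strand i = (G.strand i).map σ) (hx : σ x = y)
    (hy : σ y = x) : G'.NextIf (!o) x y := by
  cases o <;> obtain ⟨i, hi⟩ := h <;> refine ⟨i, ?_⟩ <;> rw [hs i] <;>
    simpa [hx, hy] using hi.map σ

/-- The move inverts the order on all three pieces, so with an odd number of reversed pieces the
inverse move is one with an even number. -/
theorem Triangle.regularEquivalent {G G' : GaussDiagram k} {a b c : ℕ} {o₁ o₂ o₃ : Bool}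
    (h : G.Triangle a b c o₁ o₂ o₃) (hsign : G'.sign = G.sign)
    (hs : ∀ i, G'.strand i = (G.strand i).map (triangleSwap a b c)) : RegularEquivalent G G' := by
  have e := triangleSwap_apply h.ne_ab h.ne_ac h.ne_bc
  have h' : G'.Triangle a b c (!o₁) (!o₂) (!o₃) := by
    refine ⟨h.ne_ab, h.ne_ac, h.ne_bc, h.next₁.map hs e.1 e.2.1, h.next₂.map hs e.2.2.1 e.2.2.2.1,
      h.next₃.map hs e.2.2.2.2.1 e.2.2.2.2.2, ?_, ?_⟩
    · have := h.sign_ab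
      rw [hsign]
      cases o₂ <;> cases o₃ <;> simpa [orientationSign, neg_eq_iff_eq_neg] using this
    · have := h.sign_bc
      rw [hsign]
      cases o₁ <;> cases o₂ <;> simpa [orientationSign, neg_eq_iff_eq_neg] using this
  have hs' : ∀ i, G.strand i = (G'.strand i).map (triangleSwap a b c) := fun i => by
    rw [hs i, List.map_map]
    conv_lhs => rw [← List.map_id (G.strand i)]
    exact List.map_congr_left fun z _ =>
      (triangleSwap_involutive h.ne_ab h.ne_ac h.ne_bc z).symm
  cases o₁ <;> cases o₂ <;> cases o₃ <;>
    first
    | exact h.regularEquivalent_of_even (by decide) hsign hs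
    | exact (h'.regularEquivalent_of_even (by decide) hsign.symm hs').symm

/-! ## Reversing strands -/

theorem countP_fst_eq (l : List ArrowEnd) (a : ℕ) :
    (l.countP fun x => x.1 = a) = l.count (a, false) + l.count (a, true) := by
  induction l with
  | nil => rfl
  | cons x l ih =>
    obtain ⟨b, s⟩ := x
    rw [List.countP_cons, List.count_cons, List.count_cons, ih]
    by_cases h : b = a <;> cases s <;> simp [h] <;> omega

theorem prod_pow_count {D : GaussDiagram k} (r : Fin k → Bool) {x : ArrowEnd} {i : Fin k}
    (h : x ∈ D.strand i) :
    (∏ j, if r j then (-1 : ℤˣ) ^ (D.strand j).count x else 1) = orientationSign (!r i) := by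
  rw [Finset.prod_eq_single i]
  · rw [List.count_eq_one_of_mem (D.nodup_strand i) h]
    cases r i <;> simp [orientationSign]
  · intro j _ hj
    rw [List.count_eq_zero.2 fun h' => hj (strand_unique h' h)]
    simp
  · simp

theorem reorient_sign {D : GaussDiagram k} (r : Fin k → Bool) {a : ℕ} {i j : Fin k}
    (hi : ArrowEnd.tail a ∈ D.strand i) (hj : ArrowEnd.head a ∈ D.strand j) :
    (D.reorient r).sign a = D.sign a * (orientationSign (!r i) * orientationSign (!r j)) := by
  rw [← prod_pow_count r hi, ← prod_pow_count r hj, ← Finset.prod_mul_distrib]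
  change D.sign a * _ = _
  congr 1
  refine Finset.prod_congr rfl fun m _ => ?_
  rw [countP_fst_eq, pow_add]
  split <;> simp

theorem NextIf.reorient {D : GaussDiagram k} (r : Fin k → Bool) {x y : ArrowEnd} {i : Fin k}
    (h : [x, y] <:+: D.strand i) : (D.reorient r).NextIf (!r i) x y := by
  cases hr : r i
  · refine ⟨i, ?_⟩
    simpa [GaussDiagram.reorient, hr] using h
  · refine ⟨i, ?_⟩
    simpa [GaussDiagram.reorient, hr] using List.reverse_infix.2 h

theorem Adjacent.reorient {D : GaussDiagram k} (r : Fin k → Bool) {x y : ArrowEnd}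
    (h : D.Adjacent x y) : (D.reorient r).Adjacent x y := by
  rcases h with ⟨i, hi⟩ | ⟨i, hi⟩ <;> have := NextIf.reorient r hi <;> revert this <;>
    cases r i <;> intro this
  · exact Or.inl this
  · exact Or.inr this
  · exact Or.inr this
  · exact Or.inl this

theorem Adjacent.exists_mem {D : GaussDiagram k} {x y : ArrowEnd} (h : D.Adjacent x y) :
    ∃ i, x ∈ D.strand i ∧ y ∈ D.strand i := by
  rcases h with ⟨i, hi⟩ | ⟨i, hi⟩ <;> exact ⟨i, hi.subset (by simp), hi.subset (by simp)⟩

theorem Same.reorient {D D' : GaussDiagram k} (h : Same D D') (r : Fin k → Bool) :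
    Same (D.reorient r) (D'.reorient r) := by
  obtain ⟨τ, hs, hsign⟩ := h
  refine ⟨τ, fun i => ?_, fun a ha => ?_⟩
  · simp only [GaussDiagram.reorient, hs i]
    split <;> simp
  · simp only [GaussDiagram.reorient, hs, hsign a ha, List.countP_map, Function.comp_def,
      τ.apply_eq_iff_eq]

theorem same_reorient_remove (D : GaussDiagram k) (S : Finset ℕ) (r : Fin k → Bool) :
    Same ((D.remove S).reorient r) ((D.reorient r).remove S) := by
  refine same_of_eq (fun i => ?_) fun a ha => ?_
  · simp only [GaussDiagram.reorient, GaussDiagram.remove]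
    split <;> simp
  · have ha : a ∉ S := (Finset.mem_sdiff.1 ha).2
    have key : ∀ l : List ArrowEnd, ((l.filter fun x => x.1 ∉ S).countP fun x => x.1 = a) =
        l.countP fun x => x.1 = a := fun l => by
      rw [List.countP_filter]
      refine List.countP_congr fun x _ => ?_
      simp only [Bool.and_eq_true, decide_eq_true_eq, and_iff_left_iff_imp]
      rintro rfl
      exact ha
    simp only [GaussDiagram.reorient, GaussDiagram.remove, key]

theorem ReidemeisterII.reorient {D D' : GaussDiagram k} (h : ReidemeisterII D D')
    (r : Fin k → Bool) : RIIEquivalent (D.reorient r) (D'.reorient r) := by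
  obtain ⟨a, b, ht, hh, hsign, rfl⟩ := h
  refine RIIEquivalent.trans (.rel _ _ (Or.inr ⟨a, b, ht.reorient r, hh.reorient r, ?_, rfl⟩))
    (same_reorient_remove D {a, b} r).symm.riiEquivalent
  obtain ⟨i, hi, hi'⟩ := ht.exists_mem
  obtain ⟨j, hj, hj'⟩ := hh.exists_mem
  rw [reorient_sign r hi hj, reorient_sign r hi' hj', hsign, neg_mul]

/-- The sign rule of `reorient` is exactly what makes the reoriented configuration a `Triangle`,
with orders given by the directions of the strands on which the three pieces lie. -/
theorem ReidemeisterIII.reorient {D D' : GaussDiagram k} (h : ReidemeisterIII D D')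
    (r : Fin k → Bool) : RegularEquivalent (D.reorient r) (D'.reorient r) := by
  obtain ⟨a, b, c, hab, hac, hbc, n1, n2, n3, s1, s2, hsign, hs⟩ := h
  -- `reorient` reads off signs from the number of ends of an arrow on each strand. Ends are
  -- exchanged only between neighbours, so these numbers do not change.
  have hcount : ∀ i w, (D'.strand i).count w = (D.strand i).count w := by
    intro i w
    have e := triangleSwap_apply hab hac hbc
    have hw : (D'.strand i).count w = (D.strand i).count (triangleSwap a b c w) := by
      rw [hs i]
      conv_lhs => rw [← triangleSwap_involutive hab hac hbc w]
      exact List.count_map_of_injective _ _ (Equiv.injective _) _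
    have pair : ∀ x y, D.Next x y → (D.strand i).count x = (D.strand i).count y := by
      intro x y hxy
      rcases hxy.infix_or i with h | h
      · rw [List.count_eq_one_of_mem (D.nodup_strand i) (h.subset (by simp)),
          List.count_eq_one_of_mem (D.nodup_strand i) (h.subset (by simp))]
      · rw [List.count_eq_zero.2 h.1, List.count_eq_zero.2 h.2]
    rw [hw]
    by_cases k1 : w = (a, false)
    · rw [k1, e.1, ← pair _ _ n1]
    by_cases k2 : w = (b, false)
    · rw [k2, e.2.1, pair _ _ n1]
    by_cases k3 : w = (a, true)
    · rw [k3, e.2.2.1, ← pair _ _ n2]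
    by_cases k4 : w = (c, false)
    · rw [k4, e.2.2.2.1, pair _ _ n2]
    by_cases k5 : w = (b, true)
    · rw [k5, e.2.2.2.2.1, ← pair _ _ n3]
    by_cases k6 : w = (c, true)
    · rw [k6, e.2.2.2.2.2, pair _ _ n3]
    rw [triangleSwap_apply_of_ne k1 k2 k3 k4 k5 k6]
  obtain ⟨i, hi⟩ := n1
  obtain ⟨j, hj⟩ := n2
  obtain ⟨l, hl⟩ := n3
  have mem : ∀ {x y m}, [x, y] <:+: D.strand m → x ∈ D.strand m ∧ y ∈ D.strand m :=
    fun h => ⟨h.subset (by simp), h.subset (by simp)⟩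
  refine Triangle.regularEquivalent (a := a) (b := b) (c := c) (o₁ := !r i) (o₂ := !r j)
    (o₃ := !r l) ⟨hab, hac, hbc, NextIf.reorient r hi, NextIf.reorient r hj,
      NextIf.reorient r hl, ?_, ?_⟩ ?_ fun m => ?_
  · rw [reorient_sign r (mem hi).1 (mem hj).1, reorient_sign r (mem hi).2 (mem hl).1, s1]
    cases r i <;> cases r j <;> cases r l <;> simp [orientationSign]
  · rw [reorient_sign r (mem hi).2 (mem hl).1, reorient_sign r (mem hj).2 (mem hl).2, s2]
    cases r i <;> cases r j <;> cases r l <;> simp [orientationSign]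
  · funext d
    simp only [GaussDiagram.reorient, hsign, countP_fst_eq, hcount]
  · simp only [GaussDiagram.reorient, hs m]
    split <;> simp

theorem RegularEquivalent.reorient {D D' : GaussDiagram k} (h : RegularEquivalent D D')
    (r : Fin k → Bool) : RegularEquivalent (D.reorient r) (D'.reorient r) := by
  induction h with
  | rel _ _ h =>
    rcases h with h | h | h
    · exact (h.reorient r).riiEquivalent.regularEquivalent
    · exact (h.reorient r).regularEquivalent
    · exact h.reorient r
  | refl => exact .refl _
  | symm _ _ _ ih => exact ih.symm
  | trans _ _ _ _ _ ih ih' => exact ih.trans ih'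

end GaussDiagram

namespace GaussDiagram

variable {k : ℕ}

/-! ## Attaching equivalent diagrams -/

theorem ext_of_strand {D D' : GaussDiagram k} (hsign : D.sign = D'.sign)
    (hs : ∀ i, D.strand i = D'.strand i) : D = D' :=
  GaussDiagram.ext (arrows_eq_of_strand hs) hsign (funext hs)

theorem reorient_false (D : GaussDiagram k) : D.reorient (fun _ => false) = D :=
  ext_of_strand (by funext a; simp [reorient]) fun i => by simp [reorient]

/-- The embedding with all strands running along the interval. -/
def StrandEmbedding.forward {D : GaussDiagram 1} (e : StrandEmbedding D k) :
    StrandEmbedding D k :=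
  { e with reversed := fun _ => false }

/-- Moves the reversal of strands from the embedding to the attached diagram, so that insertion into
the interval has to be studied only for strands running forward. -/
theorem attach_reorient (D : GaussDiagram 1) (T : GaussDiagram k) (e : StrandEmbedding D k) :
    D.attach (T.reorient e.reversed) e.forward = D.attach T e := by
  refine ext_of_strand ?_ fun i => ?_
  · funext a
    simp only [attach, StrandEmbedding.forward, reorient_false]
  · simp only [attach, StrandEmbedding.forward, reorient_false]

/-- The strand of a diagram with another one attached, all strands running forward. -/
theorem attach_forward_strand (D : GaussDiagram 1) (T : GaussDiagram k) (e : StrandEmbedding D k)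
    (i : Fin 1) : (D.attach T e.forward).strand i =
      (List.ofFn fun i : Fin k => (e.block i.castSucc).map oldEnd ++
        (T.strand (e.order i)).map newEnd).flatten ++ (e.block (Fin.last k)).map oldEnd := by
  simp only [attach, StrandEmbedding.forward, reorient_false]

theorem attach_forward_sign (D : GaussDiagram 1) (T : GaussDiagram k) (e : StrandEmbedding D k)
    (a : ℕ) : (D.attach T e.forward).sign a =
      if a % 2 = 0 then D.sign (a / 2) else T.sign (a / 2) := by
  simp only [attach, StrandEmbedding.forward, reorient_false]

variable {D : GaussDiagram 1} {T T' : GaussDiagram k}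

theorem Next.attach {x y : ArrowEnd} (h : T.Next x y) (e : StrandEmbedding D k) :
    (D.attach T e.forward).Next (newEnd x) (newEnd y) := by
  obtain ⟨i, hi⟩ := h
  refine ⟨0, ?_⟩
  rw [attach_forward_strand]
  refine List.IsInfix.trans ?_ (List.infix_append' [] _ _)
  refine List.IsInfix.trans ?_ (List.infix_of_mem_flatten (List.mem_ofFn.2 ⟨e.order.symm i, rfl⟩))
  rw [Equiv.apply_symm_apply]
  exact List.IsInfix.trans (hi.map newEnd) (List.suffix_append _ _).isInfix

theorem Adjacent.attach {x y : ArrowEnd} (h : T.Adjacent x y) (e : StrandEmbedding D k) :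
    (D.attach T e.forward).Adjacent (newEnd x) (newEnd y) :=
  h.imp (fun h => h.attach e) fun h => h.attach e

theorem attach_remove (S : Finset ℕ) (e : StrandEmbedding D k) :
    D.attach (T.remove S) e.forward =
      (D.attach T e.forward).remove (S.image fun a => 2 * a + 1) := by
  refine ext_of_strand ?_ fun i => ?_
  · funext a
    exact (attach_forward_sign _ _ e a).trans (attach_forward_sign _ T e a).symm
  · have h1 : ∀ l : List ArrowEnd, (l.map newEnd).filter
        (fun x => x.1 ∉ S.image fun a => 2 * a + 1) = (l.filter fun x => x.1 ∉ S).map newEnd := by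
      intro l
      rw [List.filter_map]
      congr 1
      refine List.filter_congr fun x _ => ?_
      simp [newEnd]
    have h2 : ∀ l : List ArrowEnd, (l.map oldEnd).filter
        (fun x => x.1 ∉ S.image fun a => 2 * a + 1) = l.map oldEnd := by
      intro l
      rw [List.filter_eq_self]
      intro x hx
      obtain ⟨y, -, rfl⟩ := List.mem_map.1 hx
      simp only [oldEnd, Finset.mem_image, not_exists, not_and, decide_eq_true_eq]
      intro a _
      omega
    change _ = ((D.attach T e.forward).strand i).filter _
    rw [attach_forward_strand, attach_forward_strand, List.filter_append, List.filter_flatten,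
      List.map_ofFn, h2]
    simp only [Function.comp_def, List.filter_append, h1, h2]
    rfl

theorem Same.attach (h : Same T T') (e : StrandEmbedding D k) :
    Same (D.attach T e.forward) (D.attach T' e.forward) := by
  obtain ⟨τ, hs, hsign⟩ := h
  refine same_of_injOn (fun a => if a % 2 = 0 then a else 2 * τ (a / 2) + 1) ?_ (fun i => ?_)
    fun a ha => ?_
  · intro a _ b _ hab
    have hab : (if a % 2 = 0 then a else 2 * τ (a / 2) + 1) =
      if b % 2 = 0 then b else 2 * τ (b / 2) + 1 := hab
    split_ifs at hab
    · exact hab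
    · omega
    · omega
    · have : a / 2 = b / 2 := τ.injective (by omega)
      omega
  · rw [attach_forward_strand, attach_forward_strand, List.map_append, List.map_flatten,
      List.map_ofFn]
    have h1 : ∀ l : List ArrowEnd, (l.map oldEnd).map (fun x => ((if x.1 % 2 = 0 then x.1 else
        2 * τ (x.1 / 2) + 1, x.2) : ArrowEnd)) = l.map oldEnd := fun l => by
      rw [List.map_map]
      exact List.map_congr_left fun x _ => by simp [oldEnd]
    have h2 : ∀ l : List ArrowEnd, (l.map newEnd).map (fun x => ((if x.1 % 2 = 0 then x.1 else
        2 * τ (x.1 / 2) + 1, x.2) : ArrowEnd)) =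
        (l.map fun x => (τ x.1, x.2)).map newEnd := fun l => by
      rw [List.map_map, List.map_map]
      refine List.map_congr_left fun x _ => ?_
      have : (2 * x.1 + 1) / 2 = x.1 := by omega
      simp [newEnd, Nat.add_mod, this]
    simp only [Function.comp_def, List.map_append, h1, h2, hs]
  · rw [attach_forward_sign, attach_forward_sign]
    have ha : a ∈ D.arrows.image (fun a => 2 * a) ∪ T.arrows.image (fun a => 2 * a + 1) := ha
    rcases Finset.mem_union.1 ha with ha | ha
    · obtain ⟨b, hb, rfl⟩ := Finset.mem_image.1 ha
      simp
    · obtain ⟨b, hb, rfl⟩ := Finset.mem_image.1 ha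
      have h1 : (2 * b + 1) / 2 = b := by omega
      have h2 : (2 * τ b + 1) / 2 = τ b := by omega
      simp [Nat.add_mod, h1, h2, hsign b hb]

theorem attach_forward_sign_new (e : StrandEmbedding D k) (a : ℕ) :
    (D.attach T e.forward).sign (2 * a + 1) = T.sign a := by
  have h1 : (2 * a + 1) / 2 = a := by omega
  simp [attach_forward_sign, Nat.add_mod, h1]

theorem ReidemeisterMove.attach (h : ReidemeisterMove T T') (e : StrandEmbedding D k) :
    ReidemeisterMove (D.attach T e.forward) (D.attach T' e.forward) := by
  rcases h with ⟨a, h, rfl⟩ | ⟨a, b, ht, hh, hsign, rfl⟩ |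
    ⟨a, b, c, hab, hac, hbc, n1, n2, n3, s1, s2, hsign, hs⟩
  · refine Or.inl ⟨2 * a + 1, h.attach e, ?_⟩
    rw [attach_remove, Finset.image_singleton]
  · refine Or.inr (Or.inl ⟨2 * a + 1, 2 * b + 1, ht.attach e, hh.attach e, ?_, ?_⟩)
    · rw [attach_forward_sign_new, attach_forward_sign_new, hsign]
    · rw [attach_remove, Finset.image_insert, Finset.image_singleton]
  · refine Or.inr (Or.inr ⟨2 * a + 1, 2 * b + 1, 2 * c + 1, by omega, by omega, by omega,
      n1.attach e, n2.attach e, n3.attach e, ?_, ?_, ?_, fun i => ?_⟩)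
    · rw [attach_forward_sign_new, attach_forward_sign_new, s1]
    · rw [attach_forward_sign_new, attach_forward_sign_new, s2]
    · funext d
      rw [attach_forward_sign, attach_forward_sign, hsign]
    · change _ = List.map (triangleSwap (2 * a + 1) (2 * b + 1) (2 * c + 1)) _
      have hn : ∀ x, triangleSwap (2 * a + 1) (2 * b + 1) (2 * c + 1) (newEnd x) =
          newEnd (triangleSwap a b c x) := fun x => by
        change Equiv.swap (newEnd (ArrowEnd.tail a)) (newEnd (ArrowEnd.tail b))
          (Equiv.swap (newEnd (ArrowEnd.head a)) (newEnd (ArrowEnd.tail c))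
            (Equiv.swap (newEnd (ArrowEnd.head b)) (newEnd (ArrowEnd.head c)) (newEnd x))) = _
        rw [newEnd_injective.swap_apply, newEnd_injective.swap_apply,
          newEnd_injective.swap_apply]
        rfl
      have ho : ∀ x, triangleSwap (2 * a + 1) (2 * b + 1) (2 * c + 1) (oldEnd x) =
          oldEnd x := fun x => by
        have : ∀ d s, oldEnd x ≠ (2 * d + 1, s) := fun d s => oldEnd_ne_newEnd x (d, s)
        exact triangleSwap_apply_of_ne (this _ _) (this _ _) (this _ _) (this _ _) (this _ _)
          (this _ _)
      rw [attach_forward_strand, attach_forward_strand, List.map_append, List.map_flatten,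
        List.map_ofFn]
      simp only [Function.comp_def, List.map_append, List.map_map, hn, ho, hs]

theorem Equivalent.attach_forward (h : Equivalent T T') (e : StrandEmbedding D k) :
    Equivalent (D.attach T e.forward) (D.attach T' e.forward) := by
  induction h with
  | rel _ _ h =>
    rcases h with h | h
    · exact (h.attach e).equivalent
    · exact .rel _ _ (Or.inr (h.attach e))
  | refl => exact .refl _
  | symm _ _ _ ih => exact ih.symm
  | trans _ _ _ _ _ ih ih' => exact ih.trans ih'

/-- Reorienting comes first and preserves equivalence by RII and RIII; inserting forward strands
then turns every move into a move. -/
theorem RegularEquivalent.attach (h : RegularEquivalent T T') (e : StrandEmbedding D k) :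
    Equivalent (D.attach T e) (D.attach T' e) := by
  rw [← attach_reorient D T, ← attach_reorient D T']
  exact (h.reorient e.reversed).equivalent.attach_forward e

/-- Attaching a diagram without arrows changes nothing. -/
theorem same_attach_of_arrows_eq_empty (hT : T.arrows = ∅) (e : StrandEmbedding D k) :
    Same D (D.attach T e) := by
  have h0 : ∀ i, T.strand i = [] := fun i => List.eq_nil_iff_forall_not_mem.2 fun x hx => by
    have := mem_arrows_of_mem_strand hx
    simp [hT] at this
  refine same_of_injOn (fun a => 2 * a) (fun a _ b _ h => by simpa using h) (fun i => ?_)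
    fun a _ => ?_
  · obtain rfl : i = 0 := Subsingleton.elim _ _
    have h1 : ∀ i, (T.reorient e.reversed).strand i = [] := fun i => by
      simp only [GaussDiagram.reorient, h0]
      split <;> rfl
    have h2 : List.ofFn (fun i : Fin k => (e.block i.castSucc).map oldEnd) ++
        [(e.block (Fin.last k)).map oldEnd] = (List.ofFn e.block).map (List.map oldEnd) := by
      rw [List.map_ofFn, List.ofFn_succ_last]
      rfl
    simp only [GaussDiagram.attach, h1, List.map_nil, List.append_nil]
    rw [← e.flatten_block, ← List.flatten_concat, h2, ← List.map_flatten]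
    rfl
  · simp [GaussDiagram.attach]

end GaussDiagram

open GaussDiagram

/-! ## Words as lists of horizontal arrows -/

section WordEnds

variable {α Y : Type*} [DecidableEq α] (f : Y → α × α)

/-- The endpoints on the strand `i` of the horizontal arrows of a word, where the letter `y` is an
arrow from the strand `(f y).1` to the strand `(f y).2`. -/
def wordEnds (i : α) : List (Y × Bool) → List ArrowEnd
  | [] => []
  | x :: w =>
    (if (f x.1).1 = i then [ArrowEnd.tail w.length]
      else if (f x.1).2 = i then [ArrowEnd.head w.length] else []) ++ wordEnds i w

/-- The signs of the horizontal arrows of a word. -/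
def wordSign : List (Y × Bool) → ℕ → ℤˣ
  | [], _ => 1
  | x :: w, a => if a = w.length then (if x.2 then 1 else -1) else wordSign w a

/-- The labels of the letters with a given property. -/
def wordLabels (P : Y → Prop) [DecidablePred P] : List (Y × Bool) → Finset ℕ
  | [] => ∅
  | x :: w => if P x.1 then insert w.length (wordLabels P w) else wordLabels P w

/-- The word without the letters whose labels belong to `S`. -/
def wordKeep (S : Finset ℕ) : List (Y × Bool) → List (Y × Bool)
  | [] => []
  | x :: w => if w.length ∈ S then wordKeep S w else x :: wordKeep S w

/-- The number of natural numbers below `a` that are not in `S`. -/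
def rank (S : Finset ℕ) (a : ℕ) : ℕ := ((Finset.range a).filter (· ∉ S)).card

theorem rank_succ (S : Finset ℕ) (a : ℕ) :
    rank S (a + 1) = if a ∈ S then rank S a else rank S a + 1 := by
  rw [rank, Finset.range_add_one, Finset.filter_insert]
  split_ifs <;> simp_all [rank]

theorem rank_mono (S : Finset ℕ) : Monotone (rank S) := fun _ _ h =>
  Finset.card_le_card (Finset.filter_subset_filter _ (Finset.range_mono h))

theorem rank_lt {S : Finset ℕ} {a b : ℕ} (ha : a ∉ S) (h : a < b) : rank S a < rank S b := by
  have h1 := rank_mono S (Nat.succ_le_of_lt h)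
  rw [Nat.succ_eq_add_one, rank_succ, if_neg ha] at h1
  omega

theorem rank_injOn (S : Finset ℕ) : Set.InjOn (rank S) {a | a ∉ S} := fun a ha b hb h => by
  rcases lt_trichotomy a b with h1 | h1 | h1
  · have := rank_lt ha h1; omega
  · exact h1
  · have := rank_lt hb h1; omega

variable {f}

theorem lt_of_mem_wordEnds {i : α} {w : List (Y × Bool)} {x : ArrowEnd}
    (h : x ∈ wordEnds f i w) : x.1 < w.length := by
  induction w with
  | nil => simp [wordEnds] at h
  | cons y w ih =>
    rw [wordEnds, List.mem_append] at h
    rw [List.length_cons]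
    rcases h with h | h
    · split_ifs at h <;> simp at h <;> simp [h]
    · exact (ih h).trans (Nat.lt_succ_self _)

theorem wordEnds_append (i : α) (u v : List (Y × Bool)) : wordEnds f i (u ++ v) =
    (wordEnds f i u).map (fun x => (x.1 + v.length, x.2)) ++ wordEnds f i v := by
  induction u with
  | nil => rfl
  | cons y u ih =>
    rw [List.cons_append, wordEnds, wordEnds, ih, List.map_append, List.append_assoc,
      List.length_append]
    congr 1
    split_ifs <;> rfl

theorem wordSign_append_of_lt (u : List (Y × Bool)) {v : List (Y × Bool)} {a : ℕ}
    (h : a < v.length) : wordSign (u ++ v) a = wordSign v a := by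
  induction u with
  | nil => rfl
  | cons y u ih =>
    rw [List.cons_append, wordSign, List.length_append, if_neg (by omega), ih]

theorem wordSign_append_add (u v : List (Y × Bool)) {a : ℕ} (h : a < u.length) :
    wordSign (u ++ v) (a + v.length) = wordSign u a := by
  induction u with
  | nil => simp at h
  | cons y u ih =>
    rw [List.cons_append, wordSign, wordSign, List.length_append]
    by_cases h1 : a = u.length
    · rw [if_pos (by omega), if_pos h1]
    · rw [if_neg (by omega), if_neg h1, ih (by simp at h; omega)]

theorem length_wordKeep (S : Finset ℕ) (w : List (Y × Bool)) :
    (wordKeep S w).length = rank S w.length := by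
  induction w with
  | nil => simp [wordKeep, rank]
  | cons x w ih =>
    rw [wordKeep, List.length_cons, rank_succ]
    split_ifs <;> simp [ih]

/-- A label is the number of letters after the letter, so when the labels in `S` are removed, `a`
becomes the number of surviving labels below `a`. -/
theorem wordEnds_wordKeep (i : α) (S : Finset ℕ) (w : List (Y × Bool)) :
    wordEnds f i (wordKeep S w) =
      ((wordEnds f i w).filter (fun x => x.1 ∉ S)).map fun x => (rank S x.1, x.2) := by
  induction w with
  | nil => rfl
  | cons x w ih =>
    rw [wordKeep, wordEnds, List.filter_append, List.map_append, ← ih]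
    split_ifs <;> simp [wordEnds, *, length_wordKeep]

theorem wordSign_wordKeep (S : Finset ℕ) (w : List (Y × Bool)) {a : ℕ} (ha : a < w.length)
    (haS : a ∉ S) : wordSign (wordKeep S w) (rank S a) = wordSign w a := by
  induction w with
  | nil => simp at ha
  | cons x w ih =>
    rw [List.length_cons] at ha
    rw [wordKeep, wordSign]
    by_cases h1 : a = w.length
    · subst h1
      rw [if_neg haS, wordSign, length_wordKeep, if_pos rfl, if_pos rfl]
    · rw [if_neg h1]
      have h2 := rank_lt haS (b := w.length) (by omega)
      split_ifs
      · exact ih (by omega)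
      · rw [wordSign, length_wordKeep, if_neg (by omega)]
        exact ih (by omega)

theorem wordKeep_append_of_forall_lt {S : Finset ℕ} (u : List (Y × Bool)) {v : List (Y × Bool)}
    (h : ∀ a ∈ S, a < v.length) : wordKeep S (u ++ v) = u ++ wordKeep S v := by
  induction u with
  | nil => rfl
  | cons x u ih =>
    rw [List.cons_append, wordKeep, if_neg, ih, List.cons_append]
    intro h1
    have := h _ h1
    rw [List.length_append] at this
    omega

theorem wordKeep_congr {S S' : Finset ℕ} {w : List (Y × Bool)}
    (h : ∀ a < w.length, a ∈ S ↔ a ∈ S') : wordKeep S w = wordKeep S' w := by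
  induction w with
  | nil => rfl
  | cons x w ih =>
    rw [wordKeep, wordKeep, ih fun a ha => h a (by simp; omega)]
    simp only [h w.length (by simp)]

theorem wordKeep_empty (w : List (Y × Bool)) : wordKeep ∅ w = w := by
  induction w with
  | nil => rfl
  | cons x w ih => simp [wordKeep, ih]

theorem wordKeep_of_forall_le {S : Finset ℕ} {w : List (Y × Bool)}
    (h : ∀ a ∈ S, w.length ≤ a) : wordKeep S w = w := by
  refine (wordKeep_congr fun a ha => ?_).trans (wordKeep_empty w)
  simp only [Finset.notMem_empty, iff_false]
  exact fun h1 => by have := h a h1; omega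

theorem lt_of_mem_wordLabels {P : Y → Prop} [DecidablePred P] {w : List (Y × Bool)} {a : ℕ}
    (h : a ∈ wordLabels P w) : a < w.length := by
  induction w with
  | nil => simp [wordLabels] at h
  | cons x w ih =>
    rw [wordLabels] at h
    rw [List.length_cons]
    split_ifs at h
    · rcases Finset.mem_insert.1 h with h | h
      · omega
      · exact (ih h).trans (Nat.lt_succ_self _)
    · exact (ih h).trans (Nat.lt_succ_self _)

theorem wordKeep_wordLabels (P : Y → Prop) [DecidablePred P] (w : List (Y × Bool)) :
    wordKeep (wordLabels P w) w = w.filter fun x => ¬ P x.1 := by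
  induction w with
  | nil => rfl
  | cons x w ih =>
    have h1 : wordKeep (wordLabels P (x :: w)) w = wordKeep (wordLabels P w) w := by
      refine wordKeep_congr fun a ha => ?_
      rw [wordLabels]
      split_ifs
      · rw [Finset.mem_insert, or_iff_right (by omega)]
      · rfl
    have h2 : w.length ∈ wordLabels P (x :: w) ↔ P x.1 := by
      have h3 : w.length ∉ wordLabels P w := fun h => lt_irrefl _ (lt_of_mem_wordLabels h)
      rw [wordLabels]
      split_ifs with h4 <;> simp [h3, h4]
    rw [wordKeep, h1, ih]
    by_cases h4 : P x.1 <;> simp [h2, h4]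

theorem mem_wordLabels_iff {P : Y → Prop} [DecidablePred P] {w : List (Y × Bool)} {a : ℕ} :
    a ∈ wordLabels P w ↔ ∃ u x v, w = u ++ x :: v ∧ a = v.length ∧ P x.1 := by
  induction w with
  | nil => simp [wordLabels]
  | cons y w ih =>
    have h1 : a ∈ wordLabels P (y :: w) ↔ (a = w.length ∧ P y.1) ∨ a ∈ wordLabels P w := by
      rw [wordLabels]
      split_ifs with h <;> simp [h]
    rw [h1, ih]
    constructor
    · rintro (⟨h, hP⟩ | ⟨u, x, v, h, ha, hP⟩)
      · exact ⟨[], y, w, rfl, h, hP⟩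
      · exact ⟨y :: u, x, v, by rw [h]; rfl, ha, hP⟩
    · rintro ⟨_ | ⟨z, u⟩, x, v, h, ha, hP⟩
      · obtain ⟨rfl, rfl⟩ := List.cons.inj h
        exact Or.inl ⟨ha, hP⟩
      · exact Or.inr ⟨u, x, v, (List.cons.inj h).2, ha, hP⟩

end WordEnds

/-! ## Diagrams of pure virtual braids -/

namespace PVWord

variable {k : ℕ}

theorem strand_eq_wordEnds (i : Fin k) (w : PVWord k) :
    strand i w = wordEnds (fun y : PVGen k => y.1) i w := by
  induction w with
  | nil => rfl
  | cons x w ih => rw [strand, wordEnds, ih]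

theorem sign_eq_wordSign (w : PVWord k) : sign w = wordSign w := by
  funext a
  induction w with
  | nil => rfl
  | cons x w ih => rw [sign, wordSign, ih]

theorem gaussDiagram_strand (w : PVWord k) (i : Fin k) :
    w.gaussDiagram.strand i = wordEnds (fun y : PVGen k => y.1) i w := strand_eq_wordEnds i w

theorem gaussDiagram_sign (w : PVWord k) : w.gaussDiagram.sign = wordSign w := sign_eq_wordSign w

theorem same_remove_gaussDiagram (w : PVWord k) (S : Finset ℕ) :
    Same (w.gaussDiagram.remove S) (gaussDiagram (wordKeep S w)) := by
  refine same_of_injOn (rank S) ((rank_injOn S).mono fun a ha => ?_) (fun i => ?_) fun a ha => ?_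
  · exact (Finset.mem_sdiff.1 ha).2
  · rw [gaussDiagram_strand, wordEnds_wordKeep, ← gaussDiagram_strand]
    rfl
  · obtain ⟨h1, h2⟩ := Finset.mem_sdiff.1 ha
    rw [gaussDiagram_sign, wordSign_wordKeep S w (Finset.mem_range.1 h1) h2, ← gaussDiagram_sign]
    rfl

theorem riiEquivalent_cancel (u v : PVWord k) (y : PVGen k) (b : Bool) :
    RIIEquivalent (gaussDiagram (u ++ (y, b) :: (y, !b) :: v)) (gaussDiagram (u ++ v)) := by
  -- Labels count the letters that follow, so these are the labels of the cancelling pair.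
  have h : wordKeep {v.length + 1, v.length} (u ++ (y, b) :: (y, !b) :: v) = u ++ v := by
    rw [wordKeep_append_of_forall_lt _ (by simp)]
    simp [wordKeep, wordKeep_of_forall_le]
  refine Relation.EqvGen.trans _ _ _ (.rel _ _ (Or.inr ⟨v.length + 1, v.length, Or.inl ⟨y.1.1, ?_⟩,
    Or.inl ⟨y.1.2, ?_⟩, ?_, rfl⟩)) (h ▸ (same_remove_gaussDiagram _ _).riiEquivalent)
  · rw [gaussDiagram_strand, wordEnds_append]
    simp only [wordEnds, if_true, List.length_cons]
    exact ⟨_, wordEnds (fun y : PVGen k => y.1) y.1.1 v, by simp; rfl⟩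
  · rw [gaussDiagram_strand, wordEnds_append]
    simp only [wordEnds, if_true, List.length_cons, if_neg y.2]
    exact ⟨_, wordEnds (fun y : PVGen k => y.1) y.1.2 v, by simp; rfl⟩
  · rw [gaussDiagram_sign, wordSign_append_of_lt _ (by simp), wordSign_append_of_lt _ (by simp)]
    cases b <;> simp [wordSign]

/-- Each step of free reduction is an RII move, and by confluence words that are equal in the free
group have a common reduct. -/
theorem riiEquivalent_of_mk_eq {w w' : PVWord k} (h : FreeGroup.mk w = FreeGroup.mk w') :
    RIIEquivalent w.gaussDiagram w'.gaussDiagram := by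
  have key : ∀ {a b : PVWord k}, FreeGroup.Red a b →
      RIIEquivalent a.gaussDiagram b.gaussDiagram := fun h => by
    induction h with
    | refl => exact .refl _
    | tail _ h ih =>
      obtain ⟨⟩ := h
      exact ih.trans (riiEquivalent_cancel _ _ _ _)
  obtain ⟨c, hc, hc'⟩ := FreeGroup.Red.exact.1 h
  exact (key hc).trans (key hc').symm

theorem map_wordEnds_eq_self {i : Fin k} {w : PVWord k} {g : ArrowEnd → ArrowEnd}
    (h : ∀ a < w.length, ∀ s, g (a, s) = (a, s)) :
    (wordEnds (fun y : PVGen k => y.1) i w).map g = wordEnds (fun y : PVGen k => y.1) i w := by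
  conv_rhs => rw [← List.map_id (wordEnds _ i w)]
  exact List.map_congr_left fun x hx => h x.1 (lt_of_mem_wordEnds hx) x.2

/-- Letters on disjoint pairs of strands have no strand in common, so exchanging them alters no
strand, only the labels. -/
theorem same_commute (u v : PVWord k) (y z : PVGen k × Bool)
    (h : Disjoint ({y.1.1.1, y.1.1.2} : Set (Fin k)) {z.1.1.1, z.1.1.2}) :
    Same (gaussDiagram (u ++ y :: z :: v)) (gaussDiagram (u ++ z :: y :: v)) := by
  have h1 : ∀ a, a < v.length → Equiv.swap v.length (v.length + 1) a = a := fun a ha =>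
    Equiv.swap_apply_of_ne_of_ne (by omega) (by omega)
  have h2 : ∀ a, Equiv.swap v.length (v.length + 1) (a + (v.length + 1 + 1)) =
      a + (v.length + 1 + 1) := fun a => Equiv.swap_apply_of_ne_of_ne (by omega) (by omega)
  refine ⟨Equiv.swap v.length (v.length + 1), fun i => ?_, fun a ha => ?_⟩
  · simp only [gaussDiagram_strand, wordEnds_append, wordEnds, List.map_append, List.map_map,
      List.length_cons]
    congr 1
    · exact List.map_congr_left fun x _ => by simp [h2]
    rw [map_wordEnds_eq_self fun a ha s => by rw [h1 a ha], ← List.append_assoc,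
      ← List.append_assoc]
    congr 1
    simp only [Set.disjoint_left, Set.mem_insert_iff, Set.mem_singleton_iff] at h
    have h3 := @h i
    split_ifs <;> simp_all
  · have ha : a < (u ++ y :: z :: v).length := Finset.mem_range.1 ha
    simp only [List.length_append, List.length_cons] at ha
    rw [gaussDiagram_sign, gaussDiagram_sign]
    rcases lt_or_ge a v.length with h3 | h3
    · rw [h1 a h3, wordSign_append_of_lt _ (by simp; omega), wordSign_append_of_lt _ (by simp; omega)]
      simp only [wordSign, List.length_cons]
      rw [if_neg (by omega), if_neg (by omega), if_neg (by omega), if_neg (by omega)]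
    rcases lt_or_ge a (v.length + 2) with h4 | h4
    · obtain rfl | rfl : a = v.length ∨ a = v.length + 1 := by omega
      · rw [Equiv.swap_apply_left, wordSign_append_of_lt _ (by simp),
          wordSign_append_of_lt _ (by simp)]
        simp [wordSign]
      · rw [Equiv.swap_apply_right, wordSign_append_of_lt _ (by simp),
          wordSign_append_of_lt _ (by simp)]
        simp [wordSign]
    · obtain ⟨b, rfl⟩ := Nat.exists_eq_add_of_le' h4
      rw [h2]
      exact (wordSign_append_add u (z :: y :: v) (by omega)).trans
        (wordSign_append_add u (y :: z :: v) (by omega)).symm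

end PVWord

/-! ### Relations of the pure virtual braid group as moves on diagrams. -/

namespace PVWord

variable {k : ℕ}

theorem regularEquivalent_triangle (u v : PVWord k) {i j l : Fin k} (hij : i ≠ j) (hil : i ≠ l)
    (hjl : j ≠ l) :
    RegularEquivalent
      (gaussDiagram (u ++ (⟨(i, j), hij⟩, true) :: (⟨(i, l), hil⟩, true) ::
        (⟨(j, l), hjl⟩, true) :: v))
      (gaussDiagram (u ++ (⟨(j, l), hjl⟩, true) :: (⟨(i, l), hil⟩, true) ::
        (⟨(i, j), hij⟩, true) :: v)) := by
  set m := v.length with hm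
  set D := gaussDiagram (u ++ (⟨(i, j), hij⟩, true) :: (⟨(i, l), hil⟩, true) ::
        (⟨(j, l), hjl⟩, true) :: v) with hD
  have hDs : ∀ t, D.strand t = (wordEnds (fun y : PVGen k => y.1) t u).map
      (fun x => (x.1 + (m + 3), x.2)) ++ ((if i = t then [(m + 2, false), (m + 1, false)] else
        if j = t then [(m + 2, true), (m, false)] else if l = t then [(m + 1, true), (m, true)]
        else []) ++ wordEnds (fun y : PVGen k => y.1) t v) := fun t => by
    rw [hD, gaussDiagram_strand, wordEnds_append]
    simp only [wordEnds, List.length_cons, ← hm]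
    congr 1
    simp only [← List.append_assoc]
    congr 1
    by_cases h1 : i = t
    · subst h1; simp [hij.symm, hil.symm]
    by_cases h2 : j = t
    · subst h2; simp [h1, hjl.symm]
    by_cases h3 : l = t
    · subst h3; simp [h1, h2]
    simp [h1, h2, h3]
  obtain ⟨e1, e2, e3, e4, e5, e6⟩ := triangleSwap_apply (a := m + 2) (b := m + 1) (c := m)
    (by omega) (by omega) (by omega)
  have hlt : ∀ a s, a < m → triangleSwap (m + 2) (m + 1) m (a, s) = (a, s) := fun a s h =>
    triangleSwap_apply_of_ne (by simp; omega) (by simp; omega) (by simp; omega) (by simp; omega)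
      (by simp; omega) (by simp; omega)
  have hge : ∀ a s, triangleSwap (m + 2) (m + 1) m (a + (m + 3), s) = (a + (m + 3), s) :=
    fun a s => triangleSwap_apply_of_ne (by simp; omega) (by simp; omega) (by simp; omega)
      (by simp; omega) (by simp; omega) (by simp; omega)
  have hmem : ∀ x : ArrowEnd, x.1 ∈ D.arrows ↔ x.1 < u.length + (m + 3) := fun x => by
    rw [hD]
    change x.1 ∈ Finset.range _ ↔ _
    rw [Finset.mem_range, List.length_append]
    rfl
  have hsgn : ∀ a, m ≤ a → a < m + 3 → D.sign a = 1 := fun a h1 h2 => by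
    rw [hD, gaussDiagram_sign, wordSign_append_of_lt _ (by simp; omega)]
    obtain rfl | rfl | rfl : a = m ∨ a = m + 1 ∨ a = m + 2 := by omega
    all_goals simp [wordSign, ← hm]
  have hσ : ∀ x, (triangleSwap (m + 2) (m + 1) m x).1 ∈ D.arrows ↔ x.1 ∈ D.arrows := by
    rintro ⟨a, s⟩
    rw [hmem, hmem]
    rcases lt_or_ge a m with h | h
    · rw [hlt a s h]
    rcases lt_or_ge a (m + 3) with h' | h'
    · obtain rfl | rfl | rfl : a = m ∨ a = m + 1 ∨ a = m + 2 := by omega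
      all_goals cases s <;> simp only [e1, e2, e3, e4, e5, e6] <;> omega
    · obtain ⟨b, rfl⟩ := Nat.exists_eq_add_of_le' h'
      rw [hge]
  -- By counting letters from the end, `μ i j`, `μ i l`, `μ j l` have the labels `m + 2`, `m + 1`,
  -- `m`, and in the other word `m`, `m + 1`, `m + 2`. After the move it remains to exchange `m` and
  -- `m + 2`.
  refine Relation.EqvGen.trans _ (D.permute _ hσ) _ (.rel _ _ (Or.inr (Or.inr ⟨m + 2, m + 1, m,
    by omega, by omega, by omega, ⟨i, ?_⟩, ⟨j, ?_⟩, ⟨l, ?_⟩, ?_, ?_, rfl, fun _ => rfl⟩)))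
    (.rel _ _ (Or.inl ⟨Equiv.swap m (m + 2), fun t => ?_, fun a ha => ?_⟩))
  · rw [hDs, if_pos rfl]
    exact ⟨_, _, List.append_assoc _ _ _⟩
  · rw [hDs, if_neg hij, if_pos rfl]
    exact ⟨_, _, List.append_assoc _ _ _⟩
  · rw [hDs, if_neg hil, if_neg hjl, if_pos rfl]
    exact ⟨_, _, List.append_assoc _ _ _⟩
  · rw [hsgn _ (by omega) (by omega), hsgn _ (by omega) (by omega)]
  · rw [hsgn _ (by omega) (by omega), hsgn _ (by omega) (by omega)]
  · change _ = ((D.strand t).map (triangleSwap (m + 2) (m + 1) m)).map _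
    have h1 : ∀ x : ArrowEnd, x.1 < m → (fun x : ArrowEnd => (Equiv.swap m (m + 2) x.1, x.2))
        (triangleSwap (m + 2) (m + 1) m x) = x := fun x h => by
      rw [hlt x.1 x.2 h]
      exact Prod.ext (Equiv.swap_apply_of_ne_of_ne (by omega) (by omega)) rfl
    have h2 : ∀ x : ArrowEnd, (fun x : ArrowEnd => (Equiv.swap m (m + 2) x.1, x.2))
        (triangleSwap (m + 2) (m + 1) m (x.1 + (m + 3), x.2)) = (x.1 + (m + 3), x.2) := fun x => by
      rw [hge]
      exact Prod.ext (Equiv.swap_apply_of_ne_of_ne (by simp; omega) (by simp; omega)) rfl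
    have h3 : Equiv.swap m (m + 2) (m + 1) = m + 1 :=
      Equiv.swap_apply_of_ne_of_ne (by omega) (by omega)
    rw [hDs, gaussDiagram_strand, wordEnds_append, List.map_map, List.map_append, List.map_append,
      List.map_map]
    congr 1
    · exact (List.map_congr_left fun x _ => h2 x).symm
    rw [map_wordEnds_eq_self fun a ha s => h1 (a, s) ha]
    simp only [wordEnds, List.length_cons, ← hm, ← List.append_assoc]
    congr 1
    clear h1 h2
    generalize triangleSwap (m + 2) (m + 1) m = σ at e1 e2 e3 e4 e5 e6 ⊢
    by_cases h1 : i = t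
    · subst h1; simp [hij.symm, hil.symm, e1, e2, h3]
    by_cases h2 : j = t
    · subst h2; simp [h1, hjl.symm, e3, e4]
    by_cases h4 : l = t
    · subst h4; simp [h1, h2, e5, e6, h3]
    simp [h1, h2, h4]
  · have ha := (hmem (a, true)).1 ha
    change _ = D.sign a
    rw [gaussDiagram_sign]
    rcases lt_or_ge a m with h | h
    · rw [Equiv.swap_apply_of_ne_of_ne (by omega) (by omega), hD, gaussDiagram_sign,
        wordSign_append_of_lt _ (by simp; omega), wordSign_append_of_lt _ (by simp; omega)]
      have h1 : a ≠ m := by omega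
      have h2 : a ≠ m + 1 := by omega
      have h3 : a ≠ m + 1 + 1 := by omega
      simp only [wordSign, List.length_cons, ← hm, h1, h2, h3, if_false]
    rcases lt_or_ge a (m + 3) with h' | h'
    · rw [hsgn a h h']
      obtain rfl | rfl | rfl : a = m ∨ a = m + 1 ∨ a = m + 2 := by omega
      · rw [Equiv.swap_apply_left, wordSign_append_of_lt _ (by simp; omega)]
        simp [wordSign, ← hm]
      · rw [Equiv.swap_apply_of_ne_of_ne (by omega) (by omega),
          wordSign_append_of_lt _ (by simp; omega)]
        simp [wordSign, ← hm]
      · rw [Equiv.swap_apply_right, wordSign_append_of_lt _ (by simp; omega)]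
        simp [wordSign, ← hm]
    · obtain ⟨b, rfl⟩ := Nat.exists_eq_add_of_le' h'
      rw [Equiv.swap_apply_of_ne_of_ne (by omega) (by omega), hD, gaussDiagram_sign]
      exact (wordSign_append_add u (_ :: _ :: _ :: v) (by simp at ha; omega)).trans
        (wordSign_append_add u (_ :: _ :: _ :: v) (by simp at ha; omega)).symm

/-- Elements of the free group whose diagrams are equivalent by second and third Reidemeister
moves. -/
def FreeRegular (g h : FreeGroup (PVGen k)) : Prop :=
  RegularEquivalent (gaussDiagram g.toWord) (gaussDiagram h.toWord)

theorem regularEquivalent_toWord_mk (w : PVWord k) :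
    RegularEquivalent (gaussDiagram (FreeGroup.mk w).toWord) w.gaussDiagram :=
  (riiEquivalent_of_mk_eq FreeGroup.mk_toWord).regularEquivalent

theorem freeRegular_mk {w w' : PVWord k} (h : RegularEquivalent w.gaussDiagram w'.gaussDiagram) :
    FreeRegular (FreeGroup.mk w) (FreeGroup.mk w') :=
  ((regularEquivalent_toWord_mk w).trans h).trans (regularEquivalent_toWord_mk w').symm

/-- The elements of the free group that can be inserted in every word. -/
def freeRegularSubgroup (k : ℕ) : Subgroup (FreeGroup (PVGen k)) where
  carrier := {g | ∀ u v, FreeRegular (u * g * v) (u * v)}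
  one_mem' u v := by rw [mul_one]; exact .refl _
  mul_mem' := fun {g h} hg hh u v => by
    have h1 := hg u (h * v)
    have h2 : u * (g * h) * v = u * g * (h * v) := by group
    rw [← mul_assoc u h v] at h1
    rw [h2]
    exact RegularEquivalent.trans h1 (hh u v)
  inv_mem' := fun {g} hg u v => by
    have h1 := hg (u * g⁻¹) v
    rw [inv_mul_cancel_right] at h1
    exact RegularEquivalent.symm h1

instance : (freeRegularSubgroup k).Normal where
  conj_mem g hg n u v := by
    have h1 := hg (u * n) (n⁻¹ * v)
    have h2 : u * n * (n⁻¹ * v) = u * v := by group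
    have h3 : u * n * g * (n⁻¹ * v) = u * (n * g * n⁻¹) * v := by group
    rwa [h2, h3] at h1

theorem mul_inv_mem_freeRegularSubgroup {a b : PVWord k}
    (h : ∀ u v, RegularEquivalent (gaussDiagram (u ++ a ++ v)) (gaussDiagram (u ++ b ++ v))) :
    FreeGroup.mk a * (FreeGroup.mk b)⁻¹ ∈ freeRegularSubgroup k := fun u v => by
  have h1 := freeRegular_mk (h u.toWord ((FreeGroup.mk b)⁻¹ * v).toWord)
  simp only [← FreeGroup.mul_mk, FreeGroup.mk_toWord] at h1
  have h2 : u * FreeGroup.mk b * ((FreeGroup.mk b)⁻¹ * v) = u * v := by group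
  have h3 : u * FreeGroup.mk a * ((FreeGroup.mk b)⁻¹ * v) =
      u * (FreeGroup.mk a * (FreeGroup.mk b)⁻¹) * v := by group
  rwa [h2, h3] at h1

/-- The elements that can be inserted anywhere without changing the class of the diagram form a
normal subgroup. So only the relators have to be examined: one type is RIII, the other leaves the
diagram unchanged up to labels. -/
theorem normalClosure_pvRelators_le :
    Subgroup.normalClosure (pvRelators k) ≤ freeRegularSubgroup k := by
  refine Subgroup.normalClosure_le_normal ?_
  rintro _ (⟨i, j, l, hij, hil, hjl, rfl⟩ | ⟨i, j, l, m, hij, hlm, hd, rfl⟩)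
  · refine mul_inv_mem_freeRegularSubgroup
      (a := [(⟨(i, j), hij⟩, true), (⟨(i, l), hil⟩, true), (⟨(j, l), hjl⟩, true)])
      (b := [(⟨(j, l), hjl⟩, true), (⟨(i, l), hil⟩, true), (⟨(i, j), hij⟩, true)]) fun u v => ?_
    simpa using regularEquivalent_triangle u v hij hil hjl
  · refine mul_inv_mem_freeRegularSubgroup
      (a := [(⟨(i, j), hij⟩, true), (⟨(l, m), hlm⟩, true)])
      (b := [(⟨(l, m), hlm⟩, true), (⟨(i, j), hij⟩, true)]) fun u v => ?_
    simpa using (same_commute u v (⟨(i, j), hij⟩, true) (⟨(l, m), hlm⟩, true)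
      hd).riiEquivalent.regularEquivalent

/-- Words that represent the same pure virtual braid have equivalent diagrams. -/
theorem regularEquivalent_of_toGroup_eq {w w' : PVWord k} (h : w.toGroup = w'.toGroup) :
    RegularEquivalent w.gaussDiagram w'.gaussDiagram := by
  have h1 : (FreeGroup.mk w)⁻¹ * FreeGroup.mk w' ∈ freeRegularSubgroup k :=
    normalClosure_pvRelators_le (QuotientGroup.eq.1 h)
  have h2 := h1 (FreeGroup.mk w) 1
  rw [mul_one, mul_one, mul_inv_cancel_left] at h2
  exact ((regularEquivalent_toWord_mk w).symm.trans (RegularEquivalent.symm h2)).trans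
    (regularEquivalent_toWord_mk w')

end PVWord

/-! ### Coloured braid words and `n`-trivial diagrams. -/

section WordMap

variable {α Y Z : Type*} [DecidableEq α]

theorem wordKeep_map (S : Finset ℕ) (g : Y → Z) (w : List (Y × Bool)) :
    wordKeep S (w.map fun x => (g x.1, x.2)) = (wordKeep S w).map fun x => (g x.1, x.2) := by
  induction w with
  | nil => rfl
  | cons x w ih =>
    simp only [List.map_cons, wordKeep, ih, List.length_map]
    split_ifs <;> rfl

theorem wordLabels_nonempty {P : Y → Prop} [DecidablePred P] {w : List (Y × Bool)}
    {x : Y × Bool} (hx : x ∈ w) (hP : P x.1) : (wordLabels P w).Nonempty := by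
  obtain ⟨u, v, rfl⟩ := List.append_of_mem hx
  exact ⟨v.length, mem_wordLabels_iff.2 ⟨u, x, v, rfl, rfl, hP⟩⟩

theorem disjoint_wordLabels {P Q : Y → Prop} [DecidablePred P] [DecidablePred Q]
    (h : ∀ y, P y → ¬ Q y) (w : List (Y × Bool)) :
    Disjoint (wordLabels P w) (wordLabels Q w) := by
  rw [Finset.disjoint_left]
  intro a ha hb
  obtain ⟨u, x, v, rfl, rfl, hP⟩ := mem_wordLabels_iff.1 ha
  obtain ⟨u', x', v', h1, h2, hQ⟩ := mem_wordLabels_iff.1 hb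
  obtain ⟨-, h3⟩ := List.append_inj' h1 (by simp [h2])
  rw [(List.cons.inj h3).1] at hP
  exact h _ hP hQ

/-- Removing the labels of the colours in `S` is erasing these colours. -/
theorem wordKeep_biUnion_wordLabels (S : Finset ℕ) (w : List ((Y × ℕ) × Bool)) :
    wordKeep (S.biUnion fun c => wordLabels (fun y : Y × ℕ => y.2 = c) w) w =
      eraseColors S w := by
  have h : S.biUnion (fun c => wordLabels (fun y : Y × ℕ => y.2 = c) w) =
      wordLabels (fun y : Y × ℕ => y.2 ∈ S) w := by
    ext a
    simp only [Finset.mem_biUnion, mem_wordLabels_iff]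
    constructor
    · rintro ⟨c, hc, u, x, v, h1, h2, rfl⟩
      exact ⟨u, x, v, h1, h2, hc⟩
    · rintro ⟨u, x, v, h1, h2, h3⟩
      exact ⟨_, h3, u, x, v, h1, h2, rfl⟩
  rw [h, wordKeep_wordLabels]
  rfl

end WordMap

namespace PVWord

variable {k : ℕ}

/-- The word without the colours of its letters. -/
def ofColored (w : List ((PVGen k × ℕ) × Bool)) : PVWord k := w.map fun x => (x.1.1, x.2)

theorem mk_ofColored (w : List ((PVGen k × ℕ) × Bool)) :
    FreeGroup.mk (ofColored w) = forgetColors (FreeGroup.mk w) := rfl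

/-- The sets of arrows are the colour classes. Removing several classes factors through killing one
of them, which already makes the element of the free group trivial; RII moves then remove all
remaining arrows. -/
theorem nTrivial_ofColored {n : ℕ} {w : List ((PVGen k × ℕ) × Bool)}
    (h1 : ∀ c ≤ n, ∃ x ∈ w, x.1.2 = c)
    (h2 : ∀ c ≤ n, killColors {c} (FreeGroup.mk w) = 1) :
    (gaussDiagram (ofColored w)).NTrivial n := by
  refine ⟨fun i => wordLabels (fun y => y.2 = (i : ℕ)) w, fun i => ⟨?_, ?_⟩, fun i j hij => ?_,
    fun S hS => ?_⟩
  · obtain ⟨x, hx, hc⟩ := h1 i (Nat.lt_succ_iff.1 i.2)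
    exact wordLabels_nonempty hx hc
  · intro a ha
    have := lt_of_mem_wordLabels ha
    exact Finset.mem_range.2 (by simpa [ofColored] using this)
  · exact disjoint_wordLabels (fun y h h' => hij (Fin.ext (h.symm.trans h'))) w
  · obtain ⟨c, hc⟩ := hS
    have h3 : S.biUnion (fun i => wordLabels (fun y : PVGen k × ℕ => y.2 = (i : ℕ)) w) =
        (S.image Fin.val).biUnion fun c => wordLabels (fun y => y.2 = c) w := by
      rw [Finset.image_biUnion]
    have h4 := same_remove_gaussDiagram (ofColored w)
      (S.biUnion fun i => wordLabels (fun y => y.2 = (i : ℕ)) w)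
    have h5 : wordKeep (S.biUnion fun i => wordLabels (fun y => y.2 = (i : ℕ)) w) (ofColored w) =
        ofColored (eraseColors (S.image Fin.val) w) := by
      rw [ofColored, wordKeep_map, h3, wordKeep_biUnion_wordLabels]
      rfl
    have h6 : FreeGroup.mk (ofColored (eraseColors (S.image Fin.val) w)) =
        FreeGroup.mk ([] : PVWord k) := by
      rw [mk_ofColored, mk_eraseColors]
      have h7 : S.image Fin.val = S.image Fin.val ∪ {(c : ℕ)} :=
        (Finset.union_eq_left.2 (Finset.singleton_subset_iff.2 (Finset.mem_image_of_mem _ hc))).symm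
      rw [h7, ← killColors_killColors, h2 c (Nat.lt_succ_iff.1 c.2), map_one, map_one]
      rfl
    rw [h5] at h4
    exact ⟨gaussDiagram [], rfl, h4.riiEquivalent.trans (riiEquivalent_of_mk_eq h6)⟩

/-- A pure virtual braid in `Γ_{n+1}` has an `n`-trivial diagram. -/
theorem exists_nTrivial {n : ℕ} {w : PVWord k} (hw : w ≠ [])
    (h : w.toGroup ∈ lowerCentralSubgroup (PureVirtualBraidGroup k) (n + 1)) :
    ∃ v : PVWord k, v.toGroup = w.toGroup ∧ v.gaussDiagram.NTrivial n := by
  obtain ⟨u, hu, hk⟩ := exists_colored (PresentedGroup.mk (pvRelators k))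
    (PresentedGroup.mk_surjective _) (Nat.le_add_left 1 n) h
  obtain ⟨x, hx⟩ := List.exists_mem_of_ne_nil w hw
  -- `n`-triviality asks for non-empty sets, but some colour may not occur in `u`. The prefix `p`
  -- supplies a cancelling pair of every colour; this is where a letter of `w` is needed.
  let p : List ((PVGen k × ℕ) × Bool) :=
    (List.range (n + 1)).flatMap fun c => [((x.1, c), true), ((x.1, c), false)]
  have hp : FreeGroup.mk p = 1 := by
    simp only [p]
    induction List.range (n + 1) with
    | nil => rfl
    | cons c l ih =>
      rw [List.flatMap_cons, ← FreeGroup.mul_mk, ih, mul_one]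
      exact mul_inv_cancel (FreeGroup.of (x.1, c))
  have hp' : FreeGroup.mk (p ++ u.toWord) = u := by
    rw [← FreeGroup.mul_mk, hp, one_mul, FreeGroup.mk_toWord]
  refine ⟨ofColored (p ++ u.toWord), ?_, nTrivial_ofColored (fun c hc => ?_) fun c hc => ?_⟩
  · rw [toGroup, mk_ofColored, hp', hu]
  · exact ⟨((x.1, c), true), List.mem_append_left _ (List.mem_flatMap.2
      ⟨c, List.mem_range.2 (by omega), by simp⟩), rfl⟩
  · rw [hp', hk c (by omega)]

end PVWord

/-! ### From `L_n`-equivalence to `n`-equivalence. -/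

namespace GaussDiagram

theorem LMove.nEquivalent {n : ℕ} {D D' : GaussDiagram 1} (h : LMove (n + 1) D D') :
    NEquivalent n D D' := by
  obtain ⟨k, -, w, e, h1, h2, h3⟩ := h
  -- The empty word represents 1, which lies in every term of the series and is excluded by the
  -- exactness condition of the move.
  have hw : w ≠ [] := by
    rintro rfl
    exact h2 (one_mem _)
  obtain ⟨v, hv, hT⟩ := PVWord.exists_nTrivial hw h1
  refine Relation.EqvGen.trans _ (D.attach v.gaussDiagram e) _
    (.rel _ _ (Or.inr (Or.inr ⟨k, _, e, hT, Same.refl _⟩))) (Equivalent.nEquivalent ?_)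
  exact ((PVWord.regularEquivalent_of_toGroup_eq hv).attach e).trans h3.equivalent

theorem LEquivalent.nEquivalent {n : ℕ} {D D' : GaussDiagram 1} (h : LEquivalent (n + 1) D D') :
    NEquivalent n D D' := by
  induction h with
  | rel _ _ h =>
    rcases h with h | h | h
    · exact .rel _ _ (Or.inl h)
    · exact .rel _ _ (Or.inr (Or.inl h))
    · exact h.nEquivalent
  | refl => exact .refl _
  | symm _ _ _ ih => exact .symm _ _ ih
  | trans _ _ _ _ _ ih ih' => exact .trans _ _ _ ih ih'

end GaussDiagram

theorem flatMap_range_eq_flatten_ofFn {β : Type*} (N : ℕ) (f : ℕ → List β) :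
    (List.range N).flatMap f = (List.ofFn fun i : Fin N => f i).flatten := by
  rw [List.flatMap_def]
  congr 1
  exact List.ext_getElem (by simp) fun i _ _ => by simp

theorem wordKeep_sublist {Y : Type*} (S : Finset ℕ) (w : List (Y × Bool)) :
    (wordKeep S w).Sublist w := by
  induction w with
  | nil => exact .slnil
  | cons x w ih =>
    rw [wordKeep]
    split_ifs
    · exact ih.cons x
    · exact ih.cons_cons x

/-! ## Words on slots of the interval -/

/-- Coloured arrows between different slots; the slots follow each other on the interval. -/
abbrev SlotGen := {p : ℕ × ℕ // p.1 ≠ p.2} × ℕ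

/-- Words in coloured arrows between slots. -/
abbrev SlotWord := List (SlotGen × Bool)

namespace SlotWord

/-- The endpoints in the slot `i`. -/
abbrev ends (i : ℕ) (w : SlotWord) : List ArrowEnd := wordEnds (fun y : SlotGen => y.1.1) i w

/-- All slots of the word are less than `N`. -/
def Below (N : ℕ) (w : SlotWord) : Prop := ∀ x ∈ w, x.1.1.1.1 < N ∧ x.1.1.1.2 < N

/-- All slots of the word are at least `N`. -/
def Above (N : ℕ) (w : SlotWord) : Prop := ∀ x ∈ w, N ≤ x.1.1.1.1 ∧ N ≤ x.1.1.1.2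

/-- A number greater than all slots of the word. -/
def bound (w : SlotWord) : ℕ := (w.map fun x => x.1.1.1.1 + x.1.1.1.2 + 1).sum

theorem below_bound (w : SlotWord) : w.Below w.bound := fun x hx => by
  have h : x.1.1.1.1 + x.1.1.1.2 + 1 ≤ w.bound :=
    List.le_sum_of_mem (List.mem_map_of_mem (f := fun x => x.1.1.1.1 + x.1.1.1.2 + 1) hx)
  omega

theorem Below.mono {N M : ℕ} {w : SlotWord} (h : w.Below N) (hNM : N ≤ M) : w.Below M :=
  fun x hx => ⟨(h x hx).1.trans_le hNM, (h x hx).2.trans_le hNM⟩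

theorem Below.append {N : ℕ} {v w : SlotWord} (hv : v.Below N) (hw : w.Below N) :
    SlotWord.Below N (v ++ w) := fun x hx => (List.mem_append.1 hx).elim (hv x) (hw x)

theorem Above.append {N : ℕ} {v w : SlotWord} (hv : v.Above N) (hw : w.Above N) :
    SlotWord.Above N (v ++ w) := fun x hx => (List.mem_append.1 hx).elim (hv x) (hw x)

theorem exists_below (v w : SlotWord) : ∃ N, 2 ≤ N ∧ v.Below N ∧ w.Below N :=
  ⟨v.bound + w.bound + 2, by omega, v.below_bound.mono (by omega), w.below_bound.mono (by omega)⟩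

theorem ends_eq_nil {i : ℕ} {w : SlotWord} (h : ∀ x ∈ w, x.1.1.1.1 ≠ i ∧ x.1.1.1.2 ≠ i) :
    ends i w = [] := by
  induction w with
  | nil => rfl
  | cons x w ih =>
    rw [ends, wordEnds, if_neg (h x (by simp)).1, if_neg (h x (by simp)).2, List.nil_append]
    exact ih fun y hy => h y (by simp [hy])

theorem Below.ends_eq_nil {N i : ℕ} {w : SlotWord} (h : w.Below N) (hi : N ≤ i) :
    ends i w = [] :=
  SlotWord.ends_eq_nil fun x hx => ⟨((h x hx).1.trans_le hi).ne, ((h x hx).2.trans_le hi).ne⟩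

theorem Above.ends_eq_nil {N i : ℕ} {w : SlotWord} (h : w.Above N) (hi : i < N) :
    ends i w = [] :=
  SlotWord.ends_eq_nil fun x hx => ⟨(hi.trans_le (h x hx).1).ne', (hi.trans_le (h x hx).2).ne'⟩

theorem Below.flatMap_eq {N M : ℕ} {w : SlotWord} (hN : w.Below N) (hM : w.Below M) :
    (List.range N).flatMap (ends · w) = (List.range M).flatMap (ends · w) := by
  have key : ∀ K, (List.range (N + K)).flatMap (ends · w) =
      (List.range N).flatMap (ends · w) := fun K => by
    induction K with
    | zero => rfl
    | succ K ih =>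
      rw [← add_assoc, List.range_succ, List.flatMap_append, ih]
      simp [hN.ends_eq_nil (Nat.le_add_right N K)]
  have key' : ∀ K, (List.range (M + K)).flatMap (ends · w) =
      (List.range M).flatMap (ends · w) := fun K => by
    induction K with
    | zero => rfl
    | succ K ih =>
      rw [← add_assoc, List.range_succ, List.flatMap_append, ih]
      simp [hM.ends_eq_nil (Nat.le_add_right M K)]
  rw [← key M, ← key' N, add_comm]

/-- The letters of the word on the first `N` slots, as a word in the generators of the pure
virtual braid group. -/
def toPV (N : ℕ) (w : SlotWord) : PVWord N := w.filterMap fun x =>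
  if h : x.1.1.1.1 < N ∧ x.1.1.1.2 < N then
    some (⟨(⟨x.1.1.1.1, h.1⟩, ⟨x.1.1.1.2, h.2⟩), fun h' => x.1.1.2 (congrArg Fin.val h')⟩, x.2)
  else none

theorem toPV_cons {N : ℕ} {x : SlotGen × Bool} (h : x.1.1.1.1 < N ∧ x.1.1.1.2 < N)
    (w : SlotWord) : toPV N (x :: w) = (⟨(⟨x.1.1.1.1, h.1⟩, ⟨x.1.1.1.2, h.2⟩),
      fun h' => x.1.1.2 (congrArg Fin.val h')⟩, x.2) :: toPV N w := by
  simp [toPV, h]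

/-- The corresponding homomorphism. -/
def toPVHom (N : ℕ) : FreeGroup SlotGen →* PureVirtualBraidGroup N :=
  FreeGroup.lift fun y => if h : y.1.1.1 < N ∧ y.1.1.2 < N then
    PresentedGroup.of ⟨(⟨y.1.1.1, h.1⟩, ⟨y.1.1.2, h.2⟩), fun h' => y.1.2 (congrArg Fin.val h')⟩
  else 1

theorem toGroup_cons {k : ℕ} (x : PVGen k × Bool) (w : PVWord k) :
    PVWord.toGroup (x :: w) = (if x.2 then PresentedGroup.of x.1 else (PresentedGroup.of x.1)⁻¹) *
      w.toGroup := by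
  obtain ⟨y, b⟩ := x
  rw [PVWord.toGroup, FreeGroup.mk_cons, map_mul]
  cases b <;> simp <;> rfl

theorem toGroup_toPV (N : ℕ) (w : SlotWord) :
    (toPV N w).toGroup = toPVHom N (FreeGroup.mk w) := by
  induction w with
  | nil => rfl
  | cons x w ih =>
    obtain ⟨y, b⟩ := x
    rw [FreeGroup.mk_cons, map_mul, ← ih]
    by_cases h : y.1.1.1 < N ∧ y.1.1.2 < N
    · rw [toPV_cons (x := (y, b)) h, toGroup_cons]
      cases b <;> simp [toPVHom, h]
    · have h1 : toPV N ((y, b) :: w) = toPV N w := by simp [toPV, h]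
      rw [h1]
      cases b <;> simp [toPVHom, h]

theorem length_toPV {N : ℕ} {w : SlotWord} (h : w.Below N) : (toPV N w).length = w.length := by
  induction w with
  | nil => rfl
  | cons x w ih =>
    rw [toPV_cons (h x (by simp)), List.length_cons, List.length_cons,
      ih fun y hy => h y (by simp [hy])]

theorem wordEnds_toPV {N : ℕ} {w : SlotWord} (h : w.Below N) (i : Fin N) :
    wordEnds (fun y : PVGen N => y.1) i (toPV N w) = ends i w := by
  induction w with
  | nil => rfl
  | cons x w ih =>
    have hw : SlotWord.Below N w := fun y hy => h y (by simp [hy])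
    rw [toPV_cons (h x (by simp)), wordEnds, ends, wordEnds, ih hw, length_toPV hw]
    simp only [Fin.ext_iff]

theorem wordSign_toPV {N : ℕ} {w : SlotWord} (h : w.Below N) :
    wordSign (toPV N w) = wordSign w := by
  funext a
  induction w with
  | nil => rfl
  | cons x w ih =>
    have hw : SlotWord.Below N w := fun y hy => h y (by simp [hy])
    rw [toPV_cons (h x (by simp)), wordSign, wordSign, ih hw, length_toPV hw]

/-- The word in slots that corresponds to a pure virtual braid word. -/
def ofPV {N : ℕ} (w : PVWord N) : SlotWord :=
  w.map fun x => ((⟨(x.1.1.1, x.1.1.2), fun h => x.1.2 (Fin.ext h)⟩, 0), x.2)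

theorem ofPV_below {N : ℕ} (w : PVWord N) : (ofPV w).Below N := fun x hx => by
  obtain ⟨y, -, rfl⟩ := List.mem_map.1 hx
  exact ⟨y.1.1.1.2, y.1.1.2.2⟩

theorem toPV_ofPV {N : ℕ} (w : PVWord N) : toPV N (ofPV w) = w := by
  induction w with
  | nil => rfl
  | cons x w ih =>
    rw [ofPV, List.map_cons, toPV_cons ⟨x.1.1.1.2, x.1.1.2.2⟩]
    exact congrArg (List.cons x) ih

/-- The Gauss diagram on the interval that a word in slots describes. -/
def diagram (w : SlotWord) : GaussDiagram 1 where
  arrows := Finset.range w.length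
  sign := wordSign w
  strand _ := (List.range w.bound).flatMap (ends · w)
  count_eq x := by
    have h := w.below_bound
    rw [Fin.sum_univ_one, flatMap_range_eq_flatten_ofFn, count_flatten_ofFn, ← length_toPV h,
      ← PVWord.sum_count_strand (toPV w.bound w) x]
    exact Finset.sum_congr rfl fun i _ => by rw [PVWord.strand_eq_wordEnds, wordEnds_toPV h]

theorem diagram_strand {N : ℕ} {w : SlotWord} (h : w.Below N) (i : Fin 1) :
    w.diagram.strand i = (List.range N).flatMap (ends · w) := w.below_bound.flatMap_eq h

theorem same_remove_diagram (w : SlotWord) (S : Finset ℕ) :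
    Same (w.diagram.remove S) (diagram (wordKeep S w)) := by
  refine same_of_injOn (rank S) ((rank_injOn S).mono fun a ha => ?_) (fun i => ?_) fun a ha => ?_
  · exact (Finset.mem_sdiff.1 ha).2
  · have h : SlotWord.Below w.bound (wordKeep S w) := fun x hx =>
      w.below_bound x ((wordKeep_sublist S w).subset hx)
    rw [diagram_strand h]
    change _ = ((w.diagram.strand i).filter _).map _
    rw [diagram_strand w.below_bound, List.filter_flatMap, List.map_flatMap]
    exact List.flatMap_congr fun i _ => wordEnds_wordKeep i S w
  · obtain ⟨h1, h2⟩ := Finset.mem_sdiff.1 ha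
    exact wordSign_wordKeep S w (Finset.mem_range.1 h1) h2

/-- The embedding of `N` strands that puts a strand at the end of each of the first `N` slots. -/
def embedding {N : ℕ} {w : SlotWord} (h : w.Below N) : StrandEmbedding w.diagram N where
  order := 1
  block := Fin.snoc (fun i : Fin N => ends i w) []
  flatten_block := by
    rw [diagram_strand h, List.ofFn_succ_last, flatMap_range_eq_flatten_ofFn]
    simp
  reversed _ := false

/-- Strands placed at the ends of the slots receive the arrows after those already there, which is
what appending to the word means. -/
theorem same_attach {N : ℕ} {v z : SlotWord} (hv : v.Below N) (hz : z.Below N) :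
    Same (v.diagram.attach (toPV N z).gaussDiagram (embedding hv)) (diagram (v ++ z)) := by
  have hb : ∀ a, (2 * a + 1) / 2 = a := fun a => by omega
  have hm : ∀ a ∈ (v.diagram.attach (toPV N z).gaussDiagram (embedding hv)).arrows,
      (∃ b < v.length, a = 2 * b) ∨ ∃ b < z.length, a = 2 * b + 1 := fun a ha => by
    rcases Finset.mem_union.1 ha with ha | ha
    · obtain ⟨b, h, rfl⟩ := Finset.mem_image.1 ha
      exact Or.inl ⟨b, Finset.mem_range.1 h, rfl⟩
    · obtain ⟨b, h, rfl⟩ := Finset.mem_image.1 ha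
      exact Or.inr ⟨b, length_toPV hz ▸ Finset.mem_range.1 h, rfl⟩
  refine same_of_injOn (fun a => if a % 2 = 0 then a / 2 + z.length else a / 2)
    (fun a ha b hb' h => ?_) (fun i => ?_) fun a ha => ?_
  · replace h : (if a % 2 = 0 then a / 2 + z.length else a / 2) =
      if b % 2 = 0 then b / 2 + z.length else b / 2 := h
    have h1 := hm a ha
    have h2 := hm b hb'
    split_ifs at h <;> omega
  · rw [diagram_strand (hv.append hz), flatMap_range_eq_flatten_ofFn]
    have h := attach_forward_strand v.diagram (toPV N z).gaussDiagram (embedding hv) i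
    refine .trans ?_ (congrArg _ h.symm)
    simp only [embedding, Fin.snoc_castSucc, Fin.snoc_last, List.map_nil, List.append_nil,
      List.map_flatten, List.map_ofFn, Function.comp_def, List.map_append, List.map_map,
      PVWord.gaussDiagram_strand, Equiv.Perm.coe_one, id_eq, wordEnds_toPV hz]
    congr 2
    funext i
    rw [ends, wordEnds_append]
    congr 1
    · exact List.map_congr_left fun x _ => by simp [oldEnd]
    · conv_lhs => rw [← List.map_id (wordEnds _ _ _)]
      exact List.map_congr_left fun x _ => by simp [newEnd, Nat.add_mod, hb]
  · refine .trans ?_ (attach_forward_sign v.diagram (toPV N z).gaussDiagram (embedding hv) a).symm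
    rw [PVWord.gaussDiagram_sign, wordSign_toPV hz]
    rcases hm a ha with ⟨b, h, rfl⟩ | ⟨b, h, rfl⟩
    · simp only [Nat.mul_mod_right, if_true, Nat.mul_div_cancel_left b two_pos]
      exact wordSign_append_add v z h
    · have h1 : ¬ (2 * b + 1) % 2 = 0 := by omega
      simp only [h1, if_false, hb]
      exact wordSign_append_of_lt v h

end SlotWord

/-! ### Juxtaposition of diagrams on the interval. -/

namespace GaussDiagram

theorem LEquivalent.trans {n : ℕ} {D D' D'' : GaussDiagram 1} (h : LEquivalent n D D')
    (h' : LEquivalent n D' D'') : LEquivalent n D D'' := Relation.EqvGen.trans _ _ _ h h'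

theorem LEquivalent.symm {n : ℕ} {D D' : GaussDiagram 1} (h : LEquivalent n D D') :
    LEquivalent n D' D := Relation.EqvGen.symm _ _ h

/-- The embedding of a strand at the beginning of the interval. -/
def StrandEmbedding.start (D : GaussDiagram 1) : StrandEmbedding D 1 where
  order := 1
  block := ![[], D.strand 0]
  flatten_block := by simp
  reversed _ := false

theorem attach_start_strand (D X : GaussDiagram 1) (i : Fin 1) :
    (D.attach X (.start D)).strand i =
      (X.strand 0).map newEnd ++ (D.strand 0).map oldEnd := by
  refine (attach_forward_strand D X (.start D) i).trans ?_
  simp [StrandEmbedding.start]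

theorem attach_start_sign (D X : GaussDiagram 1) (a : ℕ) :
    (D.attach X (.start D)).sign a = if a % 2 = 0 then D.sign (a / 2) else X.sign (a / 2) :=
  attach_forward_sign D X (.start D) a

/-- An embedding of strands in an interval, as an embedding in the interval that is extended at
its end. -/
def StrandEmbedding.extend {k : ℕ} {X : GaussDiagram 1} (e : StrandEmbedding X k)
    (D : GaussDiagram 1) : StrandEmbedding (D.attach X (.start D)) k where
  order := e.order
  block := Fin.snoc (fun i : Fin k => (e.block i.castSucc).map newEnd)
    ((e.block (Fin.last k)).map newEnd ++ (D.strand 0).map oldEnd)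
  flatten_block := by
    rw [attach_start_strand, ← e.flatten_block, List.ofFn_succ_last, List.ofFn_succ_last]
    simp [List.map_flatten, List.map_ofFn, Function.comp_def]
  reversed := e.reversed

theorem same_attach_extend {k : ℕ} {X : GaussDiagram 1} (D : GaussDiagram 1) (T : GaussDiagram k)
    (e : StrandEmbedding X k) :
    Same (D.attach (X.attach T e) (.start D)) ((D.attach X (.start D)).attach T (e.extend D)) := by
  rw [← attach_reorient X T e, ← attach_reorient _ T (e.extend D)]
  change Same _ ((D.attach X (.start D)).attach (T.reorient e.reversed) (e.extend D).forward)
  generalize T.reorient e.reversed = T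
  have h1 : ∀ b, (2 * b + 1) / 2 = b := fun b => by omega
  have h2 : ∀ b, (2 * b + 1) % 2 ≠ 0 := fun b => by omega
  -- The arrows of `D`, `X` and `T` with label `b` are labelled `2b`, `4b + 1`, `4b + 3` on the left
  -- and `4b`, `4b + 2`, `2b + 1` on the right.
  refine same_of_injOn (fun a => if a % 2 = 0 then 2 * a else
    if (a / 2) % 2 = 0 then a + 1 else a / 2) (fun a _ b _ h => ?_) (fun i => ?_) fun a _ => ?_
  · replace h : (if a % 2 = 0 then 2 * a else if (a / 2) % 2 = 0 then a + 1 else a / 2) =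
      if b % 2 = 0 then 2 * b else if (b / 2) % 2 = 0 then b + 1 else b / 2 := h
    split_ifs at h <;> omega
  · rw [attach_forward_strand, attach_start_strand, attach_forward_strand]
    simp only [StrandEmbedding.extend, Fin.snoc_castSucc, Fin.snoc_last, List.map_append,
      List.map_flatten, List.map_ofFn, Function.comp_def, List.map_map, List.append_assoc]
    have e1 : ∀ l : List ArrowEnd, l.map (fun x => oldEnd (newEnd x)) = l.map fun x =>
        ((if (newEnd (oldEnd x)).1 % 2 = 0 then 2 * (newEnd (oldEnd x)).1 else
          if ((newEnd (oldEnd x)).1 / 2) % 2 = 0 then (newEnd (oldEnd x)).1 + 1 else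
            (newEnd (oldEnd x)).1 / 2, (newEnd (oldEnd x)).2) : ArrowEnd) := fun l =>
      List.map_congr_left fun x _ => by
        simp only [oldEnd, newEnd, h1, h2, if_false, Nat.mul_mod_right, if_true]
        congr 1
    have e2 : ∀ l : List ArrowEnd, l.map newEnd = l.map fun x =>
        ((if (newEnd (newEnd x)).1 % 2 = 0 then 2 * (newEnd (newEnd x)).1 else
          if ((newEnd (newEnd x)).1 / 2) % 2 = 0 then (newEnd (newEnd x)).1 + 1 else
            (newEnd (newEnd x)).1 / 2, (newEnd (newEnd x)).2) : ArrowEnd) := fun l =>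
      List.map_congr_left fun x _ => by
        simp only [newEnd, h1, h2, if_false]
    have e3 : ∀ l : List ArrowEnd, l.map (fun x => oldEnd (oldEnd x)) = l.map fun x =>
        ((if (oldEnd x).1 % 2 = 0 then 2 * (oldEnd x).1 else
          if ((oldEnd x).1 / 2) % 2 = 0 then (oldEnd x).1 + 1 else
            (oldEnd x).1 / 2, (oldEnd x).2) : ArrowEnd) := fun l =>
      List.map_congr_left fun x _ => by
        simp only [oldEnd, Nat.mul_mod_right, if_true]
    rw [e1, e3]
    simp only [e1, e2]
  · rw [attach_start_sign, attach_forward_sign, attach_start_sign, attach_forward_sign]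
    obtain ⟨b, rfl | rfl⟩ := Nat.even_or_odd' a
    · have h3 : 2 * (2 * b) / 2 = 2 * b := by omega
      have h4 : 2 * b / 2 = b := by omega
      simp only [Nat.mul_mod_right, if_true, h3, h4]
    · obtain ⟨c, rfl | rfl⟩ := Nat.even_or_odd' b
      · have h3 : (2 * (2 * c) + 1 + 1) % 2 = 0 := by omega
        have h4 : (2 * (2 * c) + 1 + 1) / 2 = 2 * c + 1 := by omega
        have h5 : 2 * c / 2 = c := by omega
        simp only [h1, h2, if_false, Nat.mul_mod_right, if_true, h3, h4, h5]
      · simp only [h1, h2, if_false]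

/-- A move on one factor is a move on the juxtaposition: for `L_n`-moves the embedding of the
strands is extended over the other factor. -/
theorem LEquivalent.attach_start {n : ℕ} {X X' : GaussDiagram 1} (h : LEquivalent n X X')
    (D : GaussDiagram 1) : LEquivalent n (D.attach X (.start D)) (D.attach X' (.start D)) := by
  induction h with
  | rel _ _ h =>
    rcases h with h | h | ⟨k, hk, w, e, h1, h2, h3⟩
    · exact .rel _ _ (Or.inl (h.attach (.start D)))
    · exact .rel _ _ (Or.inr (Or.inl (h.attach (.start D))))
    · exact Relation.EqvGen.trans _ _ _
        (.rel _ _ (Or.inr (Or.inr ⟨k, hk, w, e.extend D, h1, h2, .refl _⟩)))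
        (Relation.EqvGen.trans _ _ _ (.rel _ _ (Or.inl (same_attach_extend D _ e).symm))
          (.rel _ _ (Or.inl (h3.attach (.start D)))))
  | refl => exact .refl _
  | symm _ _ _ ih => exact ih.symm
  | trans _ _ _ _ _ ih ih' => exact ih.trans ih'

end GaussDiagram

/-! ### Moves on words in slots. -/

namespace SlotWord

theorem equivalent_append {N : ℕ} {v z z' : SlotWord} (hv : v.Below N) (hz : z.Below N)
    (hz' : z'.Below N) (h : (toPV N z).toGroup = (toPV N z').toGroup) :
    Equivalent (diagram (v ++ z)) (diagram (v ++ z')) :=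
  ((same_attach hv hz).symm.equivalent.trans
    ((PVWord.regularEquivalent_of_toGroup_eq h).attach (embedding hv))).trans
      (same_attach hv hz').equivalent

/-- The diagram only depends on the element of the free group. -/
theorem equivalent_of_mk_eq {w w' : SlotWord} (h : FreeGroup.mk w = FreeGroup.mk w') :
    Equivalent w.diagram w'.diagram := by
  obtain ⟨N, -, h1, h2⟩ := exists_below w w'
  have h0 : SlotWord.Below N [] := fun x hx => by simp at hx
  have := equivalent_append h0 h1 h2 (by rw [toGroup_toPV, toGroup_toPV, h])
  simpa using this

/-- Appending an element of depth exactly `n` is an `L_n`-move on strands at the ends of the slots.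
The hypothesis gives only depth at least `n`, so the remaining case is reduced to this one. -/
theorem lEquivalent_append {n : ℕ} (hn : 1 ≤ n) (v : SlotWord) {z : SlotWord}
    (hz : FreeGroup.mk z ∈ lowerCentralSubgroup (FreeGroup SlotGen) n) :
    LEquivalent n (diagram (v ++ z)) v.diagram := by
  obtain ⟨N, hN, h1, h2⟩ := exists_below v z
  have key : ∀ {u y : SlotWord}, u.Below N → y.Below N →
      (toPV N y).toGroup ∈ lowerCentralSubgroup (PureVirtualBraidGroup N) n →
      (toPV N y).toGroup ∉ lowerCentralSubgroup (PureVirtualBraidGroup N) (n + 1) →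
      LEquivalent n u.diagram (diagram (u ++ y)) := fun hu hy h h' =>
    .rel _ _ (Or.inr (Or.inr ⟨N, by omega, _, embedding hu, h, h', same_attach hu hy⟩))
  have hz' : (toPV N z).toGroup ∈ lowerCentralSubgroup (PureVirtualBraidGroup N) n := by
    rw [toGroup_toPV]
    exact map_mem_lowerCentralSubgroup _ hz
  by_cases h3 : (toPV N z).toGroup ∈ lowerCentralSubgroup (PureVirtualBraidGroup N) (n + 1)
  -- If `z` is too deep for a move, take `g` of exact depth `n`. Then `z g` has exact depth `n` too,
  -- and `v` and `v z` are both one move away from `v z g`.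
  · obtain ⟨g, hg, hg'⟩ := exists_mem_lowerCentralSubgroup_notMem
      (p := (⟨0, by omega⟩ : Fin N)) (q := ⟨1, by omega⟩) (by simp) hn
    obtain ⟨f, rfl⟩ := PresentedGroup.mk_surjective (pvRelators N) g
    have hf : (toPV N (ofPV f.toWord)).toGroup = PresentedGroup.mk (pvRelators N) f := by
      rw [toPV_ofPV, PVWord.toGroup, FreeGroup.mk_toWord]
    have hzf : (toPV N (z ++ ofPV f.toWord)).toGroup =
        (toPV N z).toGroup * PresentedGroup.mk (pvRelators N) f := by
      rw [toGroup_toPV, ← FreeGroup.mul_mk, map_mul, ← toGroup_toPV, ← toGroup_toPV, hf]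
    have h4 := key (h1.append h2) (ofPV_below f.toWord) (hf ▸ hg) (hf ▸ hg')
    have h5 := key h1 (h2.append (ofPV_below f.toWord)) (hzf ▸ mul_mem hz' hg) fun h => hg' (by
      rw [hzf] at h
      exact (Subgroup.mul_mem_cancel_left _ h3).1 h)
    rw [← List.append_assoc] at h5
    exact h4.trans h5.symm
  · exact (key h1 h2 hz' h3).symm

/-! ## Shifting slots -/

/-- The word with all slots shifted by one. -/
def shift (w : SlotWord) : SlotWord :=
  w.map fun x => ((⟨(x.1.1.1.1 + 1, x.1.1.1.2 + 1), fun h => x.1.1.2 (Nat.succ_injective h)⟩,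
    x.1.2), x.2)

theorem length_shift (w : SlotWord) : (shift w).length = w.length := List.length_map _

theorem ends_shift_zero (w : SlotWord) : ends 0 (shift w) = [] :=
  SlotWord.ends_eq_nil fun x hx => by
    obtain ⟨y, -, rfl⟩ := List.mem_map.1 hx
    exact ⟨Nat.succ_ne_zero _, Nat.succ_ne_zero _⟩

theorem ends_shift_succ (i : ℕ) (w : SlotWord) : ends (i + 1) (shift w) = ends i w := by
  induction w with
  | nil => rfl
  | cons x w ih =>
    rw [shift, List.map_cons, ends, wordEnds, ends, wordEnds]
    simp only [Nat.add_right_cancel_iff, List.length_map]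
    exact congrArg _ ih

theorem wordSign_shift (w : SlotWord) : wordSign (shift w) = wordSign w := by
  funext a
  induction w with
  | nil => rfl
  | cons x w ih =>
    rw [shift, List.map_cons, wordSign, wordSign, List.length_map]
    exact ite_congr rfl (fun _ => rfl) fun _ => ih

theorem Below.shift {N : ℕ} {w : SlotWord} (h : w.Below N) : (shift w).Below (N + 1) :=
  fun x hx => by
    obtain ⟨y, hy, rfl⟩ := List.mem_map.1 hx
    exact ⟨Nat.succ_lt_succ (h y hy).1, Nat.succ_lt_succ (h y hy).2⟩

/-- Regrouping along the interval: what stands at the end of slot `i` stands equally well at the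
beginning of slot `i + 1`. -/
theorem flatMap_range_shift {β : Type*} (v z y : ℕ → List β) (h0 : y 0 = [])
    (hs : ∀ i, y (i + 1) = z i) (N : ℕ) : (List.range (N + 1)).flatMap (fun i => y i ++ v i) =
      (List.range N).flatMap (fun i => v i ++ z i) ++ v N := by
  induction N with
  | zero => simp [h0]
  | succ N ih =>
    rw [List.range_succ, List.flatMap_append, ih, List.range_succ, List.flatMap_append]
    simp [hs]

/-- Braids that come last can be moved to the beginning at the cost of a shift. -/
theorem same_shift (v z : SlotWord) : Same (diagram (v ++ z)) (diagram (shift z ++ v)) := by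
  obtain ⟨N, -, hv, hz⟩ := exists_below v z
  refine same_of_injOn (fun a => if a < z.length then a + v.length else a - z.length)
    (fun a ha b hb h => ?_) (fun i => ?_) fun a ha => ?_
  · replace ha : a ∈ Finset.range (v ++ z).length := ha
    replace hb : b ∈ Finset.range (v ++ z).length := hb
    replace h : (if a < z.length then a + v.length else a - z.length) =
      if b < z.length then b + v.length else b - z.length := h
    rw [Finset.mem_range, List.length_append] at ha hb
    split_ifs at h <;> omega
  · rw [diagram_strand (hv.append hz), diagram_strand (hz.shift.append (hv.mono N.le_succ))]
    have h1 : ∀ l : List ArrowEnd, (l.map fun x => ((x.1 + z.length, x.2) : ArrowEnd)).map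
        (fun x => ((if x.1 < z.length then x.1 + v.length else x.1 - z.length, x.2) : ArrowEnd)) =
        l := fun l => by
      rw [List.map_map]
      conv_rhs => rw [← List.map_id l]
      exact List.map_congr_left fun x _ => by simp
    have h2 : ∀ i, (ends i z).map
        (fun x => ((if x.1 < z.length then x.1 + v.length else x.1 - z.length, x.2) : ArrowEnd)) =
        (ends i z).map fun x => (x.1 + v.length, x.2) := fun i =>
      List.map_congr_left fun x hx => by rw [if_pos (lt_of_mem_wordEnds hx)]
    simp only [ends, wordEnds_append, List.map_flatMap, List.map_append, h1] at h2 ⊢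
    rw [flatMap_range_shift (fun i => ends i v)
      (fun i => (ends i z).map fun x => (x.1 + v.length, x.2)) _ (by
        rw [show wordEnds (fun y : SlotGen => y.1.1) 0 (shift z) = [] from ends_shift_zero z]
        rfl) (fun i => by
        rw [show wordEnds (fun y : SlotGen => y.1.1) (i + 1) (shift z) = _ from
          ends_shift_succ i z]), hv.ends_eq_nil le_rfl, List.append_nil]
    exact List.flatMap_congr fun i _ => by rw [h2]
  · replace ha : a ∈ Finset.range (v ++ z).length := ha
    rw [Finset.mem_range, List.length_append] at ha
    change wordSign (shift z ++ v) _ = wordSign (v ++ z) a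
    split_ifs with h
    · rw [wordSign_append_add _ _ (by rwa [length_shift]), wordSign_append_of_lt _ h,
        wordSign_shift]
    · obtain ⟨b, rfl⟩ := Nat.exists_eq_add_of_le' (not_lt.1 h)
      rw [Nat.add_sub_cancel, wordSign_append_of_lt _ (by omega),
        wordSign_append_add _ _ (by omega)]

theorem flatMap_range_append {β : Type*} (a b : ℕ → List β) (N : ℕ) (ha : ∀ i, N ≤ i → a i = [])
    (hb : ∀ i, i < N → b i = []) (K : ℕ) : (List.range K).flatMap (fun i => a i ++ b i) =
      (List.range K).flatMap a ++ (List.range K).flatMap b := by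
  induction K with
  | zero => rfl
  | succ K ih =>
    rw [List.range_succ]
    simp only [List.flatMap_append, ih, List.flatMap_cons, List.flatMap_nil, List.append_nil]
    rcases lt_or_ge K N with h | h
    · have : (List.range K).flatMap b = [] := by
        rw [List.flatMap_eq_nil_iff]
        exact fun i hi => hb i ((List.mem_range.1 hi).trans h)
      simp [this, hb K h]
    · simp [ha K h]

/-- Words on separated slots give juxtaposed diagrams. -/
theorem same_juxtapose {N : ℕ} {v z : SlotWord} (hv : v.Below N) (hz : z.Above N) :
    Same (z.diagram.attach v.diagram (.start z.diagram)) (diagram (v ++ z)) := by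
  obtain ⟨M, -, hvM, hzM⟩ := exists_below v z
  have hb : ∀ a, (2 * a + 1) / 2 = a := fun a => by omega
  have hm : ∀ a ∈ (z.diagram.attach v.diagram (.start z.diagram)).arrows,
      (∃ b < z.length, a = 2 * b) ∨ ∃ b < v.length, a = 2 * b + 1 := fun a ha => by
    rcases Finset.mem_union.1 ha with ha | ha
    · obtain ⟨b, h, rfl⟩ := Finset.mem_image.1 ha
      exact Or.inl ⟨b, Finset.mem_range.1 h, rfl⟩
    · obtain ⟨b, h, rfl⟩ := Finset.mem_image.1 ha
      exact Or.inr ⟨b, Finset.mem_range.1 h, rfl⟩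
  refine same_of_injOn (fun a => if a % 2 = 0 then a / 2 else a / 2 + z.length)
    (fun a ha b hb' h => ?_) (fun i => ?_) fun a ha => ?_
  · replace h : (if a % 2 = 0 then a / 2 else a / 2 + z.length) =
      if b % 2 = 0 then b / 2 else b / 2 + z.length := h
    rcases hm a ha with ⟨c, h1, rfl⟩ | ⟨c, h1, rfl⟩ <;>
      rcases hm b hb' with ⟨d, h2, rfl⟩ | ⟨d, h2, rfl⟩ <;> split_ifs at h <;> omega
  · rw [attach_start_strand, diagram_strand hvM, diagram_strand hzM,
      diagram_strand (hvM.append hzM)]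
    simp only [ends, wordEnds_append]
    rw [flatMap_range_append _ _ N (fun i hi => by rw [← ends, hv.ends_eq_nil hi]; rfl)
      fun i hi => hz.ends_eq_nil hi]
    simp only [List.map_append, List.map_flatMap, List.map_map]
    congr 1
    · refine List.flatMap_congr fun i _ => List.map_congr_left fun x _ => ?_
      have h1 : ¬ (2 * x.1 + 1) % 2 = 0 := by omega
      simp only [newEnd, Function.comp_apply, h1, if_false, hb]
    · refine List.flatMap_congr fun i _ => ?_
      conv_lhs => rw [← List.map_id (ends _ _)]
      exact List.map_congr_left fun x _ => by simp [oldEnd]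
  · rw [attach_start_sign]
    rcases hm a ha with ⟨b, h, rfl⟩ | ⟨b, h, rfl⟩
    · simp only [Nat.mul_mod_right, if_true, Nat.mul_div_cancel_left b two_pos]
      exact wordSign_append_of_lt v h
    · have h1 : ¬ (2 * b + 1) % 2 = 0 := by omega
      simp only [h1, if_false, hb]
      exact wordSign_append_add v z h

theorem lEquivalent_juxtapose {n N : ℕ} {v v' z : SlotWord} (hv : v.Below N) (hv' : v'.Below N)
    (hz : z.Above N) (h : LEquivalent n v.diagram v'.diagram) :
    LEquivalent n (diagram (v ++ z)) (diagram (v' ++ z)) :=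
  ((same_juxtapose hv hz).symm.equivalent.lEquivalent.trans (h.attach_start z.diagram)).trans
    (same_juxtapose hv' hz).equivalent.lEquivalent

end SlotWord

/-! ### Erasing colours in words. -/

section EraseColors

variable {Y : Type*}

theorem eraseColors_append (S : Finset ℕ) (v w : List ((Y × ℕ) × Bool)) :
    eraseColors S (v ++ w) = eraseColors S v ++ eraseColors S w := List.filter_append ..

theorem eraseColors_invRev (S : Finset ℕ) (w : List ((Y × ℕ) × Bool)) :
    eraseColors S (FreeGroup.invRev w) = FreeGroup.invRev (eraseColors S w) := by
  rw [eraseColors, FreeGroup.invRev, List.filter_reverse, List.filter_map]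
  rfl

theorem eraseColors_eraseColors (S T : Finset ℕ) (w : List ((Y × ℕ) × Bool)) :
    eraseColors S (eraseColors T w) = eraseColors (S ∪ T) w := by
  rw [eraseColors, eraseColors, eraseColors, List.filter_filter]
  exact List.filter_congr fun x _ => by simp

theorem eraseColors_empty (w : List ((Y × ℕ) × Bool)) : eraseColors ∅ w = w := by
  simp [eraseColors]

end EraseColors

/-! ### Sliding braids to high slots and separating colours. -/

namespace SlotWord

theorem eraseColors_shift (S : Finset ℕ) (w : SlotWord) :
    eraseColors S (shift w) = shift (eraseColors S w) := by
  rw [eraseColors, shift, List.filter_map]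
  rfl

theorem eraseColors_iterate_shift (S : Finset ℕ) (N : ℕ) (w : SlotWord) :
    eraseColors S (shift^[N] w) = shift^[N] (eraseColors S w) := by
  induction N with
  | zero => rfl
  | succ N ih => rw [Function.iterate_succ_apply', Function.iterate_succ_apply',
      eraseColors_shift, ih]

/-- The homomorphism that shifts slots. -/
def shiftHom : FreeGroup SlotGen →* FreeGroup SlotGen := FreeGroup.map fun y =>
  (⟨(y.1.1.1 + 1, y.1.1.2 + 1), fun h => y.1.2 (Nat.succ_injective h)⟩, y.2)

theorem mk_shift (w : SlotWord) : FreeGroup.mk (shift w) = shiftHom (FreeGroup.mk w) := rfl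

theorem iterate_shift_above (N : ℕ) (w : SlotWord) : Above N (shift^[N] w) := by
  induction N with
  | zero => exact fun x _ => ⟨Nat.zero_le _, Nat.zero_le _⟩
  | succ N ih =>
    rw [Function.iterate_succ_apply']
    intro x hx
    obtain ⟨y, hy, rfl⟩ := List.mem_map.1 hx
    exact ⟨Nat.succ_le_succ (ih y hy).1, Nat.succ_le_succ (ih y hy).2⟩

/-- The word `sᴺ⁻¹ v ⋯ s v * v`, where `s` is the shift. -/
def shiftProd (v : SlotWord) : ℕ → SlotWord
  | 0 => []
  | N + 1 => shift (shiftProd v N) ++ v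

theorem eraseColors_shiftProd (S : Finset ℕ) (v : SlotWord) (N : ℕ) :
    eraseColors S (shiftProd v N) = shiftProd (eraseColors S v) N := by
  induction N with
  | zero => rfl
  | succ N ih => rw [shiftProd, shiftProd, eraseColors_append, eraseColors_shift, ih]

/-- In one step `v z` closes up like `s(z) v`, and the latter is `v (v⁻¹ s(z) v)` in the free group.
Iterating this accumulates the conjugators into `shiftProd v N`. -/
theorem equivalent_conj_shift (v z : SlotWord) (N : ℕ) :
    Equivalent (diagram (v ++ z)) (diagram (v ++ (FreeGroup.invRev (shiftProd v N) ++
      (shift^[N] z ++ shiftProd v N)))) := by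
  induction N with
  | zero => exact equivalent_of_mk_eq (by simp [shiftProd])
  | succ N ih =>
    refine ih.trans ((same_shift _ _).equivalent.trans (equivalent_of_mk_eq ?_))
    rw [Function.iterate_succ_apply', shiftProd]
    simp only [← FreeGroup.mul_mk, mk_shift, ← FreeGroup.inv_mk, map_mul, map_inv]
    group

/-- A braid in the lower central series can be moved to high slots. -/
theorem exists_slide {n : ℕ} (hn : 1 ≤ n) (N d : ℕ) : ∀ m, n ≤ m + d → 1 ≤ m →
    ∀ v z : SlotWord, FreeGroup.mk z ∈ lowerCentralSubgroup (FreeGroup SlotGen) m →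
    ∃ z' : SlotWord, z'.Above N ∧
      (∀ S, LEquivalent n (diagram (eraseColors S (v ++ z))) (diagram (eraseColors S (v ++ z')))) ∧
      ∀ S, FreeGroup.mk (eraseColors S z) = 1 → FreeGroup.mk (eraseColors S z') = 1 := by
  induction d with
  | zero =>
    intro m hm _ v z hz
    -- Here `m ≥ n`, so `z` can be deleted, and so can every `eraseColors S z`, because erasing is a
    -- homomorphism.
    refine ⟨[], fun x hx => by simp at hx, fun S => ?_, fun S _ => rfl⟩
    rw [eraseColors_append, List.append_nil]
    refine lEquivalent_append hn _ (mem_lowerCentralSubgroup_of_le hm ?_)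
    rw [mk_eraseColors]
    exact map_mem_lowerCentralSubgroup _ hz
  | succ d ih =>
    intro m hm hm1 v z hz
    set g := shiftProd v N with hg
    set z₁ := shift^[N] z with hz₁
    -- The conjugate `g⁻¹ z₁ g` equals `z₁ z₂`, where `z₁` already lies on high slots and `z₂ =
    -- ⁅z₁⁻¹, g⁻¹⁆` is one step deeper than `z`.
    set z₂ : SlotWord := FreeGroup.invRev z₁ ++ (FreeGroup.invRev g ++ (z₁ ++ g)) with hz₂
    have hmk : ∀ (w : SlotWord) (M : ℕ) (i : ℕ),
        FreeGroup.mk w ∈ lowerCentralSubgroup (FreeGroup SlotGen) i →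
        FreeGroup.mk (shift^[M] w) ∈ lowerCentralSubgroup (FreeGroup SlotGen) i := by
      intro w M i hw
      induction M with
      | zero => exact hw
      | succ M ihM =>
        rw [Function.iterate_succ_apply', mk_shift]
        exact map_mem_lowerCentralSubgroup _ ihM
    have h2 : FreeGroup.mk z₂ ∈ lowerCentralSubgroup (FreeGroup SlotGen) (m + 1) := by
      have h3 : FreeGroup.mk z₂ = ⁅(FreeGroup.mk z₁)⁻¹, (FreeGroup.mk g)⁻¹⁆ := by
        simp only [hz₂, ← FreeGroup.mul_mk, ← FreeGroup.inv_mk, commutatorElement_def]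
        group
      rw [h3]
      exact commutator_mem_lowerCentralSubgroup (inv_mem (hmk z N m hz)) (Subgroup.mem_top _)
    -- Now `v ++ z₁` plays the role of `v`. No bound on its slots is needed, only on those of the
    -- result. One `z'` serves all `S` at once, since shifting, inverting and multiplying commute
    -- with erasing.
    obtain ⟨z', hz', hS, h1⟩ := ih (m + 1) (by omega) (by omega) (v ++ z₁) z₂ h2
    have hconj : ∀ S, FreeGroup.mk (eraseColors S z) = 1 →
        FreeGroup.mk (eraseColors S z₁) = 1 := fun S h => by
      rw [hz₁, eraseColors_iterate_shift]
      have : ∀ M, FreeGroup.mk (shift^[M] (eraseColors S z)) = 1 := fun M => by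
        induction M with
        | zero => exact h
        | succ M ihM => rw [Function.iterate_succ_apply', mk_shift, ihM, map_one]
      exact this N
    refine ⟨z₁ ++ z', (iterate_shift_above N z).append hz', fun S => ?_, fun S h => ?_⟩
    · have h3 := hS S
      rw [List.append_assoc v z₁ z'] at h3
      refine (Equivalent.lEquivalent ?_).trans h3
      simp only [eraseColors_append, hz₂, hz₁, hg, eraseColors_invRev, eraseColors_iterate_shift,
        eraseColors_shiftProd]
      refine (equivalent_conj_shift _ _ N).trans (equivalent_of_mk_eq ?_)
      simp only [← FreeGroup.mul_mk, ← FreeGroup.inv_mk]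
      group
    · rw [eraseColors_append, ← FreeGroup.mul_mk, hconj S h, one_mul]
      refine h1 S ?_
      simp only [hz₂, eraseColors_append, eraseColors_invRev, ← FreeGroup.mul_mk,
        ← FreeGroup.inv_mk, hconj S h]
      group

theorem Below.eraseColors {N : ℕ} {w : SlotWord} (h : w.Below N) (S : Finset ℕ) :
    SlotWord.Below N (eraseColors S w) := fun x hx => h x (List.mem_of_mem_filter hx)

theorem Above.eraseColors {N : ℕ} {w : SlotWord} (h : w.Above N) (S : Finset ℕ) :
    SlotWord.Above N (eraseColors S w) := fun x hx => h x (List.mem_of_mem_filter hx)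

/-- If erasing any non-empty set of the colours `0, …, n - 1` gives the same result, then so does
erasing no colour. -/
theorem lEquivalent_eraseColors {n : ℕ} (hn : 1 ≤ n) {w : SlotWord}
    (hw : ∀ S : Finset ℕ, S.Nonempty → S ⊆ Finset.range n →
      LEquivalent n (diagram (eraseColors S w)) (diagram (eraseColors (Finset.range n) w))) :
    LEquivalent n w.diagram (diagram (eraseColors (Finset.range n) w)) := by
  set R := Finset.range n with hR
  have hRn : R.Nonempty := ⟨0, Finset.mem_range.2 hn⟩
  -- The word is replaced by one whose erasures have the same classes and for which erasing any
  -- single colour below `j` equals erasing all colours in the free group, not just up to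
  -- equivalence of closures.
  have key : ∀ j ≤ n, ∃ y : SlotWord,
      (∀ S ⊆ R, LEquivalent n (diagram (eraseColors S w)) (diagram (eraseColors S y))) ∧
      ∀ c < j, FreeGroup.mk (eraseColors {c} y) = FreeGroup.mk (eraseColors R y) := by
    intro j
    induction j with
    | zero => exact fun _ => ⟨w, fun S _ => .refl _, fun c hc => absurd hc (Nat.not_lt_zero c)⟩
    | succ j ih =>
      intro hj
      obtain ⟨y, hy, hc⟩ := ih (by omega)
      have hjR : {j} ⊆ R := Finset.singleton_subset_iff.2 (Finset.mem_range.2 hj)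
      obtain ⟨N, -, hN, -⟩ := exists_below y y
      -- Splits `y` as `y_j (y_j⁻¹ y)`, with `y_j` the word without the colour `j`, and slides the
      -- second factor beyond all slots of `y`. Starting at depth 1, `n` rounds suffice.
      obtain ⟨z', hz', hS, h1⟩ := exists_slide hn N n 1 (by omega) le_rfl (eraseColors {j} y)
        (FreeGroup.invRev (eraseColors {j} y) ++ y) (Subgroup.mem_top _)
      -- For `c < j`, erasing `c` turns both `y_j` and `y` into `y_R`, by the induction hypothesis;
      -- for `c = j` both become `y_j`. So `y_j⁻¹ y` dies with each of these colours, and `z'`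
      -- inherits this.
      have hz1 : ∀ c < j + 1, FreeGroup.mk (eraseColors {c} z') = 1 := fun c hcj => by
        refine h1 _ ?_
        rw [eraseColors_append, eraseColors_invRev, eraseColors_eraseColors, ← FreeGroup.mul_mk,
          ← FreeGroup.inv_mk, inv_mul_eq_one]
        rcases Nat.lt_succ_iff_lt_or_eq.1 hcj with h | rfl
        · rw [hc c h, Finset.union_comm, ← eraseColors_eraseColors, mk_eraseColors, hc c h,
            ← mk_eraseColors, eraseColors_eraseColors, Finset.union_eq_right.2 hjR]
        · rw [Finset.union_self]
      have hzR : FreeGroup.mk (eraseColors R z') = 1 := by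
        rw [← Finset.union_eq_left.2 hjR, ← eraseColors_eraseColors, mk_eraseColors,
          hz1 j j.lt_succ_self, map_one]
      -- After erasing `S`, the low slots hold `y` without `S ∪ {j}`. This set is non-empty even if
      -- `S` is empty, so the assumption on `w` allows the exchange for `y_R` next to the high
      -- slots.
      refine ⟨eraseColors R y ++ z', fun S hSR => (hy S hSR).trans ?_, fun c hcj => ?_⟩
      · have h2 : Equivalent (diagram (eraseColors S y)) (diagram (eraseColors S
            (eraseColors {j} y ++ (FreeGroup.invRev (eraseColors {j} y) ++ y)))) := by
          refine equivalent_of_mk_eq ?_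
          rw [mk_eraseColors, mk_eraseColors]
          simp only [← FreeGroup.mul_mk, ← FreeGroup.inv_mk, mul_inv_cancel_left]
        refine (h2.lEquivalent.trans (hS S)).trans ?_
        rw [eraseColors_append, eraseColors_append]
        refine lEquivalent_juxtapose ((hN.eraseColors _).eraseColors _)
          ((hN.eraseColors _).eraseColors _) (hz'.eraseColors S) ?_
        rw [eraseColors_eraseColors, eraseColors_eraseColors, Finset.union_eq_right.2 hSR]
        have hT : S ∪ {j} ⊆ R := Finset.union_subset hSR hjR
        exact (hy _ hT).symm.trans ((hw _ ⟨j, by simp⟩ hT).trans (hy R subset_rfl))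
      · rw [eraseColors_append, eraseColors_append, ← FreeGroup.mul_mk, ← FreeGroup.mul_mk,
          hz1 c hcj, hzR, eraseColors_eraseColors, eraseColors_eraseColors,
          Finset.union_eq_right.2 (Finset.singleton_subset_iff.2
            (Finset.mem_range.2 (lt_of_lt_of_le hcj hj))), Finset.union_self]
  obtain ⟨y, hy, hc⟩ := key n le_rfl
  -- With `y_c = y_R` for all colours `c < n`, the element `y_R⁻¹ y` dies with each of the `n`
  -- colours; hence it lies in `Γ_n`.
  have h1 : FreeGroup.mk (FreeGroup.invRev (eraseColors R y) ++ y) ∈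
      lowerCentralSubgroup (FreeGroup SlotGen) n := by
    refine mem_lowerCentralSubgroup_of_killColors_eq_one fun c hcn => ?_
    rw [← mk_eraseColors, eraseColors_append, eraseColors_invRev, eraseColors_eraseColors,
      ← FreeGroup.mul_mk, ← FreeGroup.inv_mk, hc c hcn, Finset.union_eq_right.2
        (Finset.singleton_subset_iff.2 (Finset.mem_range.2 hcn)), inv_mul_cancel]
  have h2 := hy ∅ (Finset.empty_subset _)
  rw [eraseColors_empty, eraseColors_empty] at h2
  have h3 : Equivalent y.diagram
      (diagram (eraseColors R y ++ (FreeGroup.invRev (eraseColors R y) ++ y))) := by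
    refine equivalent_of_mk_eq ?_
    simp only [← FreeGroup.mul_mk, ← FreeGroup.inv_mk, mul_inv_cancel_left]
  exact ((h2.trans h3.lEquivalent).trans (lEquivalent_append hn _ h1)).trans
    (hy R subset_rfl).symm

end SlotWord

namespace GaussDiagram

/-! ## Gauss diagrams on the interval as words in slots -/

variable (D : GaussDiagram 1) (col : ℕ → ℕ)

/-- The letter of an arrow of a Gauss diagram on the interval: the slots are the positions of its
ends. -/
def letter (a : ℕ) : SlotGen × Bool :=
  ((if h : (D.strand 0).idxOf (a, false) ≠ (D.strand 0).idxOf (a, true) then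
    ⟨((D.strand 0).idxOf (a, false), (D.strand 0).idxOf (a, true)), h⟩
    else ⟨(0, 1), zero_ne_one⟩, col a), D.sign a = 1)

theorem letter_fst {a : ℕ} (ha : a ∈ D.arrows) : (D.letter col a).1.1.1 =
    ((D.strand 0).idxOf (a, false), (D.strand 0).idxOf (a, true)) := by
  have h : (D.strand 0).idxOf (a, false) ≠ (D.strand 0).idxOf (a, true) := fun h => by
    have h1 : (a, false) ∈ D.strand 0 := by
      obtain ⟨i, hi⟩ := D.exists_mem_strand (x := (a, false)) ha
      rwa [Subsingleton.elim i 0] at hi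
    simpa using (List.idxOf_inj h1).1 h
  rw [letter, dif_pos h]

/-- The position from the end of an entry in a list. -/
def positionFromEnd (a : ℕ) : List ℕ → ℕ
  | [] => 0
  | x :: L => if a = x then L.length else positionFromEnd a L

theorem positionFromEnd_lt {a : ℕ} {L : List ℕ} (h : a ∈ L) : positionFromEnd a L < L.length := by
  induction L with
  | nil => simp at h
  | cons x L ih =>
    rw [positionFromEnd, List.length_cons]
    split_ifs with h1
    · omega
    · exact (ih ((List.mem_cons.1 h).resolve_left h1)).trans (Nat.lt_succ_self _)

theorem positionFromEnd_injOn (L : List ℕ) :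
    Set.InjOn (fun a => positionFromEnd a L) {a | a ∈ L} := by
  induction L with
  | nil => exact fun a ha => by simp at ha
  | cons x L ih =>
    intro a ha b hb h
    simp only [positionFromEnd] at h
    split_ifs at h with h1 h2 h2
    · rw [h1, h2]
    · have := positionFromEnd_lt ((List.mem_cons.1 hb).resolve_left h2)
      omega
    · have := positionFromEnd_lt ((List.mem_cons.1 ha).resolve_left h1)
      omega
    · exact ih ((List.mem_cons.1 ha).resolve_left h1) ((List.mem_cons.1 hb).resolve_left h2) h

variable {D}

theorem ends_map_letter {L : List ℕ} (hL : L.Nodup) (hD : ∀ a ∈ L, a ∈ D.arrows) {i : ℕ}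
    (hi : i < (D.strand 0).length) : SlotWord.ends i (L.map (D.letter col)) =
      if (D.strand 0)[i].1 ∈ L then
        [(positionFromEnd (D.strand 0)[i].1 L, (D.strand 0)[i].2)] else [] := by
  induction L with
  | nil => rfl
  | cons x L ih =>
    have hx := hD x (by simp)
    have hmem : ∀ s, (x, s) ∈ D.strand 0 := fun s => by
      obtain ⟨i, hi⟩ := D.exists_mem_strand (x := (x, s)) hx
      rwa [Subsingleton.elim i 0] at hi
    have hidx : ∀ s, (D.strand 0).idxOf (x, s) = i ↔ (D.strand 0)[i] = (x, s) := fun s => by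
      constructor
      · rintro rfl
        exact List.getElem_idxOf _
      · intro h
        rw [← h]
        exact (D.nodup_strand 0).idxOf_getElem i hi
    rw [List.nodup_cons] at hL
    rw [SlotWord.ends, List.map_cons, wordEnds, letter_fst D col hx]
    have ih := ih hL.2 fun a ha => hD a (by simp [ha])
    rw [SlotWord.ends] at ih
    rw [ih]
    simp only [hidx, List.length_map]
    obtain ⟨a, s⟩ := (D.strand 0)[i]
    by_cases h : a = x
    · subst h
      cases s <;> simp [hL.1, positionFromEnd]
    · simp [h, positionFromEnd]

theorem wordSign_map_letter {L : List ℕ} {a : ℕ} (ha : a ∈ L) :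
    wordSign (L.map (D.letter col)) (positionFromEnd a L) = D.sign a := by
  induction L with
  | nil => simp at ha
  | cons x L ih =>
    rw [List.map_cons, wordSign, positionFromEnd, List.length_map]
    by_cases h1 : a = x
    · subst h1
      rw [if_pos rfl, if_pos rfl]
      rcases Int.units_eq_one_or (D.sign a) with h | h <;> simp [letter, h]
    · have h2 := (List.mem_cons.1 ha).resolve_left h1
      rw [if_neg h1, if_neg (positionFromEnd_lt h2).ne]
      exact ih h2

theorem mem_wordLabels_map_letter {L : List ℕ} (hL : L.Nodup) (S : Finset ℕ) {a : ℕ}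
    (ha : a ∈ L) : positionFromEnd a L ∈ wordLabels (fun y : SlotGen => y.2 ∈ S)
      (L.map (D.letter col)) ↔ col a ∈ S := by
  induction L with
  | nil => simp at ha
  | cons x L ih =>
    rw [List.nodup_cons] at hL
    have hlt : L.length ∉ wordLabels (fun y : SlotGen => y.2 ∈ S) (L.map (D.letter col)) :=
      fun h => by
        have := lt_of_mem_wordLabels h
        simp at this
    rw [List.map_cons, wordLabels, positionFromEnd, List.length_map]
    by_cases h1 : a = x
    · subst h1
      rw [if_pos rfl]
      split_ifs with h2
      · simpa [letter] using h2
      · simpa [letter, hlt] using h2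
    · have h3 := (List.mem_cons.1 ha).resolve_left h1
      have h4 := positionFromEnd_lt h3
      rw [if_neg h1]
      split_ifs
      · rw [Finset.mem_insert, or_iff_right h4.ne, ih hL.2 h3]
      · exact ih hL.2 h3

variable (D)

/-- Every Gauss diagram on the interval with coloured arrows is the diagram of a word. -/
theorem exists_slotWord : ∃ w : SlotWord, ∀ S : Finset ℕ,
    Equivalent (D.remove (D.arrows.filter fun a => col a ∈ S))
      (SlotWord.diagram (eraseColors S w)) := by
  -- Slots are positions on the interval, so each holds exactly one end, and the order of the
  -- letters in the word is immaterial.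
  set L := D.arrows.toList with hL
  have hLD : ∀ a, a ∈ L ↔ a ∈ D.arrows := fun a => Finset.mem_toList
  have hnd : L.Nodup := D.arrows.nodup_toList
  set w : SlotWord := L.map (D.letter col) with hw
  have hb : w.Below (D.strand 0).length := fun x hx => by
    obtain ⟨a, ha, rfl⟩ := List.mem_map.1 hx
    have ha := (hLD a).1 ha
    have hmem : ∀ s, (a, s) ∈ D.strand 0 := fun s => by
      obtain ⟨i, hi⟩ := D.exists_mem_strand (x := (a, s)) ha
      rwa [Subsingleton.elim i 0] at hi
    rw [letter_fst D col ha]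
    exact ⟨List.idxOf_lt_length_of_mem (hmem _), List.idxOf_lt_length_of_mem (hmem _)⟩
  have hs : w.diagram.strand 0 = (D.strand 0).map fun x => (positionFromEnd x.1 L, x.2) := by
    rw [SlotWord.diagram_strand hb, flatMap_range_eq_flatten_ofFn]
    have h1 : (List.ofFn fun i : Fin (D.strand 0).length => SlotWord.ends i w) =
        (D.strand 0).map fun x => [(positionFromEnd x.1 L, x.2)] := by
      refine List.ext_getElem (by simp) fun i hi _ => ?_
      rw [List.length_ofFn] at hi
      rw [List.getElem_ofFn, List.getElem_map]
      refine (ends_map_letter col hnd (fun a ha => (hLD a).1 ha) hi).trans (if_pos ?_)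
      exact (hLD _).2 (mem_arrows_of_mem_strand (List.getElem_mem hi))
    rw [h1, ← List.flatMap_def]
    exact List.map_eq_flatMap.symm
  refine ⟨w, fun S => ?_⟩
  have h1 : wordKeep (wordLabels (fun y : SlotGen => y.2 ∈ S) w) w = eraseColors S w :=
    wordKeep_wordLabels _ w
  have h2 := SlotWord.same_remove_diagram w (wordLabels (fun y : SlotGen => y.2 ∈ S) w)
  rw [h1] at h2
  refine Equivalent.trans (Same.equivalent ?_) h2.equivalent
  refine same_of_injOn (fun a => positionFromEnd a L) ((positionFromEnd_injOn L).mono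
    fun a ha => (hLD a).2 (Finset.mem_sdiff.1 ha).1) (fun i => ?_) fun a ha => ?_
  · obtain rfl : i = 0 := Subsingleton.elim _ _
    change (w.diagram.strand 0).filter _ = ((D.strand 0).filter _).map _
    rw [hs, List.filter_map]
    congr 1
    refine List.filter_congr fun x hx => ?_
    have h3 := mem_arrows_of_mem_strand hx
    simp only [Function.comp_apply, Finset.mem_filter, h3, true_and, hw,
      mem_wordLabels_map_letter col hnd S ((hLD _).2 h3)]
  · exact wordSign_map_letter col ((hLD a).2 (Finset.mem_sdiff.1 ha).1)

/-! ## Variations -/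

theorem remove_congr {k : ℕ} (D : GaussDiagram k) {S S' : Finset ℕ}
    (h : ∀ a ∈ D.arrows, a ∈ S ↔ a ∈ S') : D.remove S = D.remove S' :=
  ext_of_strand rfl fun i => List.filter_congr fun x hx => by
    simp only [h _ (mem_arrows_of_mem_strand hx)]

theorem TrivialUpToRII.equivalent_attach {k : ℕ} {T : GaussDiagram k} (h : T.TrivialUpToRII)
    (D : GaussDiagram 1) (e : StrandEmbedding D k) : Equivalent D (D.attach T e) := by
  obtain ⟨E, hE, h⟩ := h
  exact (same_attach_of_arrows_eq_empty hE e).equivalent.trans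
    ((RIIEquivalent.regularEquivalent h).symm.attach e)

theorem equivalent_attach_remove {k : ℕ} (D : GaussDiagram 1) (T : GaussDiagram k)
    (e : StrandEmbedding D k) (S : Finset ℕ) :
    Equivalent (D.attach (T.remove S) e) ((D.attach T e).remove (S.image fun a => 2 * a + 1)) := by
  rw [← attach_reorient D T, ← attach_remove, ← attach_reorient D (T.remove S)]
  exact ((same_reorient_remove T S e.reversed).attach e).equivalent

/-- The sets `A_c` become colours of the arrows of `D.attach T e`. Removing any non-empty family of
colours leaves a diagram equivalent to `D`, which is the situation of `lEquivalent_eraseColors`. -/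
theorem Variation.lEquivalent {n : ℕ} {D D' : GaussDiagram 1} (h : Variation (n + 1) D D') :
    LEquivalent (n + 1) D D' := by
  classical
  obtain ⟨k, T, e, ⟨A, hA, hdisj, htriv⟩, hD⟩ := h
  -- Arrows of `T` have odd labels in `D.attach T e`. The default colour `n + 1`, given to the
  -- arrows of `D` and to those of `T` in no `A_c`, is outside `0, …, n` and is never erased.
  let col : ℕ → ℕ := fun a =>
    if h : ∃ c : Fin (n + 1), a / 2 ∈ A c ∧ a % 2 = 1 then (h.choose : ℕ) else n + 1
  have hcol : ∀ (b : ℕ) (c : Fin (n + 1)), col (2 * b + 1) = c ↔ b ∈ A c := fun b c => by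
    have h1 : (2 * b + 1) / 2 = b := by omega
    have h2 : (2 * b + 1) % 2 = 1 := by omega
    simp only [col, h1, h2, and_true]
    split_ifs with h
    · constructor
      · intro h3
        rw [← Fin.ext h3]
        exact h.choose_spec
      · intro h3
        by_contra h4
        exact Finset.disjoint_left.1 (hdisj _ _ fun h5 => h4 (congrArg Fin.val h5))
          h.choose_spec h3
    · have := c.2
      exact ⟨fun h3 => by omega, fun h3 => absurd ⟨c, h3⟩ h⟩
  have hcol' : ∀ b, col (2 * b) = n + 1 := fun b =>
    dif_neg fun ⟨c, _, h⟩ => by omega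
  obtain ⟨w, hw⟩ := exists_slotWord (D.attach T e) col
  -- What is left of `T` without the colours in `S` disappears by RII moves, also after being
  -- attached.
  have key : ∀ S : Finset ℕ, S.Nonempty → S ⊆ Finset.range (n + 1) →
      Equivalent D (SlotWord.diagram (eraseColors S w)) := fun S hS hSn => by
    refine Equivalent.trans ?_ (hw S)
    let S' : Finset (Fin (n + 1)) := Finset.univ.filter fun c => (c : ℕ) ∈ S
    have hS' : S'.Nonempty := by
      obtain ⟨c, hc⟩ := hS
      exact ⟨⟨c, Finset.mem_range.1 (hSn hc)⟩, Finset.mem_filter.2 ⟨Finset.mem_univ _, hc⟩⟩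
    refine ((htriv S' hS').equivalent_attach D e).trans ?_
    refine (equivalent_attach_remove D T e (S'.biUnion A)).trans ?_
    rw [remove_congr (S' := (D.attach T e).arrows.filter fun a => col a ∈ S)]
    · exact .refl _
    intro a ha
    rw [Finset.mem_filter, and_iff_right ha, Finset.mem_image]
    obtain ⟨b, rfl | rfl⟩ := Nat.even_or_odd' a
    · rw [hcol']
      refine iff_of_false (fun ⟨c, _, h⟩ => by omega) fun h => ?_
      have := Finset.mem_range.1 (hSn h)
      omega
    · have h1 : (∃ a ∈ S'.biUnion A, 2 * a + 1 = 2 * b + 1) ↔ b ∈ S'.biUnion A :=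
        ⟨fun ⟨a, h, h'⟩ => by obtain rfl : a = b := by omega
                              exact h, fun h => ⟨b, h, rfl⟩⟩
      rw [h1, Finset.mem_biUnion]
      constructor
      · rintro ⟨c, hc, h⟩
        rw [(hcol b c).2 h]
        exact (Finset.mem_filter.1 hc).2
      · intro h
        have h2 := Finset.mem_range.1 (hSn h)
        exact ⟨⟨_, h2⟩, Finset.mem_filter.2 ⟨Finset.mem_univ _, h⟩, (hcol b ⟨_, h2⟩).1 rfl⟩
  have hR := key (Finset.range (n + 1)) ⟨0, by simp⟩ subset_rfl
  have h1 := SlotWord.lEquivalent_eraseColors (Nat.le_add_left 1 n) fun S hS hSn =>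
    ((key S hS hSn).symm.trans hR).lEquivalent
  have h2 := hw ∅
  rw [eraseColors_empty] at h2
  have h3 : (D.attach T e).remove ((D.attach T e).arrows.filter fun a => col a ∈ (∅ : Finset ℕ)) =
      D.attach T e := ext_of_strand rfl fun i => by simp [remove]
  rw [h3] at h2
  exact (hR.lEquivalent.trans h1.symm).trans (h2.symm.trans hD.equivalent).lEquivalent

theorem NEquivalent.lEquivalent {n : ℕ} {D D' : GaussDiagram 1} (h : NEquivalent n D D') :
    LEquivalent (n + 1) D D' := by
  induction h with
  | rel _ _ h =>
    rcases h with h | h | h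
    · exact .rel _ _ (Or.inl h)
    · exact .rel _ _ (Or.inr (Or.inl h))
    · exact h.lEquivalent
  | refl => exact .refl _
  | symm _ _ _ ih => exact ih.symm
  | trans _ _ _ _ _ ih ih' => exact ih.trans ih'

end GaussDiagram

theorem mainTheorem1 (n : ℕ) (hn : 1 ≤ n) (K K' : LongVirtualKnot) :
    LongVirtualKnot.LEquivalent n K K' ↔ LongVirtualKnot.NEquivalent (n - 1) K K' := by
  obtain ⟨m, rfl⟩ := Nat.exists_eq_add_of_le' hn
  induction K using Quotient.inductionOn with
  | h D =>
    induction K' using Quotient.inductionOn with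
    | h D' => exact ⟨fun h => GaussDiagram.LEquivalent.nEquivalent h,
        fun h => GaussDiagram.NEquivalent.lEquivalent h⟩
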